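/- Let $q$ be a prime power, and for a non-zero $A \in \mathbb{F}_q[t]$ write $|A| = q^{\deg A}$. Let $Q \in \mathbb{F}_q[t]$ be a monic irreducible polynomial, let $\phi(Q)$ be the number of units of $\mathbb{F}_q[t]/(Q)$, and let $\chi_0$ be the trivial Dirichlet character modulo $Q$. For a Dirichlet character $\chi \neq \chi_0$ modulo $Q$ let $L(s,\chi)$ be the analytic continuation to $\mathbb{C}$ of $\sum_{A \text{ monic}} \chi(A) |A|^{-s}$ (which converges for $\operatorname{Re} s > 1$), and let $L^{(k)}(s,\chi)$ be its $k$-th derivative in $s$. For integers $i \geq 0$ put $$f_i(x,y,z) = x^i y^i + (z-x)^i (z-y)^i .$$ Then for all non-negative integers $k, l$, $$\frac{1}{\phi(Q)} \frac{1}{(\log q)^{2k+2l}} \sum_{\substack{\chi \bmod Q \\ \chi \neq \chi_0}} \Big| L^{(k)}\Big(\frac12,\chi\Big)\Big|^2 \Big| L^{(l)}\Big(\frac12,\chi\Big)\Big|^2$$ $$= (1-q^{-1}) (\deg Q)^{2k+2l+4} \int_{\substack{a_1,a_2,a_3,a_4 \geq 0 \\ 2a_1+a_3+a_4<1 \\ 2a_2+a_3+a_4<1}}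 f_k(a_1+a_3, a_1+a_4, 1)\, f_l(a_2+a_4, a_2+a_3, 1)\, \mathrm{d}a_1 \mathrm{d}a_2 \mathrm{d}a_3 \mathrm{d}a_4 + O_{k,l}\Big((\deg Q)^{2k+2l+\frac72}\Big)$$ as $\deg Q \to \infty$. That is, there are $C$ and $N$ depending only on $k$ and $l$ (not on $q$ or $Q$) such that the error is at most $C (\deg Q)^{2k+2l+7/2}$ in absolute value for all prime powers $q$ and all monic irreducible $Q \in \mathbb{F}_q[t]$ with $\deg Q \geq N$. -/

import Mathlib

open Polynomial

namespace FourthMoment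

variable {F : Type*} [Field F]

/-- Dirichlet characters of modulus `Q` on `F[t]`, seen as multiplicative characters of the
quotient ring `F[t] / Q F[t]` (extended by zero to the non-units). The unit `1` of this group is
the trivial character. -/
abbrev DirichletChar (Q : F[X]) : Type _ :=
  MulChar (F[X] ⧸ Ideal.span {Q}) ℂ

/-- The value `χ(A)` of a Dirichlet character of modulus `Q` at a polynomial `A`. -/
noncomputable def DirichletChar.value {Q : F[X]} (χ : DirichletChar Q) (A : F[X]) : ℂ :=
  χ (Ideal.Quotient.mk (Ideal.span {Q}) A)

/-- Euler's totient `φ(Q)`, the number of units of `F[t] / Q F[t]`. -/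
noncomputable def totient (Q : F[X]) : ℕ :=
  Nat.card (F[X] ⧸ Ideal.span {Q})ˣ

/-- The term `χ(A) / |A|^s` of the Dirichlet series, where `|A| = q ^ deg A` and `q = #F`
(only used for non-zero `A`). -/
noncomputable def seriesTerm {Q : F[X]} (χ : DirichletChar Q) (s : ℂ) (A : F[X]) : ℂ :=
  χ.value A / ((Nat.card F ^ A.natDegree : ℕ) : ℂ) ^ s

/-- `g` is an entire function that for `Re s > 1` is the sum, over all monic `A`, of the series of
the `χ(A) / |A|^s`. There is at most one such `g`. -/
def IsEntireLFunction {Q : F[X]} (χ : DirichletChar Q) (g : ℂ → ℂ) : Prop :=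
  Differentiable ℂ g ∧
    ∀ s : ℂ, 1 < s.re → HasSum (fun A : {A : F[X] // A.Monic} => seriesTerm χ s A.1) (g s)

open Classical in
/-- The Dirichlet `L`-function `s ↦ L(s, χ)` of a non-trivial character, continued analytically
to the whole plane. (The default value `0` is never taken for a non-trivial character of monic
modulus over a finite field, see `isEntireLFunction_LFunction`.) -/
noncomputable def LFunction {Q : F[X]} (χ : DirichletChar Q) : ℂ → ℂ :=
  if h : ∃ g : ℂ → ℂ, IsEntireLFunction χ g then h.choose else 0

/-- `f_i(x, y, z) = x^i y^i + (z - x)^i (z - y)^i`. -/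
def f (i : ℕ) (x y z : ℝ) : ℝ :=
  x ^ i * y ^ i + (z - x) ^ i * (z - y) ^ i

/-- The region `a_i ≥ 0`, `2 a_1 + a_3 + a_4 < 1`, `2 a_2 + a_3 + a_4 < 1` (indices shifted
by one). -/
def region : Set (Fin 4 → ℝ) :=
  {a | (∀ i, 0 ≤ a i) ∧ 2 * a 0 + a 2 + a 3 < 1 ∧ 2 * a 1 + a 2 + a 3 < 1}

/-! ### The definitions above make sense: finiteness and analytic continuation -/

theorem finite_quotient [Finite F] {Q : F[X]} (hQ : Q.Monic) :
    Finite (F[X] ⧸ Ideal.span {Q}) := by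
  have := hQ.finite_quotient
  exact Module.finite_of_finite F

theorem finite_dirichletChar [Finite F] {Q : F[X]} (hQ : Q.Monic) :
    Finite (DirichletChar Q) := by
  have := finite_quotient hQ
  infer_instance

theorem norm_value_le_one [Finite F] {Q : F[X]} (hQ : Q.Monic) (χ : DirichletChar Q) (A : F[X]) :
    ‖χ.value A‖ ≤ 1 := by
  have := finite_quotient hQ
  unfold DirichletChar.value
  by_cases h : IsUnit (Ideal.Quotient.mk (Ideal.span {Q}) A)
  · have hf : IsOfFinOrder (χ (Ideal.Quotient.mk (Ideal.span {Q}) A)) := by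
      have h1 : IsOfFinOrder h.unit := isOfFinOrder_of_finite _
      have h2 := MonoidHom.isOfFinOrder (Units.coeHom _) h1
      have h3 := MonoidHom.isOfFinOrder (χ.toMonoidHom) h2
      simpa using h3
    exact hf.norm_eq_one.le
  · rw [χ.map_nonunit h]; simp

/-- The monic polynomials of degree `n`. -/
abbrev MonicDeg (F : Type*) [Field F] (n : ℕ) : Type _ :=
  {A : {A : F[X] // A.Monic} // A.1.natDegree = n}

theorem card_monicDeg [Finite F] (n : ℕ) :
    Finite (MonicDeg F n) ∧ Nat.card (MonicDeg F n) = Nat.card F ^ n := by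
  have e : MonicDeg F n ≃ (Fin n → F) :=
    ((Equiv.subtypeSubtypeEquivSubtypeInter (fun A : F[X] => A.Monic)
      (fun A => A.natDegree = n)).trans (monicEquivDegreeLT n)).trans (degreeLTEquiv F n).toEquiv
  refine ⟨Finite.of_equiv _ e.symm, ?_⟩
  rw [Nat.card_congr e, Nat.card_fun, Nat.card_fin]

theorem sum_monicDeg_eq_zero [Finite F] {Q : F[X]} (hQ : Q.Monic) {χ : DirichletChar Q}
    (hχ : χ ≠ 1) {n : ℕ} (hn : Q.natDegree ≤ n) [Fintype (MonicDeg F n)] :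
    ∑ A : MonicDeg F n, χ.value A.1.1 = 0 := by
  have := finite_quotient hQ
  have := Fintype.ofFinite (F[X] ⧸ Ideal.span {Q})
  rcases eq_or_ne Q 1 with rfl | hQ1
  · -- the quotient is trivial, so every character is
    exfalso
    apply hχ
    ext x
    have hs : Subsingleton (F[X] ⧸ Ideal.span {(1 : F[X])}) := by
      rw [Ideal.Quotient.subsingleton_iff, Ideal.span_singleton_one]
    rw [Subsingleton.elim (x : F[X] ⧸ Ideal.span {(1 : F[X])}) 1, map_one, map_one]
  have hrep : ∀ x : F[X] ⧸ Ideal.span {Q}, ∃ r : F[X],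
      r.natDegree < Q.natDegree ∧ Ideal.Quotient.mk (Ideal.span {Q}) r = x := by
    intro x
    obtain ⟨r, rfl⟩ := Ideal.Quotient.mk_surjective x
    refine ⟨r %ₘ Q, natDegree_modByMonic_lt r hQ hQ1, ?_⟩
    rw [Ideal.Quotient.eq, Ideal.mem_span_singleton]
    refine ⟨-(r /ₘ Q), ?_⟩
    linear_combination (modByMonic_add_div r Q)
  have hshift : ∀ r : F[X], r.natDegree < Q.natDegree → ∀ A : MonicDeg F n,
      (A.1.1 + r).Monic ∧ (A.1.1 + r).natDegree = n := by
    intro r hr A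
    have hlt : r.natDegree < A.1.1.natDegree := by rw [A.2]; omega
    exact ⟨A.1.2.add_of_left (degree_lt_degree hlt),
      (natDegree_add_eq_left_of_natDegree_lt hlt).trans A.2⟩
  have htrans : ∀ r : F[X], r.natDegree < Q.natDegree →
      ∑ A : MonicDeg F n, χ.value A.1.1 = ∑ A : MonicDeg F n, χ.value (A.1.1 + r) := by
    intro r hr
    have hr' : (-r).natDegree < Q.natDegree := by rwa [natDegree_neg]
    let e : MonicDeg F n ≃ MonicDeg F n :=
      { toFun := fun A => ⟨⟨A.1.1 + r, (hshift r hr A).1⟩, (hshift r hr A).2⟩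
        invFun := fun A => ⟨⟨A.1.1 + -r, (hshift (-r) hr' A).1⟩, (hshift (-r) hr' A).2⟩
        left_inv := fun A => by ext1; ext1; simp
        right_inv := fun A => by ext1; ext1; simp }
    exact (e.sum_comp fun A : MonicDeg F n => χ.value A.1.1).symm
  choose r hr hrx using hrep
  have hcard : (Fintype.card (F[X] ⧸ Ideal.span {Q}) : ℂ) *
      ∑ A : MonicDeg F n, χ.value A.1.1 = 0 := by
    calc (Fintype.card (F[X] ⧸ Ideal.span {Q}) : ℂ) * ∑ A : MonicDeg F n, χ.value A.1.1
        = ∑ x : F[X] ⧸ Ideal.span {Q}, ∑ A : MonicDeg F n, χ.value (A.1.1 + r x) := by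
          rw [← Finset.sum_congr rfl (fun x _ => htrans (r x) (hr x))]
          simp
      _ = ∑ A : MonicDeg F n, ∑ x : F[X] ⧸ Ideal.span {Q},
            χ (Ideal.Quotient.mk (Ideal.span {Q}) A.1.1 + x) := by
          rw [Finset.sum_comm]
          refine Finset.sum_congr rfl fun A _ => Finset.sum_congr rfl fun x _ => ?_
          rw [DirichletChar.value, map_add, hrx]
      _ = 0 := by
          refine Finset.sum_eq_zero fun A _ => ?_
          rw [← MulChar.sum_eq_zero_of_ne_one hχ]
          exact Equiv.sum_comp (Equiv.addLeft (Ideal.Quotient.mk (Ideal.span {Q}) A.1.1)) fun x => χ x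
  exact (mul_eq_zero.mp hcard).resolve_left (Nat.cast_ne_zero.mpr Fintype.card_ne_zero)

theorem exists_isEntireLFunction [Finite F] {Q : F[X]} (hQ : Q.Monic) {χ : DirichletChar Q}
    (hχ : χ ≠ 1) : ∃ g : ℂ → ℂ, IsEntireLFunction χ g := by
  classical
  have hfin : ∀ n, Finite (MonicDeg F n) := fun n => (card_monicDeg n).1
  have hft : ∀ n, Fintype (MonicDeg F n) := fun n => Fintype.ofFinite _
  have hq : 1 < Nat.card F := Finite.one_lt_card
  have hq0 : ∀ n, Nat.card F ^ n ≠ 0 := fun n => pow_ne_zero _ (by omega)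
  let e := Equiv.sigmaFiberEquiv (fun A : {A : F[X] // A.Monic} => A.1.natDegree)
  have hfib : ∀ (s : ℂ) (n : ℕ), ∑ A : MonicDeg F n, seriesTerm χ s A.1.1 =
      (∑ A : MonicDeg F n, χ.value A.1.1) / ((Nat.card F ^ n : ℕ) : ℂ) ^ s := by
    intro s n
    rw [Finset.sum_div]
    refine Finset.sum_congr rfl fun A _ => ?_
    rw [seriesTerm, A.2]
  refine ⟨fun s => ∑ n ∈ Finset.range Q.natDegree,
    (∑ A : MonicDeg F n, χ.value A.1.1) / ((Nat.card F ^ n : ℕ) : ℂ) ^ s, ?_, ?_⟩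
  · refine Differentiable.fun_sum fun n _ => ?_
    have hb : ((Nat.card F ^ n : ℕ) : ℂ) ≠ 0 := Nat.cast_ne_zero.mpr (hq0 n)
    intro s
    refine DifferentiableAt.div (differentiableAt_const _)
      (differentiableAt_id.const_cpow (Or.inl hb)) ?_
    rw [Ne, Complex.cpow_eq_zero_iff]
    exact fun h => hb h.1
  · intro s hs
    have hbound : ∀ A : {A : F[X] // A.Monic},
        ‖seriesTerm χ s A.1‖ ≤ ((Nat.card F ^ A.1.natDegree : ℕ) : ℝ) ^ (-s.re) := by
      intro A
      rw [seriesTerm, norm_div, Complex.norm_natCast_cpow_of_pos (Nat.pos_of_ne_zero (hq0 _)),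
        Real.rpow_neg (Nat.cast_nonneg _), div_eq_mul_inv]
      exact mul_le_of_le_one_left (by positivity) (norm_value_le_one hQ χ _)
    have hsum' : Summable fun A : {A : F[X] // A.Monic} =>
        ((Nat.card F ^ A.1.natDegree : ℕ) : ℝ) ^ (-s.re) := by
      refine e.summable_iff.mp ((summable_sigma_of_nonneg
        (fun x => Real.rpow_nonneg (Nat.cast_nonneg _) _)).mpr ?_)
      refine ⟨fun n => (hasSum_fintype _).summable, ?_⟩
      have hval : ∀ n : ℕ, (∑' A : MonicDeg F n,
          ((Nat.card F ^ A.1.1.natDegree : ℕ) : ℝ) ^ (-s.re)) =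
          ((Nat.card F : ℝ) ^ (1 - s.re)) ^ n := by
        intro n
        have h1 : ∀ A : MonicDeg F n, ((Nat.card F ^ A.1.1.natDegree : ℕ) : ℝ) ^ (-s.re) =
            ((Nat.card F ^ n : ℕ) : ℝ) ^ (-s.re) := fun A => by rw [A.2]
        have hpos : (0 : ℝ) < Nat.card F := by positivity
        rw [tsum_fintype, Finset.sum_congr rfl (fun A _ => h1 A), Finset.sum_const,
          Finset.card_univ, ← Nat.card_eq_fintype_card, (card_monicDeg n).2, nsmul_eq_mul]
        have hp : (0 : ℝ) < ((Nat.card F ^ n : ℕ) : ℝ) := by positivity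
        rw [← Real.rpow_one_add' hp.le (by linarith), Nat.cast_pow, ← sub_eq_add_neg,
          ← Real.rpow_natCast, ← Real.rpow_mul hpos.le, mul_comm, Real.rpow_mul hpos.le,
          Real.rpow_natCast]
      have hgeom : Summable fun n : ℕ => ((Nat.card F : ℝ) ^ (1 - s.re)) ^ n :=
        summable_geometric_of_lt_one (by positivity)
          (Real.rpow_lt_one_of_one_lt_of_neg (by exact_mod_cast hq) (by linarith))
      exact hgeom.congr fun n => (hval n).symm
    have hsum : Summable fun A : {A : F[X] // A.Monic} => seriesTerm χ s A.1 :=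
      Summable.of_norm_bounded hsum' hbound
    have h2 := (e.summable_iff.mpr hsum).hasSum.sigma fun n => hasSum_fintype _
    rw [show (∑' c, ((fun A : {A : F[X] // A.Monic} => seriesTerm χ s A.1) ∘ e) c) =
      ∑' A : {A : F[X] // A.Monic}, seriesTerm χ s A.1
      from e.tsum_eq (fun A : {A : F[X] // A.Monic} => seriesTerm χ s A.1)] at h2
    have h3 : HasSum (fun n : ℕ => ∑ A : MonicDeg F n, seriesTerm χ s A.1.1)
        (∑ n ∈ Finset.range Q.natDegree, ∑ A : MonicDeg F n, seriesTerm χ s A.1.1) := by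
      refine hasSum_sum_of_ne_finset_zero fun n hn => ?_
      rw [hfib, sum_monicDeg_eq_zero hQ hχ (by simpa using hn), zero_div]
    have h4 := HasSum.unique h2 h3
    simp only [hfib] at h4
    have h5 := hsum.hasSum
    rw [h4] at h5
    exact h5

/-- For a non-trivial character of monic modulus, `LFunction χ` is the analytic continuation. -/
theorem isEntireLFunction_LFunction [Finite F] {Q : F[X]} (hQ : Q.Monic) {χ : DirichletChar Q}
    (hχ : χ ≠ 1) : IsEntireLFunction χ (LFunction χ) := by
  have h := exists_isEntireLFunction hQ hχ
  rw [LFunction, dif_pos h]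
  exact h.choose_spec

end FourthMoment

namespace FourthMoment

variable {F : Type*} [Field F]

/-! ### Monic polynomials of given degree -/

/-! Write `deg Q = D + 1 = d`. For non-trivial `χ` the `L`-function is a polynomial in `q ^ (-s)` of
degree at most `D`, so up to sign its `k`-th derivative at `1/2` is `(log q) ^ k` times `∑ n ^ k
ℓ_n`, where `ℓ_n` is `q ^ (-n/2)` times the sum of `χ` over the monic polynomials of degree `n`
(`LFunction_eq_sum`, `norm_iteratedDeriv_LFunction_sq`).

Finite Fourier analysis with Gauss sums gives `ℓ_n = ε ∑ κ(D - n - j) conj ℓ_j` over `j ≤ D - n`,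
with `|ε| = 1`. The kernel `κ` is a unit mass at `0` for odd `χ`; for even `χ` it decays
geometrically and still has total mass one (`functionalEquation_odd`, `functionalEquation_even`). In
the square of `∑ n ^ k ℓ_n`, reflecting the pairs with `i + j > D` leaves an exact sum of `ℓ_a conj
ℓ_b` over `a + b ≤ D` (`norm_sum_sq_eq_sum_weight`). As `κ` has mass one, the weight is close to `a
^ k b ^ k + (d - a) ^ k (d - b) ^ k`, the rescaled `f_k`, except when `a + b` is close to `D`
(`abs_weight_sub_limitWeight_le`).

Two such expansions are multiplied and averaged over `χ`. Odd and even characters have different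
kernels, so one needs orthogonality over all characters and over the even ones
(`sum_norm_sq_mul_norm_sq`). Both lead to counting monic solutions of `A C ≡ c B D` modulo `Q`, with
`c` a constant.

The solutions of `A C = B D` are `A = G R`, `B = G S`, `C = H S`, `D = H R` with `R`, `S` coprime.
The normalization cancels the number of choices exactly, leaving the density of coprime pairs, which
is `1 - 1/q` unless `R` or `S` is constant. The degrees `(g, h, r, s)` of `(G, H, R, S)` run over
the lattice points of `2 g + r + s ≤ D`, `2 h + r + s ≤ D`. Divided by `d` they form a Riemann sum
for the integral, with relative error `O(1/d)` (`abs_sum_diag_sub_le`, `abs_riemannSum_sub_le`).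

The off-diagonal is controlled by shifted divisor sums. Landreau's inequality and the divisor bound
show that it decays exponentially in `2 d - (i + j + u + v)`, up to a power of `d`
(`offCount_div_le`). This is useless when both `i + j` and `u + v` are close to `d`; there a
Cauchy-Schwarz argument bounds each whole moment by `d` (`norm_sum_normCoeff_product_le`). Switching
between the bounds at distance `d ^ (1/4)` from the edge gives the error `d ^ (2 k + 2 l + 7/2)`
(`sum_offBound_le`). Every estimate is uniform in `q`. -/

theorem finite_setOf_monic_natDegree (F : Type*) [Field F] [Finite F] (n : ℕ) :
    {A : F[X] | A.Monic ∧ A.natDegree = n}.Finite := by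
  have := (card_monicDeg (F := F) n).1
  refine Set.Finite.subset (Set.finite_range fun A : MonicDeg F n => A.1.1) ?_
  rintro A ⟨hA, hn⟩
  exact ⟨⟨⟨A, hA⟩, hn⟩, rfl⟩

/-- The finset of monic polynomials of degree `n`. -/
noncomputable def monics (F : Type*) [Field F] [Finite F] (n : ℕ) : Finset F[X] :=
  (finite_setOf_monic_natDegree F n).toFinset

@[simp]
theorem mem_monics [Finite F] {n : ℕ} {A : F[X]} :
    A ∈ monics F n ↔ A.Monic ∧ A.natDegree = n := by
  simp [monics]

theorem sum_monicDeg [Finite F] {M : Type*} [AddCommMonoid M] (n : ℕ) [Fintype (MonicDeg F n)]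
    (g : F[X] → M) : ∑ A : MonicDeg F n, g A.1.1 = ∑ A ∈ monics F n, g A := by
  refine Finset.sum_bij (fun A _ => A.1.1) (fun A _ => ?_) (fun A _ B _ h => ?_)
    (fun A hA => ?_) (fun _ _ => rfl)
  · exact mem_monics.mpr ⟨A.1.2, A.2⟩
  · exact Subtype.ext (Subtype.ext h)
  · rw [mem_monics] at hA
    exact ⟨⟨⟨A, hA.1⟩, hA.2⟩, Finset.mem_univ _, rfl⟩

theorem card_monics [Finite F] (n : ℕ) : (monics F n).card = Nat.card F ^ n := by
  classical
  have := (card_monicDeg (F := F) n).1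
  have := Fintype.ofFinite (MonicDeg F n)
  rw [← (card_monicDeg n).2, Finset.card_eq_sum_ones, ← sum_monicDeg n (fun _ => 1)]
  simp [Nat.card_eq_fintype_card]

theorem mul_mem_monics [Finite F] {m n : ℕ} {A B : F[X]} (hA : A ∈ monics F m)
    (hB : B ∈ monics F n) : A * B ∈ monics F (m + n) := by
  rw [mem_monics] at *
  exact ⟨hA.1.mul hB.1, by rw [hA.1.natDegree_mul hB.1, hA.2, hB.2]⟩

theorem of_mul_mem_monics [Finite F] {m n : ℕ} {A B : F[X]} (hA : A ∈ monics F m)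
    (hAB : A * B ∈ monics F n) : m ≤ n ∧ B ∈ monics F (n - m) := by
  rw [mem_monics] at *
  have hB : B.Monic := hA.1.of_mul_monic_left hAB.1
  have h := hA.1.natDegree_mul hB
  rw [hAB.2, hA.2] at h
  exact ⟨by omega, hB, by omega⟩

/-- The elements of `S` leave the same remainder on division by `M`, so each is determined by its
quotient, a monic polynomial of degree `n - deg M`. -/
theorem card_le_of_congr [Finite F] {M : F[X]} (hM : M.Monic) {n : ℕ} (hn : M.natDegree ≤ n)
    {S : Finset F[X]} (hS : S ⊆ monics F n) (hc : ∀ A ∈ S, ∀ B ∈ S, M ∣ A - B) :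
    S.card ≤ Nat.card F ^ (n - M.natDegree) := by
  classical
  rw [← card_monics (F := F) (n - M.natDegree)]
  refine Finset.card_le_card_of_injOn (fun A => A /ₘ M) (fun A hA => ?_) (fun A hA B hB h => ?_)
  · have := hS hA
    rw [mem_monics] at this
    rw [Finset.mem_coe, mem_monics, natDegree_divByMonic _ hM, this.2]
    refine ⟨?_, rfl⟩
    have hdeg : M.degree ≤ A.degree := by
      rw [degree_eq_natDegree hM.ne_zero, degree_eq_natDegree this.1.ne_zero, this.2]
      exact_mod_cast hn
    rw [Monic, leadingCoeff_divByMonic_of_monic hM hdeg]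
    exact this.1
  · have h1 := hc A hA B hB
    have h2 : A %ₘ M = B %ₘ M := by
      rw [← sub_eq_zero, ← sub_modByMonic, (modByMonic_eq_zero_iff_dvd hM).mpr h1]
    rw [← modByMonic_add_div A M, ← modByMonic_add_div B M, h2]
    simp only at h
    rw [h]

theorem two_le_card [Finite F] : 2 ≤ Nat.card F := Finite.one_lt_card

/-! ### The `L`-function as a Dirichlet polynomial -/

/-- The sum of `χ` over the monic polynomials of degree `n`. -/
noncomputable def coeffSum [Finite F] {Q : F[X]} (χ : DirichletChar Q) (n : ℕ) : ℂ :=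
  ∑ A ∈ monics F n, χ.value A

theorem coeffSum_eq_zero [Finite F] {Q : F[X]} (hQ : Q.Monic) {χ : DirichletChar Q}
    (hχ : χ ≠ 1) {n : ℕ} (hn : Q.natDegree ≤ n) : coeffSum χ n = 0 := by
  have := (card_monicDeg (F := F) n).1
  have := Fintype.ofFinite (MonicDeg F n)
  rw [coeffSum, ← sum_monicDeg n, sum_monicDeg_eq_zero hQ hχ hn]

theorem natCast_pow_cpow {q : ℕ} (hq : q ≠ 0) (n : ℕ) (s : ℂ) :
    (((q ^ n : ℕ) : ℂ) ^ s)⁻¹ = Complex.exp (-(n * Real.log q : ℝ) * s) := by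
  have h0 : ((q ^ n : ℕ) : ℂ) ≠ 0 := Nat.cast_ne_zero.mpr (pow_ne_zero _ hq)
  rw [Complex.cpow_def_of_ne_zero h0, ← Complex.exp_neg, ← Complex.ofReal_natCast,
    ← Complex.ofReal_log (Nat.cast_nonneg _), Nat.cast_pow, Real.log_pow]
  congr 1
  push_cast
  ring

/-- For `Re s > 1` the absolutely convergent series may be grouped by degree, and the groups of
degree at least `deg Q` vanish because `χ` is non-trivial. Both sides are entire, so the identity
theorem extends the equality. -/
theorem LFunction_eq_sum [Finite F] {Q : F[X]} (hQ : Q.Monic) {χ : DirichletChar Q}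
    (hχ : χ ≠ 1) : LFunction χ = fun s => ∑ n ∈ Finset.range Q.natDegree,
      coeffSum χ n * Complex.exp (-(n * Real.log (Nat.card F) : ℝ) * s) := by
  obtain ⟨hd, hs⟩ := isEntireLFunction_LFunction hQ hχ
  have hfin : ∀ n, Finite (MonicDeg F n) := fun n => (card_monicDeg n).1
  have hft : ∀ n, Fintype (MonicDeg F n) := fun n => Fintype.ofFinite _
  have hq : Nat.card F ≠ 0 := by have := two_le_card (F := F); omega
  let e := Equiv.sigmaFiberEquiv (fun A : {A : F[X] // A.Monic} => A.1.natDegree)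
  have hval : ∀ s : ℂ, 1 < s.re → LFunction χ s = ∑ n ∈ Finset.range Q.natDegree,
      coeffSum χ n * Complex.exp (-(n * Real.log (Nat.card F) : ℝ) * s) := by
    intro s h1
    have h2 := (e.hasSum_iff.mpr (hs s h1)).sigma fun n => hasSum_fintype _
    have hfib : ∀ n : ℕ, ∑ A : MonicDeg F n, seriesTerm χ s A.1.1 =
        coeffSum χ n * Complex.exp (-(n * Real.log (Nat.card F) : ℝ) * s) := by
      intro n
      rw [coeffSum, Finset.sum_mul, ← sum_monicDeg n]
      refine Finset.sum_congr rfl fun A _ => ?_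
      rw [seriesTerm, A.2, div_eq_mul_inv, natCast_pow_cpow hq]
    have h3 : HasSum (fun n : ℕ => ∑ A : MonicDeg F n, seriesTerm χ s A.1.1)
        (∑ n ∈ Finset.range Q.natDegree, ∑ A : MonicDeg F n, seriesTerm χ s A.1.1) := by
      refine hasSum_sum_of_ne_finset_zero fun n hn => ?_
      rw [hfib, coeffSum_eq_zero hQ hχ (by simpa using hn), zero_mul]
    have h4 := HasSum.unique h2 h3
    simp only [hfib] at h4
    exact h4
  have hd2 : Differentiable ℂ fun s : ℂ => ∑ n ∈ Finset.range Q.natDegree,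
      coeffSum χ n * Complex.exp (-(n * Real.log (Nat.card F) : ℝ) * s) := by
    fun_prop
  refine (hd.differentiableOn.analyticOnNhd isOpen_univ).eq_of_eventuallyEq
    (hd2.differentiableOn.analyticOnNhd isOpen_univ) (z₀ := 2) ?_
  have : {s : ℂ | 1 < s.re} ∈ nhds (2 : ℂ) :=
    (isOpen_lt continuous_const Complex.continuous_re).mem_nhds (by simp)
  filter_upwards [this] with s h1 using hval s h1

theorem iteratedDeriv_sum_mul_exp (t : Finset ℕ) (c a : ℕ → ℂ) (k : ℕ) :
    iteratedDeriv k (fun s => ∑ n ∈ t, c n * Complex.exp (a n * s)) =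
      fun s => ∑ n ∈ t, a n ^ k * (c n * Complex.exp (a n * s)) := by
  induction k with
  | zero => simp
  | succ k ih =>
    rw [iteratedDeriv_succ, ih]
    ext s
    refine HasDerivAt.deriv (HasDerivAt.fun_sum fun n _ => ?_)
    have h := (((hasDerivAt_id s).const_mul (a n)).cexp.const_mul (c n)).const_mul (a n ^ k)
    refine h.congr_deriv ?_
    simp only [id]
    ring

/-- The normalized coefficient `q ^ (-n / 2) ∑ χ(A)`, over monic `A` of degree `n`. -/
noncomputable def normCoeff [Finite F] {Q : F[X]} (χ : DirichletChar Q) (n : ℕ) : ℂ :=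
  ((Real.sqrt (Nat.card F) ^ n : ℝ) : ℂ)⁻¹ * coeffSum χ n

/-- Each differentiation multiplies the term of degree `n` by `-n log q`. This explains the power of
`log q` in the theorem and reduces it to sums with the weight `n ^ k`. -/
theorem norm_iteratedDeriv_LFunction_sq [Finite F] {Q : F[X]} (hQ : Q.Monic)
    {χ : DirichletChar Q} (hχ : χ ≠ 1) (k : ℕ) :
    ‖iteratedDeriv k (LFunction χ) (1 / 2)‖ ^ 2 = Real.log (Nat.card F) ^ (2 * k) *
      ‖∑ n ∈ Finset.range Q.natDegree, (((n : ℝ) ^ k : ℝ) : ℂ) * normCoeff χ n‖ ^ 2 := by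
  have hq : (0 : ℝ) < Nat.card F := by
    have := two_le_card (F := F); positivity
  rw [LFunction_eq_sum hQ hχ, iteratedDeriv_sum_mul_exp]
  have : ∀ n : ℕ, (-((n * Real.log (Nat.card F) : ℝ) : ℂ)) ^ k *
      (coeffSum χ n * Complex.exp (-(n * Real.log (Nat.card F) : ℝ) * (1 / 2))) =
      (-(Real.log (Nat.card F) : ℝ) : ℂ) ^ k * ((((n : ℝ) ^ k : ℝ) : ℂ) * normCoeff χ n) := by
    intro n
    have h1 : Complex.exp (-(n * Real.log (Nat.card F) : ℝ) * (1 / 2)) =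
        ((Real.sqrt (Nat.card F) ^ n : ℝ) : ℂ)⁻¹ := by
      rw [← Complex.ofReal_inv, ← Real.exp_log (Real.sqrt_pos.mpr hq), ← Real.exp_nat_mul,
        ← Real.exp_neg, Real.log_sqrt hq.le, Complex.ofReal_exp]
      congr 1
      push_cast
      ring
    rw [h1, normCoeff]
    push_cast
    ring
  simp only [this]
  rw [← Finset.mul_sum, norm_mul, mul_pow, norm_pow, norm_neg, Complex.norm_real, Real.norm_eq_abs,
    pow_right_comm, sq_abs, pow_mul]

/-! ### The functional equation -/

/-- For `a ≠ 0` this is the change of variable `x ↦ x / a`. For `a = 0` both sides vanish, which is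
where non-triviality enters. -/
theorem sum_mulChar_inv_mul_addChar {K : Type*} [Field K] [Fintype K] {χ : MulChar K ℂ}
    (hχ : χ ≠ 1) (ψ : AddChar K ℂ) (a : K) :
    ∑ x, χ⁻¹ x * ψ (x * a) = χ a * gaussSum χ⁻¹ ψ := by
  rcases eq_or_ne a 0 with rfl | ha
  · have := MulChar.sum_eq_zero_of_ne_one (inv_ne_one.mpr hχ)
    simp only [mul_zero, AddChar.map_zero_eq_one, mul_one, this, MulChar.map_zero, zero_mul]
  · have h := gaussSum_mulShift χ⁻¹ ψ (Units.mk0 a ha)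
    rw [← h, ← mul_assoc, Units.val_mk0, ← MulChar.mul_apply, mul_inv_cancel,
      MulChar.one_apply (isUnit_iff_ne_zero.mpr ha), one_mul, gaussSum]
    refine Finset.sum_congr rfl fun x _ => ?_
    rw [AddChar.mulShift_apply, mul_comm x a]

theorem norm_gaussSum_sq {K : Type*} [Field K] [Fintype K] {χ : MulChar K ℂ}
    (hχ : χ ≠ 1) {ψ : AddChar K ℂ} (hψ : ψ.IsPrimitive) :
    ‖gaussSum χ ψ‖ ^ 2 = Fintype.card K := by
  have h := gaussSum_mul_gaussSum_eq_card hχ hψ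
  have h2 := star_gaussSum_eq χ ψ
  rw [← h2] at h
  have h3 : ((‖gaussSum χ ψ‖ ^ 2 : ℝ) : ℂ) = (Fintype.card K : ℝ) := by
    rw [Complex.ofReal_natCast, ← h, Complex.ofReal_pow, ← Complex.mul_conj']
    rfl
  exact_mod_cast h3

/-- The coefficient of `t ^ (deg Q - 1)` of the reduced representative of a residue class. -/
noncomputable def topCoeff {Q : F[X]} (hQ : Q.Monic) : (F[X] ⧸ Ideal.span {Q}) →+ F :=
  ((lcoeff F (Q.natDegree - 1)).comp (AdjoinRoot.modByMonicHom hQ)).toAddMonoidHom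

theorem topCoeff_mk {Q : F[X]} (hQ : Q.Monic) (A : F[X]) :
    topCoeff hQ (Ideal.Quotient.mk (Ideal.span {Q}) A) = (A %ₘ Q).coeff (Q.natDegree - 1) :=
  rfl

theorem topCoeff_mk_of_lt {Q : F[X]} (hQ : Q.Monic) {A : F[X]}
    (hA : A.natDegree < Q.natDegree) :
    topCoeff hQ (Ideal.Quotient.mk (Ideal.span {Q}) A) = A.coeff (Q.natDegree - 1) := by
  rw [topCoeff_mk, (modByMonic_eq_self_iff hQ).mpr (degree_lt_degree hA)]

/-- The additive character of `F[t] / Q` induced from an additive character of `F`. -/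
noncomputable def residueAddChar {Q : F[X]} (hQ : Q.Monic) (ψ : AddChar F ℂ) :
    AddChar (F[X] ⧸ Ideal.span {Q}) ℂ :=
  ψ.compAddMonoidHom (topCoeff hQ)

theorem residueAddChar_mk_of_lt {Q : F[X]} (hQ : Q.Monic) (ψ : AddChar F ℂ) {A : F[X]}
    (hA : A.natDegree < Q.natDegree) :
    residueAddChar hQ ψ (Ideal.Quotient.mk (Ideal.span {Q}) A) =
      ψ (A.coeff (Q.natDegree - 1)) := by
  rw [residueAddChar, AddChar.compAddMonoidHom_apply, topCoeff_mk_of_lt hQ hA]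

theorem natDegree_C_mul_mul {c : F} (hc : c ≠ 0) {Y A : F[X]} (hY : Y.Monic) (hA : A.Monic) :
    (C c * Y * A).natDegree = Y.natDegree + A.natDegree := by
  rw [mul_assoc, natDegree_C_mul hc, hY.natDegree_mul hA]

/-- The product `c Y A` has degree `j + n` and leading coefficient `c`. So for `j + n < D` its
coefficient of `t ^ D` is `0`, and for `j + n = D` it is `c`. For `j + n > D` the shift of `A` by `b
t ^ (D - j)` permutes the monic polynomials of degree `n` and multiplies the sum by a value of `ψ`
other than `1`, so the sum vanishes. -/
theorem sum_residueAddChar_monics [Finite F] {Q : F[X]} (hQ : Q.Monic) {D : ℕ}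
    (hD : Q.natDegree = D + 1) {ψ : AddChar F ℂ} (hψ : ψ ≠ 1) {n j : ℕ} (hj : j ≤ D)
    {Y : F[X]} (hY : Y ∈ monics F j) (c : Fˣ) :
    ∑ A ∈ monics F n, residueAddChar hQ ψ (Ideal.Quotient.mk (Ideal.span {Q}) (C (c : F) * Y * A)) =
      if j + n < D then (Nat.card F : ℂ) ^ n else
        if j + n = D then (Nat.card F : ℂ) ^ n * ψ c else 0 := by
  rw [mem_monics] at hY
  have hdeg : ∀ A ∈ monics F n, (C (c : F) * Y * A).natDegree = j + n := by
    intro A hA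
    rw [mem_monics] at hA
    rw [natDegree_C_mul_mul c.ne_zero hY.1 hA.1, hY.2, hA.2]
  have hcard : ((monics F n).card : ℂ) = (Nat.card F : ℂ) ^ n := by
    rw [card_monics]; push_cast; rfl
  split_ifs with h1 h2
  · rw [← hcard, Finset.card_eq_sum_ones, Nat.cast_sum]
    refine Finset.sum_congr rfl fun A hA => ?_
    rw [residueAddChar_mk_of_lt hQ ψ (by rw [hdeg A hA]; omega), hD, Nat.add_sub_cancel,
      coeff_eq_zero_of_natDegree_lt (by rw [hdeg A hA]; omega), AddChar.map_zero_eq_one,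
      Nat.cast_one]
  · rw [← hcard, Finset.card_eq_sum_ones, Nat.cast_sum, Finset.sum_mul]
    refine Finset.sum_congr rfl fun A hA => ?_
    have hA' := mem_monics.mp hA
    rw [residueAddChar_mk_of_lt hQ ψ (by rw [hdeg A hA]; omega), hD, Nat.add_sub_cancel, ← h2,
      ← hdeg A hA, coeff_natDegree, leadingCoeff_mul, leadingCoeff_mul, hY.1.leadingCoeff,
      hA'.1.leadingCoeff, leadingCoeff_C, mul_one, mul_one, Nat.cast_one, one_mul]
  · obtain ⟨x, hx⟩ := AddChar.ne_one_iff.mp hψ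
    let b : F := (c : F)⁻¹ * x
    have hcb : (c : F) * b = x := by simp [b]
    have hb : b ≠ 0 := by
      rintro hb
      rw [hb, mul_zero] at hcb
      rw [← hcb] at hx
      exact hx (AddChar.map_zero_eq_one ψ)
    let v : F[X] := C b * X ^ (D - j)
    have hv : v.natDegree = D - j := natDegree_C_mul_X_pow _ _ hb
    have hmem : ∀ w : F[X], w.natDegree = D - j → ∀ A ∈ monics F n, A + w ∈ monics F n := by
      intro w hw A hA
      rw [mem_monics] at hA ⊢
      have hlt : w.natDegree < A.natDegree := by omega
      exact ⟨hA.1.add_of_left (degree_lt_degree hlt),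
        (natDegree_add_eq_left_of_natDegree_lt hlt).trans hA.2⟩
    have hshift : ∑ A ∈ monics F n,
        residueAddChar hQ ψ (Ideal.Quotient.mk (Ideal.span {Q}) (C (c : F) * Y * (A + v))) =
        ∑ A ∈ monics F n,
          residueAddChar hQ ψ (Ideal.Quotient.mk (Ideal.span {Q}) (C (c : F) * Y * A)) := by
      refine Finset.sum_bij' (fun A _ => A + v) (fun A _ => A + -v) (fun A hA => hmem v hv A hA)
        (fun A hA => hmem (-v) (by rw [natDegree_neg, hv]) A hA) (fun A _ => by ring)
        (fun A _ => by ring) (fun A _ => rfl)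
    have hψv : residueAddChar hQ ψ (Ideal.Quotient.mk (Ideal.span {Q}) (C (c : F) * Y * v)) =
        ψ x := by
      have h3 : (C (c : F) * Y * v) = C x * (Y * X ^ (D - j)) := by
        rw [← hcb, C_mul]; ring
      have h4 : (Y * X ^ (D - j)).Monic := hY.1.mul (monic_X_pow _)
      have h5 : (Y * X ^ (D - j)).natDegree = D := by
        rw [hY.1.natDegree_mul (monic_X_pow _), natDegree_X_pow, hY.2]; omega
      rw [residueAddChar_mk_of_lt hQ ψ, h3, coeff_C_mul, hD, Nat.add_sub_cancel]
      · nth_rewrite 2 [← h5]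
        rw [coeff_natDegree, h4.leadingCoeff, mul_one]
      · rw [h3]
        refine (natDegree_C_mul_le _ _).trans_lt ?_
        omega
    simp only [mul_add, map_add, AddChar.map_add_eq_mul, hψv] at hshift
    rw [← Finset.sum_mul] at hshift
    by_contra hne
    exact hx (mul_left_cancel₀ hne (hshift.trans (mul_one _).symm))

theorem isMaximal_span {Q : F[X]} (hi : Irreducible Q) : (Ideal.span {Q}).IsMaximal :=
  PrincipalIdealRing.isMaximal_of_irreducible hi

theorem mk_eq_mk_iff_of_natDegree_lt {Q A B : F[X]} (hA : A.natDegree < Q.natDegree)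
    (hB : B.natDegree < Q.natDegree) :
    Ideal.Quotient.mk (Ideal.span {Q}) A = Ideal.Quotient.mk (Ideal.span {Q}) B ↔ A = B := by
  refine ⟨fun h => ?_, fun h => by rw [h]⟩
  rw [Ideal.Quotient.eq, Ideal.mem_span_singleton] at h
  by_contra hne
  have h1 := natDegree_le_of_dvd h (sub_ne_zero.mpr hne)
  have h2 := natDegree_sub_le A B
  omega

theorem mk_ne_zero_of_natDegree_lt {Q A : F[X]} (hA : A ≠ 0) (h : A.natDegree < Q.natDegree) :
    Ideal.Quotient.mk (Ideal.span {Q}) A ≠ 0 := by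
  rw [← map_zero (Ideal.Quotient.mk (Ideal.span {Q})), Ne,
    mk_eq_mk_iff_of_natDegree_lt h (by rw [natDegree_zero]; omega)]
  exact hA

/-- Every non-zero residue class has a unique representative `c Y` with `c` a non-zero constant and
`Y` monic of degree at most `D`. -/
theorem sum_quotient_eq [Finite F] [Fintype Fˣ] {Q : F[X]} (hQ : Q.Monic) {D : ℕ}
    (hD : Q.natDegree = D + 1) [Fintype (F[X] ⧸ Ideal.span {Q})]
    (G : F[X] ⧸ Ideal.span {Q} → ℂ) (hG : G 0 = 0) :
    ∑ x, G x = ∑ j ∈ Finset.range (D + 1), ∑ Y ∈ monics F j, ∑ c : Fˣ,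
      G (Ideal.Quotient.mk (Ideal.span {Q}) (C (c : F) * Y)) := by
  classical
  have hsub : ∑ x, G x = ∑ x ∈ Finset.univ.filter (fun x => x ≠ 0), G x := by
    rw [Finset.sum_filter]
    refine Finset.sum_congr rfl fun x _ => ?_
    split_ifs with h
    · rfl
    · rw [not_not.mp h, hG]
  rw [hsub]
  simp_rw [← Finset.sum_product']
  rw [Finset.sum_sigma']
  symm
  refine Finset.sum_bij
    (fun p _ => Ideal.Quotient.mk (Ideal.span {Q}) (C (p.2.2 : F) * p.2.1)) ?_ ?_ ?_ ?_
  · rintro ⟨j, Y, c⟩ h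
    simp only [Finset.mem_sigma, Finset.mem_range, Finset.mem_product, mem_monics] at h
    simp only [Finset.mem_filter, Finset.mem_univ, true_and]
    refine mk_ne_zero_of_natDegree_lt (mul_ne_zero (C_ne_zero.mpr c.ne_zero) h.2.1.1.ne_zero) ?_
    rw [natDegree_C_mul c.ne_zero]; omega
  · rintro ⟨j, Y, c⟩ h ⟨j', Y', c'⟩ h' heq
    simp only [Finset.mem_sigma, Finset.mem_range, Finset.mem_product, mem_monics] at h h'
    simp only at heq
    rw [mk_eq_mk_iff_of_natDegree_lt (by rw [natDegree_C_mul c.ne_zero]; omega)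
      (by rw [natDegree_C_mul c'.ne_zero]; omega)] at heq
    have hc : (c : F) = c' := by
      have := congrArg leadingCoeff heq
      rwa [leadingCoeff_mul, leadingCoeff_mul, h.2.1.1.leadingCoeff, h'.2.1.1.leadingCoeff,
        leadingCoeff_C, leadingCoeff_C, mul_one, mul_one] at this
    rw [hc] at heq
    have hY : Y = Y' := mul_left_cancel₀ (C_ne_zero.mpr c'.ne_zero) heq
    obtain rfl := Units.ext hc
    subst hY
    obtain rfl : j = j' := by omega
    rfl
  · intro x hx
    simp only [Finset.mem_filter, Finset.mem_univ, true_and] at hx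
    obtain ⟨B, rfl⟩ := Ideal.Quotient.mk_surjective x
    have hB : Ideal.Quotient.mk (Ideal.span {Q}) B =
        Ideal.Quotient.mk (Ideal.span {Q}) (B %ₘ Q) := by
      rw [Ideal.Quotient.eq, Ideal.mem_span_singleton]
      exact ⟨B /ₘ Q, by linear_combination -modByMonic_add_div B Q⟩
    have hr0 : B %ₘ Q ≠ 0 := by
      intro h
      rw [hB, h, map_zero] at hx
      exact hx rfl
    have hrd : (B %ₘ Q).natDegree < D + 1 := by
      rw [← hD]
      refine natDegree_modByMonic_lt B hQ ?_
      rintro rfl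
      simp at hD
    have hl : (B %ₘ Q).leadingCoeff ≠ 0 := leadingCoeff_ne_zero.mpr hr0
    refine ⟨⟨(B %ₘ Q).natDegree, C (B %ₘ Q).leadingCoeff⁻¹ * (B %ₘ Q), Units.mk0 _ hl⟩, ?_, ?_⟩
    · simp only [Finset.mem_sigma, Finset.mem_range, Finset.mem_product, mem_monics,
        Finset.mem_univ, and_true]
      refine ⟨hrd, ?_, natDegree_C_mul (inv_ne_zero hl)⟩
      rw [mul_comm]
      exact monic_mul_leadingCoeff_inv hr0
    · simp only [Units.val_mk0]
      rw [← mul_assoc, ← C_mul, mul_inv_cancel₀ hl, C_1, one_mul, hB]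
  · intro _ _
    rfl

theorem value_mul {Q : F[X]} (χ : DirichletChar Q) (A B : F[X]) :
    χ.value (A * B) = χ.value A * χ.value B := by
  rw [DirichletChar.value, map_mul, map_mul]
  rfl

theorem value_inv [Finite F] {Q : F[X]} (hQ : Q.Monic) (χ : DirichletChar Q) (A : F[X]) :
    DirichletChar.value χ⁻¹ A = starRingEnd ℂ (χ.value A) := by
  have := finite_quotient hQ
  rw [DirichletChar.value, ← MulChar.star_eq_inv]
  rfl

theorem coeffSum_inv [Finite F] {Q : F[X]} (hQ : Q.Monic) (χ : DirichletChar Q) (n : ℕ) :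
    coeffSum χ⁻¹ n = starRingEnd ℂ (coeffSum χ n) := by
  rw [coeffSum, coeffSum, map_sum]
  exact Finset.sum_congr rfl fun A _ => value_inv hQ χ A

theorem card_quotient [Finite F] {Q : F[X]} (hQ : Q.Monic) :
    Nat.card (F[X] ⧸ Ideal.span {Q}) = Nat.card F ^ Q.natDegree := by
  have e := (AdjoinRoot.powerBasis' hQ).basis.equivFun.toEquiv
  have h := Nat.card_congr e
  rw [Nat.card_fun, Nat.card_fin, AdjoinRoot.powerBasis'_dim] at h
  exact h

theorem residueAddChar_ne_one {Q : F[X]} (hQ : Q.Monic) {D : ℕ} (hD : Q.natDegree = D + 1)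
    {ψ : AddChar F ℂ} (hψ : ψ ≠ 1) : residueAddChar hQ ψ ≠ 1 := by
  obtain ⟨x, hx⟩ := AddChar.ne_one_iff.mp hψ
  refine AddChar.ne_one_iff.mpr ⟨Ideal.Quotient.mk (Ideal.span {Q}) (C x * X ^ D), ?_⟩
  have := natDegree_C_mul_X_pow_le x D
  rw [residueAddChar_mk_of_lt hQ ψ (by omega), hD, Nat.add_sub_cancel, coeff_C_mul_X_pow, if_pos rfl]
  exact hx

/-- The unnormalized functional equation for both parities. Expand `χ(A)` times the Gauss sum as a
sum of `χ⁻¹(x) ψ(x A)` over residues `x`, write `x = c Y`, and sum over `A` first: by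
`sum_residueAddChar_monics` only `deg Y ≤ D - n` survives. -/
theorem coeffSum_mul_gaussSum [Finite F] [Fintype Fˣ] {Q : F[X]} (hQ : Q.Monic)
    (hi : Irreducible Q) {D : ℕ}
    (hD : Q.natDegree = D + 1) [Fintype (F[X] ⧸ Ideal.span {Q})] {χ : DirichletChar Q}
    (hχ : χ ≠ 1) {ψ : AddChar F ℂ} (hψ : ψ ≠ 1) {n : ℕ} (hn : n ≤ D) :
    coeffSum χ n * gaussSum χ⁻¹ (residueAddChar hQ ψ) =
      (Nat.card F : ℂ) ^ n * ∑ j ∈ Finset.range (D - n + 1), starRingEnd ℂ (coeffSum χ j) *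
        if j = D - n then ∑ c : Fˣ, starRingEnd ℂ (χ.value (C (c : F))) * ψ c
          else ∑ c : Fˣ, starRingEnd ℂ (χ.value (C (c : F))) := by
  have hmax := isMaximal_span hi
  let := Ideal.Quotient.field (Ideal.span {Q})
  have h1 : coeffSum χ n * gaussSum χ⁻¹ (residueAddChar hQ ψ) =
      ∑ x, χ⁻¹ x * ∑ A ∈ monics F n,
        residueAddChar hQ ψ (x * Ideal.Quotient.mk (Ideal.span {Q}) A) := by
    rw [coeffSum, Finset.sum_mul]
    simp only [Finset.mul_sum]
    rw [Finset.sum_comm]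
    refine Finset.sum_congr rfl fun A _ => ?_
    exact (sum_mulChar_inv_mul_addChar hχ (residueAddChar hQ ψ)
      (Ideal.Quotient.mk (Ideal.span {Q}) A)).symm
  have h0 : χ⁻¹ (0 : F[X] ⧸ Ideal.span {Q}) = 0 := MulChar.map_zero χ⁻¹
  rw [h1, sum_quotient_eq hQ hD _ (by rw [h0, zero_mul]), Finset.mul_sum]
  have hterm : ∀ j ∈ Finset.range (D + 1), ∑ Y ∈ monics F j, ∑ c : Fˣ,
      χ⁻¹ (Ideal.Quotient.mk (Ideal.span {Q}) (C (c : F) * Y)) * ∑ A ∈ monics F n,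
        residueAddChar hQ ψ (Ideal.Quotient.mk (Ideal.span {Q}) (C (c : F) * Y) *
          Ideal.Quotient.mk (Ideal.span {Q}) A) =
      if j ∈ Finset.range (D - n + 1) then
        (Nat.card F : ℂ) ^ n * (starRingEnd ℂ (coeffSum χ j) *
        if j = D - n then ∑ c : Fˣ, starRingEnd ℂ (χ.value (C (c : F))) * ψ c
          else ∑ c : Fˣ, starRingEnd ℂ (χ.value (C (c : F)))) else 0 := by
    intro j hj
    rw [Finset.mem_range] at hj
    have hY : ∀ Y ∈ monics F j, ∑ c : Fˣ,
      χ⁻¹ (Ideal.Quotient.mk (Ideal.span {Q}) (C (c : F) * Y)) * ∑ A ∈ monics F n,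
        residueAddChar hQ ψ (Ideal.Quotient.mk (Ideal.span {Q}) (C (c : F) * Y) *
          Ideal.Quotient.mk (Ideal.span {Q}) A) = DirichletChar.value χ⁻¹ Y *
        ∑ c : Fˣ, starRingEnd ℂ (χ.value (C (c : F))) * (if j + n < D then (Nat.card F : ℂ) ^ n else
        if j + n = D then (Nat.card F : ℂ) ^ n * ψ c else 0) := by
      intro Y hY
      rw [Finset.mul_sum]
      refine Finset.sum_congr rfl fun c _ => ?_
      rw [← sum_residueAddChar_monics hQ hD hψ (by omega) hY c]
      simp only [← map_mul]
      rw [← mul_assoc]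
      congr 1
      have := value_mul χ⁻¹ (C (c : F)) Y
      rw [value_inv hQ χ (C (c : F))] at this
      exact this.trans (mul_comm _ _)
    rw [Finset.sum_congr rfl hY, ← Finset.sum_mul, ← coeffSum_inv hQ]
    rw [show ∑ Y ∈ monics F j, DirichletChar.value χ⁻¹ Y = coeffSum χ⁻¹ j from rfl,
      mul_left_comm ((Nat.card F : ℂ) ^ n)]
    simp only [Finset.mem_range]
    rcases lt_trichotomy (j + n) D with h | h | h
    · rw [if_pos (by omega), if_neg (by omega : ¬ j = D - n)]
      congr 1
      simp only [if_pos h]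
      rw [← Finset.sum_mul, mul_comm]
    · rw [if_pos (by omega), if_pos (by omega : j = D - n)]
      congr 1
      simp only [if_neg (by omega : ¬ j + n < D), if_pos h]
      rw [Finset.mul_sum]
      exact Finset.sum_congr rfl fun c _ => by ring
    · rw [if_neg (by omega)]
      simp only [if_neg (by omega : ¬ j + n < D), if_neg (by omega : ¬ j + n = D), mul_zero,
        Finset.sum_const_zero]
  rw [Finset.sum_congr rfl hterm, Finset.sum_ite_mem]
  refine Finset.sum_congr ?_ fun _ _ => rfl
  ext j
  simp only [Finset.mem_inter, Finset.mem_range]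
  omega

/-- A character is even if it is trivial on the non-zero constants. -/
def IsEven {Q : F[X]} (χ : DirichletChar Q) : Prop :=
  ∀ c : Fˣ, χ.value (C (c : F)) = 1

/-- The restriction of a Dirichlet character to the constants. -/
noncomputable def restrictConst {Q : F[X]} (χ : DirichletChar Q) : MulChar F ℂ :=
  MulChar.ofUnitHom (χ.toUnitHom.comp
    (Units.map ((Ideal.Quotient.mk (Ideal.span {Q})).comp C : F →+* _).toMonoidHom))

theorem restrictConst_coe {Q : F[X]} (χ : DirichletChar Q) (c : Fˣ) :
    restrictConst χ c = χ.value (C (c : F)) := by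
  rw [restrictConst, MulChar.ofUnitHom_coe, MonoidHom.comp_apply, MulChar.coe_toUnitHom]
  rfl

theorem sum_mulChar_mul_eq_sum_units {K : Type*} [Field K] [Fintype K] [Fintype Kˣ]
    (χ : MulChar K ℂ) (g : K → ℂ) : ∑ x, χ x * g x = ∑ c : Kˣ, χ c * g c := by
  symm
  refine Fintype.sum_of_injective Units.val Units.val_injective _ _ (fun x hx => ?_)
    (fun c => rfl)
  rw [χ.map_nonunit (fun h => hx ⟨h.unit, rfl⟩), zero_mul]

theorem restrictConst_ne_one {Q : F[X]} {χ : DirichletChar Q} (h : ¬ IsEven χ) :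
    restrictConst χ ≠ 1 := by
  intro h1
  refine h fun c => ?_
  rw [← restrictConst_coe, h1, MulChar.one_apply_coe]

theorem isEven_inv [Finite F] {Q : F[X]} (hQ : Q.Monic) {χ : DirichletChar Q} :
    IsEven χ⁻¹ ↔ IsEven χ := by
  have h : ∀ χ : DirichletChar Q, IsEven χ → IsEven χ⁻¹ := fun χ h c => by
    rw [value_inv hQ, h, map_one]
  exact ⟨fun h1 => by simpa using h _ h1, h χ⟩

/-- The kernel of the functional equation of an even character. -/
noncomputable def evenKernel (q : ℕ) (e : ℕ) : ℝ :=
  if e = 0 then -(Real.sqrt q)⁻¹ else (q - 1) * (Real.sqrt q)⁻¹ * (Real.sqrt q ^ e)⁻¹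

/-- The kernel of the functional equation of an odd character. -/
def oddKernel (e : ℕ) : ℝ := if e = 0 then 1 else 0

theorem norm_gaussSum_residue [Finite F] {Q : F[X]} (hQ : Q.Monic)
    (hi : Irreducible Q) {D : ℕ}
    (hD : Q.natDegree = D + 1) [Fintype (F[X] ⧸ Ideal.span {Q})] {χ : DirichletChar Q}
    (hχ : χ ≠ 1) {ψ : AddChar F ℂ} (hψ : ψ ≠ 1) :
    ‖gaussSum χ⁻¹ (residueAddChar hQ ψ)‖ = Real.sqrt (Nat.card F) ^ (D + 1) := by
  have hmax := isMaximal_span hi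
  let := Ideal.Quotient.field (Ideal.span {Q})
  have h := norm_gaussSum_sq (K := F[X] ⧸ Ideal.span {Q}) (inv_ne_one.mpr hχ)
    (AddChar.IsPrimitive.of_ne_one (residueAddChar_ne_one hQ hD hψ))
  rw [← Nat.card_eq_fintype_card, card_quotient hQ, hD] at h
  have h2 : (Real.sqrt (Nat.card F) ^ (D + 1)) ^ 2 = ((Nat.card F ^ (D + 1) : ℕ) : ℝ) := by
    rw [pow_right_comm, Real.sq_sqrt (Nat.cast_nonneg _)]
    push_cast
    rfl
  exact (pow_left_inj₀ (norm_nonneg _) (by positivity) two_ne_zero).mp (h.trans h2.symm)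

/-- Division by the Gauss sum and by powers of `√q`, done once for both parities. The hypothesis
`hw` says that the weights, after normalization, depend on `D - n - j` only. -/
theorem normCoeff_eq_kernel_of_weights [Finite F] {Q : F[X]} {D : ℕ} {χ : DirichletChar Q}
    {g ε : ℂ} (hg : g ≠ 0) (kap : ℕ → ℝ) {n : ℕ} (w : ℕ → ℂ)
    (h : coeffSum χ n * g = (Nat.card F : ℂ) ^ n * ∑ j ∈ Finset.range (D - n + 1),
      starRingEnd ℂ (coeffSum χ j) * w j)
    (hw : ∀ j ≤ D - n, (Real.sqrt (Nat.card F) : ℂ) ^ (n + j) * w j = g * ε * kap (D - n - j)) :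
    normCoeff χ n = ε * ∑ j ∈ Finset.range (D - n + 1),
      (kap (D - n - j) : ℂ) * starRingEnd ℂ (normCoeff χ j) := by
  have hq : (0 : ℝ) < Nat.card F := by
    have := two_le_card (F := F); positivity
  have hr : (Real.sqrt (Nat.card F) : ℂ) ≠ 0 :=
    Complex.ofReal_ne_zero.mpr (Real.sqrt_pos.mpr hq).ne'
  have hr2 : (Nat.card F : ℂ) = (Real.sqrt (Nat.card F) : ℂ) ^ 2 := by
    rw [← Complex.ofReal_pow, Real.sq_sqrt hq.le, Complex.ofReal_natCast]
  refine mul_right_cancel₀ hg ?_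
  rw [normCoeff, mul_assoc, h, Finset.mul_sum, Finset.mul_sum, Finset.mul_sum, Finset.sum_mul]
  refine Finset.sum_congr rfl fun j hj => ?_
  rw [Finset.mem_range] at hj
  have h3 := hw j (by omega)
  rw [normCoeff, map_mul, map_inv₀, Complex.conj_ofReal, hr2, Complex.ofReal_pow,
    Complex.ofReal_pow]
  have h4 : ε * ((kap (D - n - j) : ℂ) * (((Real.sqrt (Nat.card F) : ℂ) ^ j)⁻¹ *
      starRingEnd ℂ (coeffSum χ j))) * g = (g * ε * kap (D - n - j)) *
      ((Real.sqrt (Nat.card F) : ℂ) ^ j)⁻¹ * starRingEnd ℂ (coeffSum χ j) := by ring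
  rw [h4, ← h3]
  field_simp
  ring

theorem exists_ne_one_addChar (F : Type*) [Field F] [Finite F] : ∃ ψ : AddChar F ℂ, ψ ≠ 1 := by
  obtain ⟨ψ, hψ⟩ := AddChar.exists_apply_ne_zero.mpr (one_ne_zero : (1 : F) ≠ 0)
  exact ⟨ψ, AddChar.ne_one_iff.mpr ⟨1, hψ⟩⟩

/-- A character that is non-trivial on the constants sums to zero over them, so only `j = D - n`
contributes, with a Gauss sum over `F` as its weight. -/
theorem functionalEquation_odd [Finite F] {Q : F[X]} (hQ : Q.Monic) (hi : Irreducible Q) {D : ℕ}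
    (hD : Q.natDegree = D + 1) {χ : DirichletChar Q} (hχ : χ ≠ 1) (ho : ¬ IsEven χ) :
    ∃ ε : ℂ, ‖ε‖ = 1 ∧ ∀ n ≤ D, normCoeff χ n = ε * ∑ j ∈ Finset.range (D - n + 1),
      (oddKernel (D - n - j) : ℂ) * starRingEnd ℂ (normCoeff χ j) := by
  have := finite_quotient hQ
  have := Fintype.ofFinite (F[X] ⧸ Ideal.span {Q})
  have := Fintype.ofFinite F
  have := Fintype.ofFinite Fˣ
  obtain ⟨ψ, hψ⟩ := exists_ne_one_addChar F
  have hq : (0 : ℝ) < Nat.card F := by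
    have := two_le_card (F := F); positivity
  have hs := Real.sqrt_pos.mpr hq
  have hg := norm_gaussSum_residue hQ hi hD hχ hψ
  set g := gaussSum χ⁻¹ (residueAddChar hQ ψ) with hgdef
  have hg0 : g ≠ 0 := by
    rw [← norm_pos_iff, hg]; positivity
  have hne := restrictConst_ne_one (fun h => ho ((isEven_inv hQ).mp h))
  set τ := ∑ c : Fˣ, starRingEnd ℂ (χ.value (C (c : F))) * ψ c with hτdef
  have hτ : ‖τ‖ = Real.sqrt (Nat.card F) := by
    have h1 : τ = gaussSum (restrictConst χ⁻¹) ψ := by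
      rw [gaussSum, sum_mulChar_mul_eq_sum_units]
      refine Finset.sum_congr rfl fun c _ => ?_
      rw [restrictConst_coe, value_inv hQ]
    rw [h1, ← Real.sqrt_sq (norm_nonneg _), norm_gaussSum_sq hne (AddChar.IsPrimitive.of_ne_one hψ),
      Nat.card_eq_fintype_card]
  have hσ : ∑ c : Fˣ, starRingEnd ℂ (χ.value (C (c : F))) = 0 := by
    rw [← MulChar.sum_eq_zero_of_ne_one hne]
    have := sum_mulChar_mul_eq_sum_units (restrictConst χ⁻¹) (fun _ => 1)
    simp only [mul_one] at this
    rw [this]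
    refine Finset.sum_congr rfl fun c _ => ?_
    rw [restrictConst_coe, value_inv hQ]
  -- The Gauss sums over `F` and over the residue field have absolute values `q ^ (1/2)` and `q ^
  -- ((D + 1)/2)`, so this number has absolute value one.
  refine ⟨(Real.sqrt (Nat.card F) : ℂ) ^ D * τ / g, ?_, fun n hn => ?_⟩
  · rw [norm_div, norm_mul, norm_pow, hτ, hg, Complex.norm_real, Real.norm_of_nonneg hs.le,
      ← pow_succ, div_self (by positivity)]
  · refine normCoeff_eq_kernel_of_weights hg0 oddKernel _
      (coeffSum_mul_gaussSum hQ hi hD hχ hψ hn) fun j hj => ?_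
    rw [← hτdef, hσ, oddKernel]
    rcases eq_or_ne j (D - n) with rfl | h
    · rw [if_pos rfl, if_pos (by omega), show n + (D - n) = D by omega]
      field_simp
      simp
    · rw [if_neg h, if_neg (by omega)]
      simp

/-- Here the sums over constants are `q - 1` for `j < D - n` and, at the endpoint `j = D - n`, the
sum of `ψ` over the non-zero constants, which is `-1`. This gives the two cases of `evenKernel`. -/
theorem functionalEquation_even [Finite F] {Q : F[X]} (hQ : Q.Monic) (hi : Irreducible Q) {D : ℕ}
    (hD : Q.natDegree = D + 1) {χ : DirichletChar Q} (hχ : χ ≠ 1) (he : IsEven χ) :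
    ∃ ε : ℂ, ‖ε‖ = 1 ∧ ∀ n ≤ D, normCoeff χ n = ε * ∑ j ∈ Finset.range (D - n + 1),
      (evenKernel (Nat.card F) (D - n - j) : ℂ) * starRingEnd ℂ (normCoeff χ j) := by
  have := finite_quotient hQ
  have := Fintype.ofFinite (F[X] ⧸ Ideal.span {Q})
  have := Fintype.ofFinite F
  have := Fintype.ofFinite Fˣ
  obtain ⟨ψ, hψ⟩ := exists_ne_one_addChar F
  have hq : (0 : ℝ) < Nat.card F := by
    have := two_le_card (F := F); positivity
  have hs := Real.sqrt_pos.mpr hq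
  have hr : (Real.sqrt (Nat.card F) : ℂ) ≠ 0 := Complex.ofReal_ne_zero.mpr hs.ne'
  have hg := norm_gaussSum_residue hQ hi hD hχ hψ
  set g := gaussSum χ⁻¹ (residueAddChar hQ ψ) with hgdef
  have hg0 : g ≠ 0 := by
    rw [← norm_pos_iff, hg]; positivity
  have hτ : ∑ c : Fˣ, starRingEnd ℂ (χ.value (C (c : F))) * ψ c = -1 := by
    rw [← gaussSum_one_left hψ, gaussSum, sum_mulChar_mul_eq_sum_units]
    refine Finset.sum_congr rfl fun c _ => ?_
    rw [he, map_one, MulChar.one_apply_coe]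
  have hσ : ∑ c : Fˣ, starRingEnd ℂ (χ.value (C (c : F))) = (Nat.card F : ℂ) - 1 := by
    have h1 : ∀ c : Fˣ, starRingEnd ℂ (χ.value (C (c : F))) = 1 := fun c => by rw [he, map_one]
    have h2 : Fintype.card Fˣ = Nat.card F - 1 := by
      rw [← Nat.card_eq_fintype_card, Nat.card_units]
    have := two_le_card (F := F)
    simp only [h1, Finset.sum_const, Finset.card_univ, h2, nsmul_eq_mul, mul_one]
    rw [Nat.cast_sub (by omega), Nat.cast_one]
  refine ⟨(Real.sqrt (Nat.card F) : ℂ) ^ (D + 1) / g, ?_, fun n hn => ?_⟩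
  · rw [norm_div, norm_pow, hg, Complex.norm_real, Real.norm_of_nonneg hs.le,
      div_self (by positivity)]
  · refine normCoeff_eq_kernel_of_weights hg0 (evenKernel (Nat.card F)) _
      (coeffSum_mul_gaussSum hQ hi hD hχ hψ hn) fun j hj => ?_
    rw [hτ, hσ, evenKernel]
    rcases eq_or_ne j (D - n) with rfl | h
    · rw [if_pos rfl, if_pos (by omega), show n + (D - n) = D by omega]
      push_cast
      field_simp
      ring
    · rw [if_neg h, if_neg (by omega)]
      push_cast
      rw [mul_div_cancel₀ _ hg0]
      have : D + 1 = (n + j) + (D - n - j) + 1 := by omega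
      rw [this]
      rw [pow_succ, pow_add]
      field_simp
      ring

/-! ### Squares of sums satisfying a functional equation -/

/-- The pairs `(a, b)` with `a + b ≤ D`. -/
def triangle (D : ℕ) : Finset (ℕ × ℕ) :=
  (Finset.range (D + 1) ×ˢ Finset.range (D + 1)).filter fun x => x.1 + x.2 ≤ D

theorem mem_triangle {D : ℕ} {x : ℕ × ℕ} : x ∈ triangle D ↔ x.1 + x.2 ≤ D := by
  simp only [triangle, Finset.mem_filter, Finset.mem_product, Finset.mem_range]
  omega

/-- The contribution to `weight` of the pairs reflected by the functional equation. -/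
def reflectedWeight (κ p : ℕ → ℝ) (D a b : ℕ) : ℝ :=
  ∑ i ∈ Finset.range (D + 1), ∑ j ∈ Finset.range (D + 1),
    if a ≤ i ∧ b ≤ j ∧ i + j < D then κ (i - a) * κ (j - b) * (p (D - i) * p (D - j)) else 0

/-- The coefficients of the approximate functional equation for `|∑ p(n) ℓ(n)| ^ 2`. -/
def weight (κ p : ℕ → ℝ) (D a b : ℕ) : ℝ :=
  p a * p b + reflectedWeight κ p D a b

/-- Reflection by the functional equation conjugates, hence exchanges the roles of `a` and `b`; the
symmetry undoes this. -/
theorem reflectedWeight_comm (κ p : ℕ → ℝ) (D a b : ℕ) :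
    reflectedWeight κ p D a b = reflectedWeight κ p D b a := by
  rw [reflectedWeight, reflectedWeight, Finset.sum_comm]
  refine Finset.sum_congr rfl fun i _ => Finset.sum_congr rfl fun j _ => ?_
  by_cases h : a ≤ j ∧ b ≤ i ∧ j + i < D
  · rw [if_pos h, if_pos (by omega)]
    ring
  · rw [if_neg h, if_neg (by omega)]

theorem reflectedWeight_eq_zero (κ p : ℕ → ℝ) {D a b : ℕ} (h : D ≤ a + b) :
    reflectedWeight κ p D a b = 0 :=
  Finset.sum_eq_zero fun i _ => Finset.sum_eq_zero fun j _ => if_neg (by omega)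

/-- An exact form of the approximate functional equation. Terms with `i + j ≤ D` are kept. In the
others, the functional equation is applied to both factors and `ε conj ε = 1` removes the root
number. The new indices satisfy `a ≤ i`, `b ≤ j` with `i + j < D`, so they lie in the triangle
again. -/
theorem norm_sum_sq_eq_sum_weight {D : ℕ} {ℓ : ℕ → ℂ} {κ : ℕ → ℝ} (p : ℕ → ℝ)
    (hFE : ∃ ε : ℂ, ‖ε‖ = 1 ∧ ∀ n ≤ D, ℓ n = ε * ∑ j ∈ Finset.range (D - n + 1),
      (κ (D - n - j) : ℂ) * starRingEnd ℂ (ℓ j)) :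
    ((‖∑ n ∈ Finset.range (D + 1), (p n : ℂ) * ℓ n‖ ^ 2 : ℝ) : ℂ) =
      ∑ x ∈ triangle D, (weight κ p D x.1 x.2 : ℂ) * (ℓ x.1 * starRingEnd ℂ (ℓ x.2)) := by
  obtain ⟨ε, hε, hFE⟩ := hFE
  have hε2 : ε * starRingEnd ℂ ε = 1 := by
    rw [Complex.mul_conj', hε]; simp
  set R := Finset.range (D + 1) with hR
  let K : ℕ → ℕ → ℂ := fun i a => if a ≤ i then (κ (i - a) : ℂ) else 0
  have hFE' : ∀ i ∈ R, ℓ (D - i) = ε * ∑ a ∈ R, K i a * starRingEnd ℂ (ℓ a) := by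
    intro i hi
    rw [hR, Finset.mem_range] at hi
    rw [hFE (D - i) (by omega), show D - (D - i) = i by omega]
    congr 1
    have hsub : Finset.range (i + 1) ⊆ R := Finset.range_subset_range.mpr (by omega)
    rw [← Finset.sum_subset hsub fun a _ ha => ?_]
    · refine Finset.sum_congr rfl fun a ha => ?_
      rw [Finset.mem_range] at ha
      simp only [K]
      rw [if_pos (by omega)]
    · rw [Finset.mem_range] at ha
      simp only [K]
      rw [if_neg (by omega), zero_mul]
  have hprod : ∀ i ∈ R, ∀ j ∈ R, ℓ (D - i) * starRingEnd ℂ (ℓ (D - j)) =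
      ∑ a ∈ R, ∑ b ∈ R, K i a * K j b * (starRingEnd ℂ (ℓ a) * ℓ b) := by
    intro i hi j hj
    have hK : ∀ j a, starRingEnd ℂ (K j a) = K j a := by
      intro j a
      simp only [K]
      split_ifs
      · exact Complex.conj_ofReal _
      · exact map_zero _
    rw [hFE' i hi, hFE' j hj, map_mul, map_sum, mul_mul_mul_comm, hε2, one_mul,
      Finset.sum_mul_sum]
    refine Finset.sum_congr rfl fun a _ => Finset.sum_congr rfl fun b _ => ?_
    rw [map_mul, hK, Complex.conj_conj]
    ring
  have hfull : ((‖∑ n ∈ R, (p n : ℂ) * ℓ n‖ ^ 2 : ℝ) : ℂ) =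
      ∑ i ∈ R, ∑ j ∈ R, (p i * p j : ℂ) * (ℓ i * starRingEnd ℂ (ℓ j)) := by
    rw [Complex.ofReal_pow, ← Complex.mul_conj', map_sum, Finset.sum_mul_sum]
    refine Finset.sum_congr rfl fun a _ => Finset.sum_congr rfl fun b _ => ?_
    rw [map_mul, Complex.conj_ofReal]
    ring
  have hsplit : ∑ i ∈ R, ∑ j ∈ R, (p i * p j : ℂ) * (ℓ i * starRingEnd ℂ (ℓ j)) =
      (∑ i ∈ R, ∑ j ∈ R, if i + j ≤ D then (p i * p j : ℂ) * (ℓ i * starRingEnd ℂ (ℓ j)) else 0) +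
      ∑ i ∈ R, ∑ j ∈ R, if i + j ≤ D then 0 else
        (p i * p j : ℂ) * (ℓ i * starRingEnd ℂ (ℓ j)) := by
    rw [← Finset.sum_add_distrib]
    refine Finset.sum_congr rfl fun a _ => ?_
    rw [← Finset.sum_add_distrib]
    refine Finset.sum_congr rfl fun b _ => ?_
    split_ifs <;> simp
  -- The inequality after reflection is strict because the line `i + j = D` is mapped to itself and
  -- has been kept in the first part.
  have hreflect : (∑ i ∈ R, ∑ j ∈ R, if i + j ≤ D then 0 else
        (p i * p j : ℂ) * (ℓ i * starRingEnd ℂ (ℓ j))) =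
      ∑ i ∈ R, ∑ j ∈ R, if i + j < D then
        (p (D - i) * p (D - j) : ℂ) * (ℓ (D - i) * starRingEnd ℂ (ℓ (D - j))) else 0 := by
    rw [hR, ← Finset.sum_range_reflect]
    refine Finset.sum_congr rfl fun i hi => ?_
    rw [← Finset.sum_range_reflect]
    refine Finset.sum_congr rfl fun j hj => ?_
    rw [Finset.mem_range] at hi hj
    simp only [Nat.add_sub_cancel]
    by_cases h : i + j < D
    · rw [if_pos h, if_neg (by omega)]
    · rw [if_neg h, if_pos (by omega)]
  have hexp : (∑ i ∈ R, ∑ j ∈ R, if i + j < D then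
        (p (D - i) * p (D - j) : ℂ) * (ℓ (D - i) * starRingEnd ℂ (ℓ (D - j))) else 0) =
      ∑ a ∈ R, ∑ b ∈ R, (reflectedWeight κ p D a b : ℂ) * (ℓ a * starRingEnd ℂ (ℓ b)) := by
    have h1 : (∑ i ∈ R, ∑ j ∈ R, if i + j < D then
        (p (D - i) * p (D - j) : ℂ) * (ℓ (D - i) * starRingEnd ℂ (ℓ (D - j))) else 0) =
        ∑ i ∈ R, ∑ j ∈ R, ∑ a ∈ R, ∑ b ∈ R, (if i + j < D then
        (p (D - i) * p (D - j) : ℂ) * (K i a * K j b * (starRingEnd ℂ (ℓ a) * ℓ b)) else 0) := by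
      refine Finset.sum_congr rfl fun i hi => Finset.sum_congr rfl fun j hj => ?_
      split_ifs
      · rw [hprod i hi j hj, Finset.mul_sum]
        exact Finset.sum_congr rfl fun a _ => Finset.mul_sum _ _ _
      · simp
    have h2 : ∑ a ∈ R, ∑ b ∈ R, (reflectedWeight κ p D a b : ℂ) * (ℓ a * starRingEnd ℂ (ℓ b)) =
        ∑ a ∈ R, ∑ b ∈ R, ∑ i ∈ R, ∑ j ∈ R, (if i + j < D then
        (p (D - i) * p (D - j) : ℂ) * (K i a * K j b * (starRingEnd ℂ (ℓ a) * ℓ b)) else 0) := by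
      rw [Finset.sum_comm]
      refine Finset.sum_congr rfl fun a _ => Finset.sum_congr rfl fun b _ => ?_
      rw [reflectedWeight_comm, reflectedWeight, Complex.ofReal_sum, Finset.sum_mul]
      refine Finset.sum_congr rfl fun i _ => ?_
      rw [Complex.ofReal_sum, Finset.sum_mul]
      refine Finset.sum_congr rfl fun j _ => ?_
      simp only [K]
      by_cases hc : i + j < D
      · by_cases ha : a ≤ i
        · by_cases hb : b ≤ j
          · rw [if_pos ⟨ha, hb, hc⟩, if_pos hc, if_pos ha, if_pos hb]
            push_cast
            ring
          · rw [if_neg (by omega), if_neg hb]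
            simp
        · rw [if_neg (by omega), if_neg ha]
          simp
      · rw [if_neg (by omega), if_neg hc]
        simp
    rw [h1, h2]
    have h3 : ∀ g : ℕ → ℕ → ℕ → ℕ → ℂ, ∑ i ∈ R, ∑ j ∈ R, ∑ a ∈ R, ∑ b ∈ R, g i j a b =
        ∑ a ∈ R, ∑ b ∈ R, ∑ i ∈ R, ∑ j ∈ R, g i j a b := by
      intro g
      have := Finset.sum_comm (s := R ×ˢ R) (t := R ×ˢ R) (f := fun x y => g x.1 x.2 y.1 y.2)
      simpa only [Finset.sum_product] using this
    exact h3 _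
  have htri : ∀ g : ℕ → ℕ → ℂ, ∑ x ∈ triangle D, g x.1 x.2 =
      ∑ a ∈ R, ∑ b ∈ R, if a + b ≤ D then g a b else 0 := by
    intro g
    rw [triangle, Finset.sum_filter, Finset.sum_product]
  rw [hfull, hsplit, hreflect, hexp,
    htri fun a b => (weight κ p D a b : ℂ) * (ℓ a * starRingEnd ℂ (ℓ b)), ← Finset.sum_add_distrib]
  refine Finset.sum_congr rfl fun a _ => ?_
  rw [← Finset.sum_add_distrib]
  refine Finset.sum_congr rfl fun b _ => ?_
  split_ifs with h
  · rw [weight]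
    push_cast
    ring
  · rw [reflectedWeight_eq_zero κ p (by omega)]
    simp

/-! ### Orthogonality and fourth moments of the coefficients -/

theorem sum_mulChar_eq {K : Type*} [CommRing K] [Finite K] [Fintype (MulChar K ℂ)]
    [DecidableEq K] (a : K) :
    ∑ χ : MulChar K ℂ, χ a = if a = 1 then (Nat.card Kˣ : ℂ) else 0 := by
  split_ifs with ha
  · simp only [ha, map_one, Finset.sum_const, Finset.card_univ, nsmul_eq_mul, mul_one]
    rw [← Nat.card_eq_fintype_card, MulChar.card_eq_card_units_of_hasEnoughRootsOfUnity]
  · obtain ⟨χ, hχ⟩ := MulChar.exists_apply_ne_one_of_hasEnoughRootsOfUnity K ℂ ha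
    refine eq_zero_of_mul_eq_self_left hχ ?_
    simp only [Finset.mul_sum, ← MulChar.mul_apply]
    exact Fintype.sum_bijective _ (Group.mulLeft_bijective χ) _ _ fun χ' => rfl

theorem isUnit_mk {Q : F[X]} (hi : Irreducible Q) {A : F[X]} (hA : ¬ Q ∣ A) :
    IsUnit (Ideal.Quotient.mk (Ideal.span {Q}) A) := by
  have := isMaximal_span hi
  let := Ideal.Quotient.field (Ideal.span {Q})
  refine (isUnit_iff_ne_zero (G₀ := F[X] ⧸ Ideal.span {Q})).mpr ?_
  rwa [Ne, Ideal.Quotient.eq_zero_iff_mem, Ideal.mem_span_singleton]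

theorem value_mul_conj_self [Finite F] {Q : F[X]} (hQ : Q.Monic) (hi : Irreducible Q)
    (χ : DirichletChar Q) {A : F[X]} (hA : ¬ Q ∣ A) :
    χ.value A * starRingEnd ℂ (χ.value A) = 1 := by
  rw [← value_inv hQ, DirichletChar.value, DirichletChar.value, ← MulChar.mul_apply,
    mul_inv_cancel, MulChar.one_apply (isUnit_mk hi hA)]

theorem sum_value_mul_conj [Finite F] {Q : F[X]} (hQ : Q.Monic) (hi : Irreducible Q)
    [Fintype (DirichletChar Q)] {A B : F[X]} (hB : ¬ Q ∣ B) [Decidable (Q ∣ A - B)] :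
    ∑ χ : DirichletChar Q, χ.value A * starRingEnd ℂ (χ.value B) =
      if Q ∣ A - B then (totient Q : ℂ) else 0 := by
  classical
  have := finite_quotient hQ
  obtain ⟨b, hb⟩ := isUnit_mk hi hB
  have h1 : ∀ χ : DirichletChar Q, χ.value A * starRingEnd ℂ (χ.value B) =
      χ (Ideal.Quotient.mk (Ideal.span {Q}) A * (b⁻¹ : (F[X] ⧸ Ideal.span {Q})ˣ)) := by
    intro χ
    have h2 := value_mul_conj_self hQ hi χ hB
    have h3 : χ.value B * χ (b⁻¹ : (F[X] ⧸ Ideal.span {Q})ˣ) = 1 := by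
      rw [DirichletChar.value, ← hb, ← map_mul, Units.mul_inv, map_one]
    have h4 : χ.value B ≠ 0 := left_ne_zero_of_mul_eq_one h3
    rw [mul_left_cancel₀ h4 (h2.trans h3.symm), map_mul]
    rfl
  simp only [h1]
  rw [sum_mulChar_eq]
  refine if_congr ?_ rfl rfl
  rw [Units.mul_inv_eq_one, hb, Ideal.Quotient.eq, Ideal.mem_span_singleton]

theorem value_C_conj_sum [Finite F] [Fintype Fˣ] {Q : F[X]} (χ : DirichletChar Q)
    [Decidable (IsEven χ)] :
    ∑ c : Fˣ, starRingEnd ℂ (χ.value (C (c : F))) =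
      if IsEven χ then (Nat.card F : ℂ) - 1 else 0 := by
  have := Fintype.ofFinite F
  split_ifs with he
  · have h1 : ∀ c : Fˣ, starRingEnd ℂ (χ.value (C (c : F))) = 1 := fun c => by rw [he, map_one]
    have h2 : Fintype.card Fˣ = Nat.card F - 1 := by
      rw [← Nat.card_eq_fintype_card, Nat.card_units]
    have := two_le_card (F := F)
    simp only [h1, Finset.sum_const, Finset.card_univ, h2, nsmul_eq_mul, mul_one]
    rw [Nat.cast_sub (by omega), Nat.cast_one]
  · rw [← map_sum]
    have := sum_mulChar_mul_eq_sum_units (restrictConst χ) (fun _ => 1)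
    simp only [mul_one, MulChar.sum_eq_zero_of_ne_one (restrictConst_ne_one he)] at this
    simp only [restrictConst_coe] at this
    rw [← this, map_zero]

/-- The quadruples `((A, C), (B, D))` of monic polynomials with degrees `((i, u), (j, v))`. -/
noncomputable def quads (F : Type*) [Field F] [Finite F] (i j u v : ℕ) :
    Finset ((F[X] × F[X]) × (F[X] × F[X])) :=
  (monics F i ×ˢ monics F u) ×ˢ (monics F j ×ˢ monics F v)

open Classical in
/-- The number of quadruples with `A C ≡ c B D` modulo `Q`. -/
noncomputable def congrCount [Finite F] (Q : F[X]) (c : F) (i j u v : ℕ) : ℕ :=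
  ((quads F i j u v).filter fun x => Q ∣ x.1.1 * x.1.2 - C c * (x.2.1 * x.2.2)).card

open Classical in
/-- The number of quadruples with `A C = B D`. -/
noncomputable def diagCount (F : Type*) [Field F] [Finite F] (i j u v : ℕ) : ℕ :=
  ((quads F i j u v).filter fun x => x.1.1 * x.1.2 = x.2.1 * x.2.2).card

open Classical in
/-- The number of quadruples with `A C ≡ c B D` modulo `Q` but `A C ≠ c B D`. -/
noncomputable def offCount [Finite F] (Q : F[X]) (c : F) (i j u v : ℕ) : ℕ :=
  ((quads F i j u v).filter fun x => Q ∣ x.1.1 * x.1.2 - C c * (x.2.1 * x.2.2) ∧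
    x.1.1 * x.1.2 ≠ C c * (x.2.1 * x.2.2)).card

theorem mem_quads [Finite F] {i j u v : ℕ} {x : (F[X] × F[X]) × (F[X] × F[X])} :
    x ∈ quads F i j u v ↔ (x.1.1 ∈ monics F i ∧ x.1.2 ∈ monics F u) ∧
      (x.2.1 ∈ monics F j ∧ x.2.2 ∈ monics F v) := by
  simp only [quads, Finset.mem_product]

theorem congrCount_one [Finite F] (Q : F[X]) (i j u v : ℕ) :
    congrCount Q 1 i j u v = diagCount F i j u v + offCount Q 1 i j u v := by
  classical
  rw [congrCount, diagCount, offCount, ← Finset.card_union_of_disjoint]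
  · congr 1
    ext x
    simp only [Finset.mem_filter, Finset.mem_union, C_1, one_mul]
    constructor
    · rintro ⟨h1, h2⟩
      by_cases h : x.1.1 * x.1.2 = x.2.1 * x.2.2
      · exact Or.inl ⟨h1, h⟩
      · exact Or.inr ⟨h1, h2, h⟩
    · rintro (⟨h1, h2⟩ | ⟨h1, h2, -⟩)
      · exact ⟨h1, by rw [h2, sub_self]; exact dvd_zero _⟩
      · exact ⟨h1, h2⟩
  · rw [Finset.disjoint_left]
    intro x h1 h2
    simp only [Finset.mem_filter, C_1, one_mul] at h1 h2
    exact h2.2.2 h1.2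

theorem congrCount_of_ne_one [Finite F] (Q : F[X]) {c : F} (hc : c ≠ 1) (i j u v : ℕ) :
    congrCount Q c i j u v = offCount Q c i j u v := by
  classical
  rw [congrCount, offCount]
  congr 1
  ext x
  simp only [Finset.mem_filter]
  refine ⟨fun h => ⟨h.1, h.2, fun heq => hc ?_⟩, fun h => ⟨h.1, h.2.1⟩⟩
  have hx := mem_quads.mp h.1
  simp only [mem_monics] at hx
  have h1 := congrArg leadingCoeff heq
  rw [(hx.1.1.1.mul hx.1.2.1).leadingCoeff, leadingCoeff_mul, leadingCoeff_C,
    (hx.2.1.1.mul hx.2.2.1).leadingCoeff, mul_one] at h1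
  exact h1.symm

theorem normCoeff_product [Finite F] {Q : F[X]} (χ : DirichletChar Q) (i j u v : ℕ) :
    (normCoeff χ i * starRingEnd ℂ (normCoeff χ j)) *
      (normCoeff χ u * starRingEnd ℂ (normCoeff χ v)) =
      ((Real.sqrt (Nat.card F) ^ (i + j + u + v) : ℝ) : ℂ)⁻¹ *
      ∑ x ∈ quads F i j u v, χ.value (x.1.1 * x.1.2) * starRingEnd ℂ (χ.value (x.2.1 * x.2.2)) := by
  have h : ∑ x ∈ quads F i j u v,
      χ.value (x.1.1 * x.1.2) * starRingEnd ℂ (χ.value (x.2.1 * x.2.2)) =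
      (coeffSum χ i * coeffSum χ u) * starRingEnd ℂ (coeffSum χ j * coeffSum χ v) := by
    rw [quads, coeffSum, coeffSum, coeffSum, coeffSum, Finset.sum_mul_sum, Finset.sum_mul_sum,
      map_sum, ← Finset.sum_product', Finset.sum_product, Finset.sum_mul]
    refine Finset.sum_congr rfl fun x _ => ?_
    simp only [map_sum]
    rw [← Finset.sum_product', Finset.mul_sum]
    refine Finset.sum_congr rfl fun y _ => ?_
    rw [value_mul, value_mul]
  rw [h]
  simp only [normCoeff, map_mul, map_inv₀, Complex.conj_ofReal, pow_add, Complex.ofReal_mul]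
  simp only [mul_inv]
  ring

theorem not_dvd_of_mem_monics [Finite F] {Q : F[X]} (hi : Irreducible Q) {A B : F[X]} {i j : ℕ}
    (hA : A ∈ monics F i) (hB : B ∈ monics F j) (h1 : i < Q.natDegree) (h2 : j < Q.natDegree) :
    ¬ Q ∣ A * B := by
  rw [mem_monics] at hA hB
  intro h
  rcases hi.prime.dvd_or_dvd h with h | h
  · have := natDegree_le_of_dvd h hA.1.ne_zero
    omega
  · have := natDegree_le_of_dvd h hB.1.ne_zero
    omega

theorem not_dvd_C_mul {Q A : F[X]} (hA : ¬ Q ∣ A) (c : Fˣ) : ¬ Q ∣ C (c : F) * A := by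
  rwa [(isUnit_C.mpr c.isUnit).dvd_mul_left]

theorem sum_normCoeff_product [Finite F] {Q : F[X]} (hQ : Q.Monic) (hi : Irreducible Q)
    [Fintype (DirichletChar Q)] {i j u v : ℕ} (hj : j < Q.natDegree) (hv : v < Q.natDegree) :
    ∑ χ : DirichletChar Q, (normCoeff χ i * starRingEnd ℂ (normCoeff χ j)) *
      (normCoeff χ u * starRingEnd ℂ (normCoeff χ v)) =
      totient Q * ((((Real.sqrt (Nat.card F) ^ (i + j + u + v))⁻¹ *
        congrCount Q 1 i j u v : ℝ)) : ℂ) := by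
  classical
  simp only [normCoeff_product]
  rw [← Finset.mul_sum, Finset.sum_comm]
  have h : ∀ x ∈ quads F i j u v, ∑ χ : DirichletChar Q,
      χ.value (x.1.1 * x.1.2) * starRingEnd ℂ (χ.value (x.2.1 * x.2.2)) =
      if Q ∣ x.1.1 * x.1.2 - C 1 * (x.2.1 * x.2.2) then (totient Q : ℂ) else 0 := by
    intro x hx
    rw [mem_quads] at hx
    rw [C_1, one_mul, sum_value_mul_conj hQ hi (not_dvd_of_mem_monics hi hx.2.1 hx.2.2 hj hv)]
  rw [Finset.sum_congr rfl h, ← Finset.sum_filter, Finset.sum_const, congrCount, nsmul_eq_mul]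
  push_cast
  ring

/-- Evenness is detected by the average of `conj χ(c)` over the non-zero constants `c`. Inserting it
into the orthogonality relation replaces the congruence `A C ≡ B D` by the family `A C ≡ c B D`. -/
theorem sum_even_normCoeff_product [Finite F] [Fintype Fˣ] {Q : F[X]} (hQ : Q.Monic)
    (hi : Irreducible Q)
    [Fintype (DirichletChar Q)] [DecidablePred (IsEven (Q := Q))]
    {i j u v : ℕ} (hj : j < Q.natDegree) (hv : v < Q.natDegree) :
    ∑ χ : DirichletChar Q with IsEven χ, (normCoeff χ i * starRingEnd ℂ (normCoeff χ j)) *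
      (normCoeff χ u * starRingEnd ℂ (normCoeff χ v)) =
      totient Q * ((((Real.sqrt (Nat.card F) ^ (i + j + u + v))⁻¹ *
        ((∑ c : Fˣ, (congrCount Q (c : F) i j u v : ℝ)) / (Nat.card F - 1)) : ℝ)) : ℂ) := by
  classical
  have hq : (Nat.card F : ℂ) - 1 ≠ 0 := by
    have := two_le_card (F := F)
    rw [sub_ne_zero]
    exact_mod_cast (by omega : Nat.card F ≠ 1)
  simp only [normCoeff_product]
  rw [← Finset.mul_sum, Finset.sum_comm]
  have h : ∀ x ∈ quads F i j u v, ∑ χ : DirichletChar Q with IsEven χ,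
      χ.value (x.1.1 * x.1.2) * starRingEnd ℂ (χ.value (x.2.1 * x.2.2)) =
      ((Nat.card F : ℂ) - 1)⁻¹ * ∑ c : Fˣ,
        if Q ∣ x.1.1 * x.1.2 - C (c : F) * (x.2.1 * x.2.2) then (totient Q : ℂ) else 0 := by
    intro x hx
    rw [mem_quads] at hx
    have hnd := not_dvd_of_mem_monics hi hx.2.1 hx.2.2 hj hv
    have h1 : ∀ c : Fˣ, (if Q ∣ x.1.1 * x.1.2 - C (c : F) * (x.2.1 * x.2.2) then
        (totient Q : ℂ) else 0) = ∑ χ : DirichletChar Q, χ.value (x.1.1 * x.1.2) *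
        starRingEnd ℂ (χ.value (x.2.1 * x.2.2)) * starRingEnd ℂ (χ.value (C (c : F))) := by
      intro c
      rw [← sum_value_mul_conj hQ hi (not_dvd_C_mul hnd c)]
      refine Finset.sum_congr rfl fun χ _ => ?_
      rw [value_mul χ (C (c : F)), map_mul]
      ring
    simp only [h1]
    rw [Finset.sum_comm]
    simp only [← Finset.mul_sum]
    rw [Finset.sum_filter, Finset.mul_sum]
    refine Finset.sum_congr rfl fun χ _ => ?_
    rw [value_C_conj_sum]
    split_ifs
    · field_simp
    · simp
  rw [Finset.sum_congr rfl h, ← Finset.mul_sum, Finset.sum_comm]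
  simp only [← Finset.sum_filter, Finset.sum_const, nsmul_eq_mul, congrCount]
  rw [← Finset.sum_mul]
  push_cast
  field_simp

theorem coeffSum_one [Finite F] {Q : F[X]} (hi : Irreducible Q) {n : ℕ} (hn : n < Q.natDegree) :
    coeffSum (1 : DirichletChar Q) n = (Nat.card F : ℂ) ^ n := by
  have h : ∀ A ∈ monics F n, DirichletChar.value (1 : DirichletChar Q) A = 1 := by
    intro A hA
    rw [mem_monics] at hA
    refine MulChar.one_apply (isUnit_mk hi fun h => ?_)
    have := natDegree_le_of_dvd h hA.1.ne_zero
    omega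
  rw [coeffSum, Finset.sum_congr rfl h, Finset.sum_const, card_monics, nsmul_eq_mul, mul_one]
  push_cast
  rfl

theorem normCoeff_one [Finite F] {Q : F[X]} (hi : Irreducible Q) {n : ℕ}
    (hn : n < Q.natDegree) :
    normCoeff (1 : DirichletChar Q) n = ((Real.sqrt (Nat.card F) ^ n : ℝ) : ℂ) := by
  have hq : (0 : ℝ) < Nat.card F := by
    have := two_le_card (F := F); positivity
  have hr : (Real.sqrt (Nat.card F) : ℂ) ≠ 0 :=
    Complex.ofReal_ne_zero.mpr (Real.sqrt_pos.mpr hq).ne'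
  have hr2 : (Nat.card F : ℂ) = (Real.sqrt (Nat.card F) : ℂ) ^ 2 := by
    rw [← Complex.ofReal_pow, Real.sq_sqrt hq.le, Complex.ofReal_natCast]
  rw [normCoeff, coeffSum_one hi hn, hr2]
  push_cast
  field_simp
  ring

theorem isEven_one {Q : F[X]} (hi : Irreducible Q) : IsEven (1 : DirichletChar Q) := by
  intro c
  refine MulChar.one_apply (isUnit_mk hi fun h => ?_)
  exact hi.not_isUnit (isUnit_of_dvd_unit h (isUnit_C.mpr c.isUnit))

/-- `(1 / φ(Q)) ∑ ℓ_i ℓ̄_j ℓ_u ℓ̄_v` over all characters. -/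
noncomputable def momentAll [Finite F] (Q : F[X]) (i j u v : ℕ) : ℝ :=
  (Real.sqrt (Nat.card F) ^ (i + j + u + v))⁻¹ * congrCount Q 1 i j u v

/-- `(1 / φ(Q)) ∑ ℓ_i ℓ̄_j ℓ_u ℓ̄_v` over the even characters. -/
noncomputable def momentEven [Finite F] [Fintype Fˣ] (Q : F[X]) (i j u v : ℕ) : ℝ :=
  (Real.sqrt (Nat.card F) ^ (i + j + u + v))⁻¹ *
    ((∑ c : Fˣ, (congrCount Q (c : F) i j u v : ℝ)) / (Nat.card F - 1))

/-- The product of the two expansions given by `norm_sum_sq_eq_sum_weight`. -/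
noncomputable def expansion [Finite F] {Q : F[X]} (κ p₁ p₂ : ℕ → ℝ) (D : ℕ)
    (χ : DirichletChar Q) : ℂ :=
  (∑ x ∈ triangle D,
    (weight κ p₁ D x.1 x.2 : ℂ) * (normCoeff χ x.1 * starRingEnd ℂ (normCoeff χ x.2))) *
  ∑ y ∈ triangle D,
    (weight κ p₂ D y.1 y.2 : ℂ) * (normCoeff χ y.1 * starRingEnd ℂ (normCoeff χ y.2))

theorem sum_expansion [Finite F] {Q : F[X]} (κ p₁ p₂ : ℕ → ℝ) (D : ℕ)
    (s : Finset (DirichletChar Q)) (m : ℕ → ℕ → ℕ → ℕ → ℝ) (t : ℂ)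
    (h : ∀ x ∈ triangle D, ∀ y ∈ triangle D,
      ∑ χ ∈ s, (normCoeff χ x.1 * starRingEnd ℂ (normCoeff χ x.2)) *
        (normCoeff χ y.1 * starRingEnd ℂ (normCoeff χ y.2)) = t * (m x.1 x.2 y.1 y.2 : ℂ)) :
    ∑ χ ∈ s, expansion κ p₁ p₂ D χ = t * ((∑ x ∈ triangle D, ∑ y ∈ triangle D,
      weight κ p₁ D x.1 x.2 * weight κ p₂ D y.1 y.2 * m x.1 x.2 y.1 y.2 : ℝ) : ℂ) := by
  simp only [expansion, Finset.sum_mul_sum]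
  rw [Finset.sum_comm, Complex.ofReal_sum, Finset.mul_sum]
  refine Finset.sum_congr rfl fun x hx => ?_
  rw [Finset.sum_comm, Complex.ofReal_sum, Finset.mul_sum]
  refine Finset.sum_congr rfl fun y hy => ?_
  have h1 : ∀ χ ∈ s, (weight κ p₁ D x.1 x.2 : ℂ) * (normCoeff χ x.1 *
      starRingEnd ℂ (normCoeff χ x.2)) * ((weight κ p₂ D y.1 y.2 : ℂ) *
      (normCoeff χ y.1 * starRingEnd ℂ (normCoeff χ y.2))) =
      ((weight κ p₁ D x.1 x.2 : ℂ) * (weight κ p₂ D y.1 y.2 : ℂ)) *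
      ((normCoeff χ x.1 * starRingEnd ℂ (normCoeff χ x.2)) *
        (normCoeff χ y.1 * starRingEnd ℂ (normCoeff χ y.2))) := fun χ _ => by ring
  rw [Finset.sum_congr rfl h1, ← Finset.mul_sum, h x hx y hy]
  push_cast
  ring

theorem expansion_one [Finite F] {Q : F[X]} (hi : Irreducible Q) {D : ℕ}
    (hD : Q.natDegree = D + 1) (κ p₁ p₂ : ℕ → ℝ) :
    expansion κ p₁ p₂ D (1 : DirichletChar Q) =
      ((∑ x ∈ triangle D, weight κ p₁ D x.1 x.2 * Real.sqrt (Nat.card F) ^ (x.1 + x.2)) *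
      (∑ x ∈ triangle D, weight κ p₂ D x.1 x.2 * Real.sqrt (Nat.card F) ^ (x.1 + x.2)) : ℝ) := by
  have h : ∀ p : ℕ → ℝ, ∑ x ∈ triangle D, (weight κ p D x.1 x.2 : ℂ) *
      (normCoeff (1 : DirichletChar Q) x.1 *
        starRingEnd ℂ (normCoeff (1 : DirichletChar Q) x.2)) =
      ((∑ x ∈ triangle D, weight κ p D x.1 x.2 * Real.sqrt (Nat.card F) ^ (x.1 + x.2) : ℝ) : ℂ) := by
    intro p
    rw [Complex.ofReal_sum]
    refine Finset.sum_congr rfl fun x hx => ?_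
    rw [mem_triangle] at hx
    rw [normCoeff_one hi (by omega), normCoeff_one hi (by omega), Complex.conj_ofReal, pow_add]
    push_cast
    ring
  rw [expansion, h, h, Complex.ofReal_mul]

/-- The odd characters are all characters minus the even ones. The trivial character is formally
even but its coefficients do not satisfy the functional equation; its expansion is included in the
even sum and then subtracted, which is the last term. -/
theorem sum_norm_sq_mul_norm_sq [Finite F] [Fintype Fˣ] {Q : F[X]} (hQ : Q.Monic)
    (hi : Irreducible Q) {D : ℕ} (hD : Q.natDegree = D + 1) [Fintype (DirichletChar Q)]
    [DecidableEq (DirichletChar Q)] (p₁ p₂ : ℕ → ℝ) :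
    ∑ χ : DirichletChar Q with χ ≠ 1,
      ‖∑ n ∈ Finset.range Q.natDegree, (p₁ n : ℂ) * normCoeff χ n‖ ^ 2 *
        ‖∑ n ∈ Finset.range Q.natDegree, (p₂ n : ℂ) * normCoeff χ n‖ ^ 2 =
      totient Q * (∑ x ∈ triangle D, ∑ y ∈ triangle D,
        (weight oddKernel p₁ D x.1 x.2 * weight oddKernel p₂ D y.1 y.2 *
          (momentAll Q x.1 x.2 y.1 y.2 - momentEven Q x.1 x.2 y.1 y.2) +
        weight (evenKernel (Nat.card F)) p₁ D x.1 x.2 *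
          weight (evenKernel (Nat.card F)) p₂ D y.1 y.2 * momentEven Q x.1 x.2 y.1 y.2)) -
      (∑ x ∈ triangle D, weight (evenKernel (Nat.card F)) p₁ D x.1 x.2 *
        Real.sqrt (Nat.card F) ^ (x.1 + x.2)) *
      (∑ x ∈ triangle D, weight (evenKernel (Nat.card F)) p₂ D x.1 x.2 *
        Real.sqrt (Nat.card F) ^ (x.1 + x.2)) := by
  classical
  rw [← Complex.ofReal_inj]
  have hall : ∀ x ∈ triangle D, ∀ y ∈ triangle D,
      ∑ χ : DirichletChar Q, (normCoeff χ x.1 * starRingEnd ℂ (normCoeff χ x.2)) *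
        (normCoeff χ y.1 * starRingEnd ℂ (normCoeff χ y.2)) =
        (totient Q : ℂ) * (momentAll Q x.1 x.2 y.1 y.2 : ℂ) := by
    intro x hx y hy
    rw [mem_triangle] at hx hy
    exact sum_normCoeff_product hQ hi (by omega) (by omega)
  have hev : ∀ x ∈ triangle D, ∀ y ∈ triangle D,
      ∑ χ : DirichletChar Q with IsEven χ,
        (normCoeff χ x.1 * starRingEnd ℂ (normCoeff χ x.2)) *
        (normCoeff χ y.1 * starRingEnd ℂ (normCoeff χ y.2)) =
        (totient Q : ℂ) * (momentEven Q x.1 x.2 y.1 y.2 : ℂ) := by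
    intro x hx y hy
    rw [mem_triangle] at hx hy
    exact sum_even_normCoeff_product hQ hi (by omega) (by omega)
  have h1 := sum_expansion oddKernel p₁ p₂ D Finset.univ _ _ hall
  have h2 := sum_expansion oddKernel p₁ p₂ D _ _ _ hev
  have h3 := sum_expansion (evenKernel (Nat.card F)) p₁ p₂ D _ _ _ hev
  have hodd : ∀ χ : DirichletChar Q, χ ≠ 1 → ¬ IsEven χ →
      ((‖∑ n ∈ Finset.range Q.natDegree, (p₁ n : ℂ) * normCoeff χ n‖ ^ 2 *
        ‖∑ n ∈ Finset.range Q.natDegree, (p₂ n : ℂ) * normCoeff χ n‖ ^ 2 : ℝ) : ℂ) =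
      expansion oddKernel p₁ p₂ D χ := by
    intro χ hχ ho
    rw [expansion, ← norm_sum_sq_eq_sum_weight p₁ (functionalEquation_odd hQ hi hD hχ ho),
      ← norm_sum_sq_eq_sum_weight p₂ (functionalEquation_odd hQ hi hD hχ ho), hD,
      Complex.ofReal_mul]
  have heven : ∀ χ : DirichletChar Q, χ ≠ 1 → IsEven χ →
      ((‖∑ n ∈ Finset.range Q.natDegree, (p₁ n : ℂ) * normCoeff χ n‖ ^ 2 *
        ‖∑ n ∈ Finset.range Q.natDegree, (p₂ n : ℂ) * normCoeff χ n‖ ^ 2 : ℝ) : ℂ) =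
      expansion (evenKernel (Nat.card F)) p₁ p₂ D χ := by
    intro χ hχ he
    rw [expansion, ← norm_sum_sq_eq_sum_weight p₁ (functionalEquation_even hQ hi hD hχ he),
      ← norm_sum_sq_eq_sum_weight p₂ (functionalEquation_even hQ hi hD hχ he), hD,
      Complex.ofReal_mul]
  have hsum : ((∑ χ : DirichletChar Q with χ ≠ 1,
      ‖∑ n ∈ Finset.range Q.natDegree, (p₁ n : ℂ) * normCoeff χ n‖ ^ 2 *
        ‖∑ n ∈ Finset.range Q.natDegree, (p₂ n : ℂ) * normCoeff χ n‖ ^ 2 : ℝ) : ℂ) =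
      (∑ χ : DirichletChar Q, expansion oddKernel p₁ p₂ D χ) -
      (∑ χ : DirichletChar Q with IsEven χ, expansion oddKernel p₁ p₂ D χ) +
      (∑ χ : DirichletChar Q with IsEven χ, expansion (evenKernel (Nat.card F)) p₁ p₂ D χ) -
      expansion (evenKernel (Nat.card F)) p₁ p₂ D (1 : DirichletChar Q) := by
    have h4 : expansion (evenKernel (Nat.card F)) p₁ p₂ D (1 : DirichletChar Q) =
        ∑ χ : DirichletChar Q, if χ = 1 then expansion (evenKernel (Nat.card F)) p₁ p₂ D χ
          else 0 := by
      rw [Finset.sum_ite_eq' Finset.univ (1 : DirichletChar Q), if_pos (Finset.mem_univ _)]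
    rw [h4, Complex.ofReal_sum, Finset.sum_filter, Finset.sum_filter, Finset.sum_filter,
      ← Finset.sum_sub_distrib, ← Finset.sum_add_distrib, ← Finset.sum_sub_distrib]
    refine Finset.sum_congr rfl fun χ _ => ?_
    by_cases hχ : χ = 1
    · rw [if_neg (not_not.mpr hχ), if_pos hχ, hχ, if_pos (isEven_one hi), if_pos (isEven_one hi)]
      ring
    · rw [if_pos hχ, if_neg hχ]
      by_cases he : IsEven χ
      · rw [if_pos he, if_pos he, heven χ hχ he]
        ring
      · rw [if_neg he, if_neg he, hodd χ hχ he]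
        ring
  rw [hsum, h1, h2, h3, expansion_one hi hD, ← mul_sub, ← mul_add, ← Complex.ofReal_sub,
    ← Complex.ofReal_add, ← Complex.ofReal_natCast, ← Complex.ofReal_mul, ← Complex.ofReal_sub]
  congr 3
  rw [← Finset.sum_sub_distrib, ← Finset.sum_add_distrib]
  refine Finset.sum_congr rfl fun x _ => ?_
  rw [← Finset.sum_sub_distrib, ← Finset.sum_add_distrib]
  refine Finset.sum_congr rfl fun y _ => ?_
  ring

/-! ### The diagonal -/

theorem exists_monic_gcd {A B : F[X]} (hA : A.Monic) (hB : B.Monic) :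
    ∃ G R S : F[X], G.Monic ∧ R.Monic ∧ S.Monic ∧ A = G * R ∧ B = G * S ∧ IsCoprime R S := by
  classical
  set g := EuclideanDomain.gcd A B with hg
  have hg0 : g ≠ 0 := fun h => hA.ne_zero (EuclideanDomain.gcd_eq_zero_iff.mp h).1
  have hG := monic_mul_leadingCoeff_inv hg0
  have hu : IsUnit (C g.leadingCoeff⁻¹) :=
    isUnit_C.mpr (isUnit_iff_ne_zero.mpr (inv_ne_zero (leadingCoeff_ne_zero.mpr hg0)))
  set G := g * C g.leadingCoeff⁻¹ with hGdef
  obtain ⟨R, hR⟩ : G ∣ A := (hu.mul_right_dvd).mpr (EuclideanDomain.gcd_dvd_left A B)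
  obtain ⟨S, hS⟩ : G ∣ B := (hu.mul_right_dvd).mpr (EuclideanDomain.gcd_dvd_right A B)
  refine ⟨G, R, S, hG, hG.of_mul_monic_left (hR ▸ hA), hG.of_mul_monic_left (hS ▸ hB), hR, hS, ?_⟩
  have hb := EuclideanDomain.gcd_eq_gcd_ab A B
  rw [← hg] at hb
  refine ⟨EuclideanDomain.gcdA A B * C g.leadingCoeff⁻¹,
    EuclideanDomain.gcdB A B * C g.leadingCoeff⁻¹, mul_left_cancel₀ hG.ne_zero ?_⟩
  calc G * (EuclideanDomain.gcdA A B * C g.leadingCoeff⁻¹ * R +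
      EuclideanDomain.gcdB A B * C g.leadingCoeff⁻¹ * S)
      = (G * R * EuclideanDomain.gcdA A B + G * S * EuclideanDomain.gcdB A B) *
          C g.leadingCoeff⁻¹ := by ring
    _ = G * 1 := by rw [← hR, ← hS, ← hb, mul_one]

/-- A Bézout relation between `R` and `S` writes `G` as a combination of `G R` and `G S`, so each of
`G`, `G'` divides the other. -/
theorem eq_of_mul_eq_mul_of_isCoprime {G R S G' R' S' : F[X]} (hG : G.Monic) (hG' : G'.Monic)
    (h : IsCoprime R S) (h' : IsCoprime R' S') (h1 : G * R = G' * R') (h2 : G * S = G' * S') :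
    G = G' ∧ R = R' ∧ S = S' := by
  have key : ∀ {G R S G' R' S' : F[X]}, IsCoprime R S → G * R = G' * R' → G * S = G' * S' →
      G' ∣ G := by
    rintro G R S G' R' S' ⟨a, b, hab⟩ h1 h2
    exact ⟨a * R' + b * S', by linear_combination (-G) * hab + a * h1 + b * h2⟩
  have hGG : G = G' := eq_of_monic_of_associated hG hG'
    (associated_of_dvd_dvd (key h' h1.symm h2.symm) (key h h1 h2))
  subst hGG
  exact ⟨rfl, mul_left_cancel₀ hG.ne_zero h1, mul_left_cancel₀ hG.ne_zero h2⟩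

open Classical in
/-- The coprime pairs of monic polynomials of degrees `r` and `s`. -/
noncomputable def coprimePairs (F : Type*) [Field F] [Finite F] (r s : ℕ) : Finset (F[X] × F[X]) :=
  (monics F r ×ˢ monics F s).filter fun x => IsCoprime x.1 x.2

theorem mem_coprimePairs [Finite F] {r s : ℕ} {x : F[X] × F[X]} :
    x ∈ coprimePairs F r s ↔ (x.1 ∈ monics F r ∧ x.2 ∈ monics F s) ∧ IsCoprime x.1 x.2 := by
  simp only [coprimePairs, Finset.mem_filter, Finset.mem_product]

/-- All pairs are sorted by the degree `e` of their monic gcd. -/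
theorem sum_card_coprimePairs [Finite F] (r s : ℕ) :
    ∑ e ∈ Finset.range (min r s + 1), Nat.card F ^ e * (coprimePairs F (r - e) (s - e)).card =
      Nat.card F ^ (r + s) := by
  classical
  have h1 : Nat.card F ^ (r + s) = (monics F r ×ˢ monics F s).card := by
    rw [Finset.card_product, card_monics, card_monics, pow_add]
  have h2 : ∀ e, Nat.card F ^ e * (coprimePairs F (r - e) (s - e)).card =
      (monics F e ×ˢ coprimePairs F (r - e) (s - e)).card := fun e => by
    rw [Finset.card_product, card_monics]
  simp only [h1, h2]
  rw [← Finset.card_sigma]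
  refine Finset.card_bij (fun p _ => (p.2.1 * p.2.2.1, p.2.1 * p.2.2.2)) ?_ ?_ ?_
  · rintro ⟨e, G, R, S⟩ h
    simp only [Finset.mem_sigma, Finset.mem_range, Finset.mem_product, mem_coprimePairs] at h
    obtain ⟨he, hG, ⟨hR, hS⟩, -⟩ := h
    rw [Finset.mem_product]
    constructor
    · simpa [show e + (r - e) = r by omega] using mul_mem_monics hG hR
    · simpa [show e + (s - e) = s by omega] using mul_mem_monics hG hS
  · rintro ⟨e, G, R, S⟩ h ⟨e', G', R', S'⟩ h' heq
    simp only [Finset.mem_sigma, Finset.mem_range, Finset.mem_product, mem_coprimePairs] at h h'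
    simp only [Prod.mk.injEq] at heq
    obtain ⟨he, hG, ⟨hR, hS⟩, hc⟩ := h
    obtain ⟨he', hG', ⟨hR', hS'⟩, hc'⟩ := h'
    rw [mem_monics] at hG hG'
    obtain ⟨rfl, rfl, rfl⟩ := eq_of_mul_eq_mul_of_isCoprime hG.1 hG'.1 hc hc' heq.1 heq.2
    obtain rfl : e = e' := hG.2.symm.trans hG'.2
    rfl
  · rintro ⟨A, B⟩ h
    rw [Finset.mem_product] at h
    have hA := mem_monics.mp h.1
    have hB := mem_monics.mp h.2
    simp only at hA hB
    obtain ⟨G, R, S, hG, hR, hS, hAG, hBG, hc⟩ := exists_monic_gcd hA.1 hB.1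
    have hGm : G ∈ monics F G.natDegree := mem_monics.mpr ⟨hG, rfl⟩
    have h3 := of_mul_mem_monics hGm (hAG ▸ h.1)
    have h4 := of_mul_mem_monics hGm (hBG ▸ h.2)
    refine ⟨⟨G.natDegree, G, R, S⟩, ?_, ?_⟩
    · simp only [Finset.mem_sigma, Finset.mem_range, Finset.mem_product, mem_coprimePairs]
      exact ⟨by omega, hGm, ⟨h3.2, h4.2⟩, hc⟩
    · simp only [← hAG, ← hBG]

/-- In `sum_card_coprimePairs` for `(r + 1, s + 1)`, the terms with `e ≥ 1` form `q` times the same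
identity for `(r, s)`. What remains is the term `e = 0`; this is the source of the factor `1 - 1/q`.
-/
theorem card_coprimePairs_succ [Finite F] (r s : ℕ) :
    (coprimePairs F (r + 1) (s + 1)).card + Nat.card F ^ (r + s + 1) = Nat.card F ^ (r + s + 2) := by
  have h1 := sum_card_coprimePairs (F := F) (r + 1) (s + 1)
  have h2 := sum_card_coprimePairs (F := F) r s
  rw [show min (r + 1) (s + 1) = min r s + 1 by omega, Finset.sum_range_succ'] at h1
  simp only [Nat.add_sub_add_right, pow_zero, one_mul, Nat.sub_zero, pow_succ'] at h1
  simp only [mul_assoc] at h1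
  rw [← Finset.mul_sum, h2, ← pow_succ', add_comm, show r + 1 + (s + 1) = r + s + 2 by omega] at h1
  exact h1

theorem card_coprimePairs_of_eq_zero [Finite F] {r s : ℕ} (h : r = 0 ∨ s = 0) :
    (coprimePairs F r s).card = Nat.card F ^ (r + s) := by
  have h1 := sum_card_coprimePairs (F := F) r s
  rw [show min r s = 0 by omega] at h1
  simpa using h1

/-- The proportion of coprime pairs among the pairs of monic polynomials of degrees `r`, `s`. -/
noncomputable def coprimeDensity (F : Type*) [Field F] [Finite F] (r s : ℕ) : ℝ :=
  (coprimePairs F r s).card / (Nat.card F : ℝ) ^ (r + s)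

theorem card_pos_real [Finite F] : (0 : ℝ) < Nat.card F := by
  have := two_le_card (F := F)
  positivity

theorem coprimeDensity_of_pos [Finite F] {r s : ℕ} (hr : r ≠ 0) (hs : s ≠ 0) :
    coprimeDensity F r s = 1 - (Nat.card F : ℝ)⁻¹ := by
  obtain ⟨r, rfl⟩ := Nat.exists_eq_succ_of_ne_zero hr
  obtain ⟨s, rfl⟩ := Nat.exists_eq_succ_of_ne_zero hs
  have h := card_coprimePairs_succ (F := F) r s
  have hq := card_pos_real (F := F)
  have h2 : ((coprimePairs F (r + 1) (s + 1)).card : ℝ) =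
      (Nat.card F : ℝ) ^ (r + s + 2) - (Nat.card F : ℝ) ^ (r + s + 1) := by
    rw [eq_sub_iff_add_eq]
    exact_mod_cast h
  rw [coprimeDensity, Nat.succ_eq_add_one, Nat.succ_eq_add_one, h2,
    show r + 1 + (s + 1) = r + s + 1 + 1 by ring, pow_succ]
  field_simp

theorem coprimeDensity_of_eq_zero [Finite F] {r s : ℕ} (h : r = 0 ∨ s = 0) :
    coprimeDensity F r s = 1 := by
  have hq := card_pos_real (F := F)
  rw [coprimeDensity, card_coprimePairs_of_eq_zero h]
  push_cast
  exact div_self (by positivity)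

theorem coprimeDensity_nonneg [Finite F] (r s : ℕ) : 0 ≤ coprimeDensity F r s := by
  rw [coprimeDensity]
  positivity

theorem coprimeDensity_le_one [Finite F] (r s : ℕ) : coprimeDensity F r s ≤ 1 := by
  have hq := card_pos_real (F := F)
  by_cases h : r = 0 ∨ s = 0
  · rw [coprimeDensity_of_eq_zero h]
  · rw [coprimeDensity_of_pos (by tauto) (by tauto)]
    have : (0 : ℝ) ≤ (Nat.card F : ℝ)⁻¹ := by positivity
    linarith

/-- The quadruples `(g, h, r, s)` with `2 g + r + s ≤ D` and `2 h + r + s ≤ D`. -/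
def cone (D : ℕ) : Finset ((ℕ × ℕ) × (ℕ × ℕ)) :=
  ((Finset.range (D + 1) ×ˢ Finset.range (D + 1)) ×ˢ
    (Finset.range (D + 1) ×ˢ Finset.range (D + 1))).filter fun p =>
      2 * p.1.1 + p.2.1 + p.2.2 ≤ D ∧ 2 * p.1.2 + p.2.1 + p.2.2 ≤ D

theorem mem_cone {D : ℕ} {p : (ℕ × ℕ) × (ℕ × ℕ)} :
    p ∈ cone D ↔ 2 * p.1.1 + p.2.1 + p.2.2 ≤ D ∧ 2 * p.1.2 + p.2.1 + p.2.2 ≤ D := by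
  simp only [cone, Finset.mem_filter, Finset.mem_product, Finset.mem_range]
  omega

/-- The degrees `((i, j), (u, v))` of `((G R, G S), (H S, H R))`, where `G, H, R, S` have degrees
`g, h, r, s`. -/
def productDegrees (p : (ℕ × ℕ) × (ℕ × ℕ)) : (ℕ × ℕ) × (ℕ × ℕ) :=
  ((p.1.1 + p.2.1, p.1.1 + p.2.2), (p.1.2 + p.2.2, p.1.2 + p.2.1))

/-- Let `G` be the monic gcd of `A = G R` and `B = G S`. Then `A C = B D` becomes `R C = S D`, and
coprimality forces `D = H R`, `C = H S`. This is a bijection between solutions and quadruples `(G,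
H, R, S)` with `R`, `S` coprime. -/
theorem diagCount_eq_sum [Finite F] {D : ℕ} {x y : ℕ × ℕ} (hx : x ∈ triangle D)
    (hy : y ∈ triangle D) :
    diagCount F x.1 x.2 y.1 y.2 = ∑ p ∈ cone D with productDegrees p = (x, y),
      Nat.card F ^ (p.1.1 + p.1.2) * (coprimePairs F p.2.1 p.2.2).card := by
  classical
  obtain ⟨i, j⟩ := x
  obtain ⟨u, v⟩ := y
  simp only [mem_triangle] at hx hy
  have h2 : ∀ p : (ℕ × ℕ) × (ℕ × ℕ),
      Nat.card F ^ (p.1.1 + p.1.2) * (coprimePairs F p.2.1 p.2.2).card =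
      ((monics F p.1.1 ×ˢ monics F p.1.2) ×ˢ coprimePairs F p.2.1 p.2.2).card := fun e => by
    rw [Finset.card_product, Finset.card_product, card_monics, card_monics, pow_add]
  simp only [h2]
  rw [← Finset.card_sigma, diagCount, eq_comm]
  refine Finset.card_bij (fun p _ =>
    ((p.2.1.1 * p.2.2.1, p.2.1.2 * p.2.2.2), (p.2.1.1 * p.2.2.2, p.2.1.2 * p.2.2.1))) ?_ ?_ ?_
  · rintro ⟨⟨⟨g, h⟩, ⟨r, s⟩⟩, ⟨⟨G, H⟩, ⟨R, S⟩⟩⟩ hp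
    simp only [Finset.mem_sigma, Finset.mem_filter, Finset.mem_product, mem_coprimePairs,
      productDegrees, Prod.mk.injEq] at hp
    obtain ⟨⟨-, ⟨rfl, rfl⟩, ⟨rfl, rfl⟩⟩, ⟨hG, hH⟩, ⟨hR, hS⟩, -⟩ := hp
    simp only [Finset.mem_filter, mem_quads]
    exact ⟨⟨⟨mul_mem_monics hG hR, mul_mem_monics hH hS⟩,
      ⟨mul_mem_monics hG hS, mul_mem_monics hH hR⟩⟩, by ring⟩
  · rintro ⟨⟨⟨g, h⟩, ⟨r, s⟩⟩, ⟨⟨G, H⟩, ⟨R, S⟩⟩⟩ hp ⟨⟨⟨g', h'⟩, ⟨r', s'⟩⟩, ⟨⟨G', H'⟩, ⟨R', S'⟩⟩⟩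
      hp' heq
    simp only [Finset.mem_sigma, Finset.mem_filter, Finset.mem_product, mem_coprimePairs,
      mem_monics] at hp hp'
    simp only [Prod.mk.injEq] at heq
    obtain ⟨-, ⟨⟨hG, rfl⟩, hH, rfl⟩, ⟨⟨hR, rfl⟩, hS, rfl⟩, hc⟩ := hp
    obtain ⟨-, ⟨⟨hG', rfl⟩, hH', rfl⟩, ⟨⟨hR', rfl⟩, hS', rfl⟩, hc'⟩ := hp'
    obtain ⟨rfl, rfl, rfl⟩ := eq_of_mul_eq_mul_of_isCoprime hG hG' hc hc' heq.1.1 heq.2.1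
    obtain rfl : H = H' := mul_right_cancel₀ hS.ne_zero heq.1.2
    rfl
  · rintro ⟨⟨A, B'⟩, ⟨B, D'⟩⟩ hp
    simp only [Finset.mem_filter, mem_quads] at hp
    obtain ⟨⟨⟨hA, hC⟩, ⟨hB, hD⟩⟩, heq⟩ := hp
    obtain ⟨G, R, S, hG, hR, hS, hAG, hBG, hc⟩ :=
      exists_monic_gcd (mem_monics.mp hA).1 (mem_monics.mp hB).1
    subst hAG hBG
    have h1 : R * B' = S * D' := mul_left_cancel₀ hG.ne_zero (by linear_combination heq)
    obtain ⟨H, rfl⟩ : R ∣ D' := hc.dvd_of_dvd_mul_left ⟨B', h1.symm⟩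
    have h3 : B' = H * S := mul_left_cancel₀ hR.ne_zero (by linear_combination h1)
    subst h3
    have hH : H.Monic := hR.of_mul_monic_left (mem_monics.mp hD).1
    rw [mem_monics, hG.natDegree_mul hR] at hA
    rw [mem_monics, hG.natDegree_mul hS] at hB
    rw [mem_monics, hH.natDegree_mul hS] at hC
    rw [mem_monics, hR.natDegree_mul hH] at hD
    refine ⟨⟨((G.natDegree, H.natDegree), (R.natDegree, S.natDegree)), ((G, H), (R, S))⟩, ?_, ?_⟩
    · simp only [Finset.mem_sigma, Finset.mem_filter, Finset.mem_product, mem_coprimePairs,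
        mem_monics, mem_cone, productDegrees, Prod.mk.injEq]
      exact ⟨⟨⟨by omega, by omega⟩, ⟨by omega, by omega⟩, ⟨by omega, by omega⟩⟩,
        ⟨⟨hG, trivial⟩, ⟨hH, trivial⟩⟩, ⟨⟨⟨hR, trivial⟩, ⟨hS, trivial⟩⟩, hc⟩⟩
    · simp only [Prod.mk.injEq, true_and]
      exact mul_comm _ _

/-- The contribution of the diagonal `A C = B D` to `momentAll`. -/
noncomputable def momentDiag (F : Type*) [Field F] [Finite F] (i j u v : ℕ) : ℝ :=
  (Real.sqrt (Nat.card F) ^ (i + j + u + v))⁻¹ * diagCount F i j u v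

/-- The four degrees add up to `2 (g + h + r + s)`, so the normalizing factor is `q ^ (-(g + h + r +
s))`; it absorbs the choices of `G` and `H` and turns the number of coprime pairs into a density. -/
theorem momentDiag_eq_sum [Finite F] {D : ℕ} {x y : ℕ × ℕ} (hx : x ∈ triangle D)
    (hy : y ∈ triangle D) :
    momentDiag F x.1 x.2 y.1 y.2 = ∑ p ∈ cone D with productDegrees p = (x, y),
      coprimeDensity F p.2.1 p.2.2 := by
  have hq := card_pos_real (F := F)
  rw [momentDiag, diagCount_eq_sum hx hy, Nat.cast_sum, Finset.mul_sum]
  refine Finset.sum_congr rfl fun p hp => ?_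
  rw [Finset.mem_filter] at hp
  have h := hp.2
  rw [productDegrees, Prod.mk.injEq] at h
  obtain ⟨rfl, rfl⟩ := h
  have h1 : p.1.1 + p.2.1 + (p.1.1 + p.2.2) + (p.1.2 + p.2.2) + (p.1.2 + p.2.1) =
      2 * ((p.1.1 + p.1.2) + (p.2.1 + p.2.2)) := by ring
  simp only [h1]
  rw [pow_mul, Real.sq_sqrt hq.le, coprimeDensity, pow_add]
  push_cast
  field_simp

theorem productDegrees_mem_triangle {D : ℕ} {p : (ℕ × ℕ) × (ℕ × ℕ)} (hp : p ∈ cone D) :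
    (productDegrees p).1 ∈ triangle D ∧ (productDegrees p).2 ∈ triangle D := by
  rw [mem_cone] at hp
  simp only [productDegrees, mem_triangle]
  omega

theorem sum_mul_momentDiag [Finite F] (D : ℕ) (X : ℕ × ℕ → ℕ × ℕ → ℝ) :
    ∑ x ∈ triangle D, ∑ y ∈ triangle D, X x y * momentDiag F x.1 x.2 y.1 y.2 =
      ∑ p ∈ cone D, X (productDegrees p).1 (productDegrees p).2 *
        coprimeDensity F p.2.1 p.2.2 := by
  have h : ∀ x ∈ triangle D, ∀ y ∈ triangle D, X x y * momentDiag F x.1 x.2 y.1 y.2 =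
      ∑ p ∈ cone D, if productDegrees p = (x, y) then
        X (productDegrees p).1 (productDegrees p).2 * coprimeDensity F p.2.1 p.2.2 else 0 := by
    intro x hx y hy
    rw [momentDiag_eq_sum hx hy, Finset.mul_sum, Finset.sum_filter]
    refine Finset.sum_congr rfl fun p _ => ?_
    split_ifs with h
    · rw [h]
    · rfl
  rw [Finset.sum_congr rfl fun x hx => Finset.sum_congr rfl fun y hy => h x hx y hy,
    ← Finset.sum_product', Finset.sum_comm]
  refine Finset.sum_congr rfl fun p hp => ?_
  have := productDegrees_mem_triangle hp
  rw [Finset.sum_ite_eq, if_pos (Finset.mem_product.mpr this)]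

/-- A point of the cone with prescribed product degrees is determined by `g`, and each such point
contributes at most `1`. -/
theorem momentDiag_le [Finite F] {D : ℕ} {x y : ℕ × ℕ} (hx : x ∈ triangle D)
    (hy : y ∈ triangle D) : momentDiag F x.1 x.2 y.1 y.2 ≤ D + 1 := by
  classical
  rw [momentDiag_eq_sum hx hy]
  calc ∑ p ∈ cone D with productDegrees p = (x, y), coprimeDensity F p.2.1 p.2.2
      ≤ ∑ p ∈ cone D with productDegrees p = (x, y), (1 : ℝ) :=
        Finset.sum_le_sum fun p _ => coprimeDensity_le_one _ _
    _ = ((cone D).filter fun p => productDegrees p = (x, y)).card := by simp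
    _ ≤ (Finset.range (D + 1)).card := by
        rw [Nat.cast_le]
        refine Finset.card_le_card_of_injOn (fun p => p.1.1) (fun p hp => ?_)
          (fun p hp p' hp' h => ?_)
        · rw [Finset.mem_coe, Finset.mem_filter, mem_cone] at hp
          rw [Finset.mem_coe, Finset.mem_range]
          change p.1.1 < D + 1
          omega
        · rw [Finset.mem_coe, Finset.mem_filter, productDegrees] at hp hp'
          obtain ⟨⟨g, h1⟩, ⟨r, s⟩⟩ := p
          obtain ⟨⟨g', h1'⟩, ⟨r', s'⟩⟩ := p'
          have h2 := hp.2.trans hp'.2.symm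
          simp only [Prod.mk.injEq] at h2 h ⊢
          omega
    _ = D + 1 := by simp

/-! ### The divisor function -/

open Classical in
/-- The monic divisors of a non-zero polynomial. -/
noncomputable def monicDivisors [Finite F] (M : F[X]) : Finset F[X] :=
  ((Finset.range (M.natDegree + 1)).biUnion (monics F)).filter fun E => E ∣ M

theorem mem_monicDivisors [Finite F] {M E : F[X]} (hM : M ≠ 0) :
    E ∈ monicDivisors M ↔ E.Monic ∧ E ∣ M := by
  simp only [monicDivisors, Finset.mem_filter, Finset.mem_biUnion, Finset.mem_range, mem_monics]
  constructor
  · rintro ⟨⟨e, -, h, -⟩, h2⟩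
    exact ⟨h, h2⟩
  · rintro ⟨h, h2⟩
    exact ⟨⟨_, Nat.lt_succ_of_le (natDegree_le_of_dvd h2 hM), h, rfl⟩, h2⟩

/-- The number of monic divisors. -/
noncomputable def tau [Finite F] (M : F[X]) : ℕ := (monicDivisors M).card

theorem one_le_tau [Finite F] {M : F[X]} (hM : M ≠ 0) : 1 ≤ tau M :=
  Finset.card_pos.mpr ⟨1, (mem_monicDivisors hM).mpr ⟨monic_one, one_dvd _⟩⟩

theorem tau_one [Finite F] : tau (1 : F[X]) = 1 := by
  rw [tau, Finset.card_eq_one]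
  refine ⟨1, Finset.ext fun E => ?_⟩
  rw [mem_monicDivisors one_ne_zero, Finset.mem_singleton]
  constructor
  · rintro ⟨h1, h2⟩
    exact h1.eq_one_of_isUnit (isUnit_of_dvd_one h2)
  · rintro rfl
    exact ⟨monic_one, dvd_rfl⟩

theorem tau_mul_le [Finite F] {M N : F[X]} (hM : M ≠ 0) (hN : N ≠ 0) :
    tau (M * N) ≤ tau M * tau N := by
  classical
  rw [tau, tau, tau, ← Finset.card_product]
  refine (Finset.card_le_card (t := (monicDivisors M ×ˢ monicDivisors N).image
    fun x => x.1 * x.2) fun E hE => ?_).trans Finset.card_image_le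
  rw [mem_monicDivisors (mul_ne_zero hM hN)] at hE
  obtain ⟨E₁, E₂, h1, h2, hE12⟩ := exists_dvd_and_dvd_of_dvd_mul hE.2
  have hE1 : E₁ ≠ 0 := by
    rintro rfl
    rw [zero_mul] at hE12
    exact hE.1.ne_zero hE12
  have hl := leadingCoeff_ne_zero.mpr hE1
  have hm := monic_mul_leadingCoeff_inv hE1
  have heq : E = (E₁ * C E₁.leadingCoeff⁻¹) * (C E₁.leadingCoeff * E₂) := by
    rw [hE12, mul_assoc, ← mul_assoc (C _) (C _), ← C_mul, inv_mul_cancel₀ hl, C_1, one_mul]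
  rw [Finset.mem_image]
  refine ⟨(E₁ * C E₁.leadingCoeff⁻¹, C E₁.leadingCoeff * E₂), ?_, heq.symm⟩
  rw [Finset.mem_product, mem_monicDivisors hM, mem_monicDivisors hN]
  have hu : IsUnit (C E₁.leadingCoeff) := isUnit_C.mpr (isUnit_iff_ne_zero.mpr hl)
  have hu' : IsUnit (C E₁.leadingCoeff⁻¹) :=
    isUnit_C.mpr (isUnit_iff_ne_zero.mpr (inv_ne_zero hl))
  exact ⟨⟨hm, hu'.mul_right_dvd.mpr h1⟩, ⟨hm.of_mul_monic_left (heq ▸ hE.1),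
    hu.mul_left_dvd.mpr h2⟩⟩

theorem tau_irreducible_le [Finite F] {P : F[X]} (hP : P.Monic) (hi : Irreducible P) :
    tau P ≤ 2 := by
  classical
  refine (Finset.card_le_card (t := {1, P}) fun E hE => ?_).trans Finset.card_le_two
  rw [mem_monicDivisors hP.ne_zero] at hE
  rw [Finset.mem_insert, Finset.mem_singleton]
  rcases (hi.dvd_iff).mp hE.2 with h | h
  · exact Or.inl (hE.1.eq_one_of_isUnit h)
  · exact Or.inr (eq_of_monic_of_associated hE.1 hP h.symm)

theorem tau_pow_le [Finite F] {P : F[X]} (hP : P.Monic) (hi : Irreducible P) (k : ℕ) :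
    tau (P ^ k) ≤ k + 1 := by
  classical
  refine (Finset.card_le_card (t := (Finset.range (k + 1)).image fun i => P ^ i)
    fun E hE => ?_).trans (Finset.card_image_le.trans (Finset.card_range _).le)
  rw [mem_monicDivisors (hP.pow k).ne_zero] at hE
  obtain ⟨i, hik, h⟩ := (dvd_prime_pow hi.prime k).mp hE.2
  exact Finset.mem_image.mpr ⟨i, Finset.mem_range.mpr (by omega),
    (eq_of_monic_of_associated hE.1 (hP.pow i) h).symm⟩

theorem exists_irreducible_mul {M : F[X]} (hM : M.Monic) (h0 : M.natDegree ≠ 0) :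
    ∃ P N : F[X], P.Monic ∧ Irreducible P ∧ N.Monic ∧ M = P * N ∧
      M.natDegree = P.natDegree + N.natDegree := by
  have hu : ¬ IsUnit M := fun h => h0 (natDegree_eq_zero_of_isUnit h)
  obtain ⟨P, hPm, hPi, N, hN⟩ := exists_monic_irreducible_factor M hu
  have hNm := hPm.of_mul_monic_left (hN ▸ hM)
  exact ⟨P, N, hPm, hPi, hNm, hN, hN ▸ hPm.natDegree_mul hNm⟩

/-- Landreau's inequality: the divisor function is controlled by its values on small divisors. -/
theorem exists_small_divisor [Finite F] (K y : ℕ) {M : F[X]} (hM : M.Monic)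
    (h : 2 * M.natDegree ≤ K * y) :
    ∃ E : F[X], E.Monic ∧ E ∣ M ∧ E.natDegree ≤ y ∧ tau M ≤ 2 ^ K * tau E ^ K := by
  classical
  induction K generalizing M with
  | zero =>
    have h1 : M = 1 := hM.natDegree_eq_zero.mp (by omega)
    subst h1
    exact ⟨1, monic_one, dvd_rfl, by simp, by simp [tau_one]⟩
  | succ K ih =>
    -- Removing a factor `E` of degree at least `y / 2` leaves a cofactor within the budget `K`. The
    -- small divisor is either `E` itself or the one found for the cofactor, whichever has more
    -- divisors up to the factor `2`. A factor with at most two divisors need not be small, since it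
    -- is never selected.
    have key : ∀ E N : F[X], E.Monic → N.Monic → M = E * N → y ≤ 2 * E.natDegree →
        (E.natDegree ≤ y ∨ tau E ≤ 2) →
        ∃ E : F[X], E.Monic ∧ E ∣ M ∧ E.natDegree ≤ y ∧
          tau M ≤ 2 ^ (K + 1) * tau E ^ (K + 1) := by
      intro E N hE hN hEN hy hor
      have hdeg := hE.natDegree_mul hN
      rw [← hEN] at hdeg
      obtain ⟨E₂, hE2, hE2N, hE2d, ht⟩ := ih hN (by
        rw [hdeg, add_mul, one_mul] at h
        omega)
      have ht2 : tau M ≤ tau E * (2 ^ K * tau E₂ ^ K) := by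
        rw [hEN]
        exact (tau_mul_le hE.ne_zero hN.ne_zero).trans (Nat.mul_le_mul_left _ ht)
      have h12 := one_le_tau hE2.ne_zero
      have hcase2 : tau E ≤ 2 * tau E₂ → tau M ≤ 2 ^ (K + 1) * tau E₂ ^ (K + 1) := by
        intro hle
        calc tau M ≤ tau E * (2 ^ K * tau E₂ ^ K) := ht2
          _ ≤ (2 * tau E₂) * (2 ^ K * tau E₂ ^ K) := Nat.mul_le_mul_right _ hle
          _ = 2 ^ (K + 1) * tau E₂ ^ (K + 1) := by ring
      have hE2M : E₂ ∣ M := by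
        rw [hEN]
        exact hE2N.mul_left E
      by_cases hle : tau E ≤ 2 * tau E₂
      · exact ⟨E₂, hE2, hE2M, hE2d, hcase2 hle⟩
      · rcases hor with hor | hor
        · refine ⟨E, hE, hEN ▸ dvd_mul_right E N, hor, ?_⟩
          calc tau M ≤ tau E * (2 ^ K * tau E₂ ^ K) := ht2
            _ ≤ tau E * (2 ^ (K + 1) * tau E ^ K) := by
                refine Nat.mul_le_mul_left _ (Nat.mul_le_mul ?_ ?_)
                · exact Nat.pow_le_pow_right (by norm_num) (by omega)
                · exact Nat.pow_le_pow_left (by omega) _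
            _ = 2 ^ (K + 1) * tau E ^ (K + 1) := by ring
        · omega
    by_cases hMy : M.natDegree ≤ y
    · refine ⟨M, hM, dvd_rfl, hMy, ?_⟩
      have h1 := one_le_tau hM.ne_zero
      calc tau M ≤ tau M ^ (K + 1) := Nat.le_self_pow (by omega) _
        _ ≤ 2 ^ (K + 1) * tau M ^ (K + 1) := Nat.le_mul_of_pos_left _ (by positivity)
    -- Take a divisor `E` of maximal degree at most `y`. If its degree is less than `y / 2`, a prime
    -- factor `P` of the cofactor cannot also have degree less than `y / 2`, since `E P` would
    -- contradict maximality; then `P` is the factor to remove.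
    · obtain ⟨E, hEmem, hmax⟩ := Finset.exists_max_image
        ((monicDivisors M).filter fun E => E.natDegree ≤ y) natDegree
        ⟨1, Finset.mem_filter.mpr ⟨(mem_monicDivisors hM.ne_zero).mpr
          ⟨monic_one, one_dvd _⟩, by simp⟩⟩
      rw [Finset.mem_filter, mem_monicDivisors hM.ne_zero] at hEmem
      obtain ⟨⟨hE, N, hN⟩, hEy⟩ := hEmem
      have hNm := hE.of_mul_monic_left (hN ▸ hM)
      by_cases hy : y ≤ 2 * E.natDegree
      · exact key E N hE hNm hN hy (Or.inl hEy)
      · have hdeg := hE.natDegree_mul hNm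
        rw [← hN] at hdeg
        obtain ⟨P, N', hP, hPi, hN', rfl, -⟩ := exists_irreducible_mul hNm (by omega)
        have hPd := hPi.natDegree_pos
        by_cases hPy : y ≤ 2 * P.natDegree
        · exact key P (E * N') hP (hE.mul hN') (by rw [hN]; ring) hPy
            (Or.inr (tau_irreducible_le hP hPi))
        · exfalso
          have hEP := hE.natDegree_mul hP
          have := hmax (E * P) (by
            rw [Finset.mem_filter, mem_monicDivisors hM.ne_zero]
            exact ⟨⟨hE.mul hP, ⟨N', by rw [hN]; ring⟩⟩, by omega⟩)
          omega

/-- Prime factors of degree at least `J` are removed one at a time. Each at most doubles the number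
of divisors and uses up at least `J` of the degree. -/
theorem exists_smooth_divisor [Finite F] (J : ℕ) {M : F[X]} (hM : M.Monic) :
    ∃ (S : F[X]) (k : ℕ), S.Monic ∧ tau M ≤ 2 ^ k * tau S ∧ J * k + S.natDegree ≤ M.natDegree ∧
      ∀ P : F[X], P.Monic → Irreducible P → P ∣ S → P.natDegree < J := by
  induction hm : M.natDegree using Nat.strong_induction_on generalizing M with
  | _ m ih =>
    by_cases h : ∀ P : F[X], P.Monic → Irreducible P → P ∣ M → P.natDegree < J
    · exact ⟨M, 0, hM, by simp, by omega, h⟩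
    · push Not at h
      obtain ⟨P, hP, hPi, ⟨N, hN⟩, hPJ⟩ := h
      have hNm := hP.of_mul_monic_left (hN ▸ hM)
      have hdeg := hP.natDegree_mul hNm
      rw [← hN] at hdeg
      have hPd := hPi.natDegree_pos
      obtain ⟨S, k, hS, ht, hk, hsm⟩ := ih N.natDegree (by omega) hNm rfl
      refine ⟨S, k + 1, hS, ?_, ?_, hsm⟩
      · calc tau M ≤ tau P * tau N := by
              rw [hN]
              exact tau_mul_le hP.ne_zero hNm.ne_zero
          _ ≤ 2 * (2 ^ k * tau S) := Nat.mul_le_mul (tau_irreducible_le hP hPi) ht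
          _ = 2 ^ (k + 1) * tau S := by ring
      · rw [mul_add, mul_one]
        omega

/-- Each prime of `T` occurs to a power at most `m`, which accounts for a factor at most `m + 1`. -/
theorem tau_le_of_irreducible_mem [Finite F] (T : Finset F[X]) (m : ℕ) {S : F[X]} (hS : S.Monic)
    (hm : S.natDegree ≤ m) (hT : ∀ P : F[X], P.Monic → Irreducible P → P ∣ S → P ∈ T) :
    tau S ≤ (m + 1) ^ T.card := by
  classical
  induction T using Finset.induction_on generalizing S with
  | empty =>
    have h1 : S = 1 := by
      by_contra h1
      have h0 : S.natDegree ≠ 0 := fun h => h1 (hS.natDegree_eq_zero.mp h)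
      obtain ⟨P, N, hP, hPi, -, h, -⟩ := exists_irreducible_mul hS h0
      exact absurd (hT P hP hPi ⟨N, h⟩) (Finset.notMem_empty _)
    rw [h1, tau_one]
    simp
  | insert P T hPT ih =>
    rw [Finset.card_insert_of_notMem hPT]
    by_cases hP : P.Monic ∧ Irreducible P
    · have hfin : FiniteMultiplicity P S :=
        FiniteMultiplicity.of_prime_left hP.2.prime hS.ne_zero
      obtain ⟨N, hN, hPN⟩ := hfin.exists_eq_pow_mul_and_not_dvd
      set k := multiplicity P S
      have hNm := (hP.1.pow k).of_mul_monic_left (hN ▸ hS)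
      have hdeg := (hP.1.pow k).natDegree_mul hNm
      rw [← hN, hP.1.natDegree_pow] at hdeg
      have hPd := hP.2.natDegree_pos
      have hkm : k ≤ k * P.natDegree := Nat.le_mul_of_pos_right _ hPd
      calc tau S ≤ tau (P ^ k) * tau N := by
            rw [hN]
            exact tau_mul_le (hP.1.pow k).ne_zero hNm.ne_zero
        _ ≤ (m + 1) * (m + 1) ^ T.card := by
            refine Nat.mul_le_mul ((tau_pow_le hP.1 hP.2 k).trans (by omega))
              (ih hNm (by omega) fun P' hP' hPi' hd => ?_)
            rcases Finset.mem_insert.mp (hT P' hP' hPi' (hN ▸ hd.mul_left _)) with rfl | h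
            · exact absurd hd hPN
            · exact h
        _ = (m + 1) ^ (T.card + 1) := by ring
    · refine (ih hS hm fun P' hP' hPi' hd => ?_).trans
        (Nat.pow_le_pow_right (by omega) (by omega))
      rcases Finset.mem_insert.mp (hT P' hP' hPi' hd) with rfl | h
      · exact absurd ⟨hP', hPi'⟩ hP
      · exact h

/-- The divisor bound, uniformly in the field. -/
theorem tau_pow_le_card_pow (J : ℕ) : ∃ b : ℕ, ∀ (F : Type*) [Field F] [Finite F]
    (M : F[X]), M.Monic → tau M ^ J ≤ Nat.card F ^ M.natDegree * (M.natDegree + 1) ^ b := by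
  classical
  refine ⟨J * (2 ^ J) ^ J * J, fun F _ _ M hM => ?_⟩
  set q := Nat.card F with hq
  have hq2 : 2 ≤ q := two_le_card
  have hqm : ∀ k, J * k ≤ M.natDegree → (2 ^ k) ^ J ≤ q ^ M.natDegree := by
    intro k hk
    rw [← pow_mul, mul_comm k J]
    exact (Nat.pow_le_pow_right (by norm_num) hk).trans (Nat.pow_le_pow_left hq2 _)
  -- This case distinction makes the bound uniform in `q`. For `q ≥ 2 ^ J` the bound `tau M ≤ 2 ^
  -- deg M` already suffices. For `q < 2 ^ J` the primes of degree below `J` number at most `J (2 ^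
  -- J) ^ J`, whatever the field, and the larger primes are removed by `exists_smooth_divisor`.
  by_cases hqJ : 2 ^ J ≤ q
  · obtain ⟨S, k, hS, ht, hk, hsm⟩ := exists_smooth_divisor 1 hM
    have hS1 : S = 1 := by
      by_contra h1
      have h0 : S.natDegree ≠ 0 := fun h => h1 (hS.natDegree_eq_zero.mp h)
      obtain ⟨P, N, hP, hPi, -, h, -⟩ := exists_irreducible_mul hS h0
      have := hsm P hP hPi ⟨N, h⟩
      have := hPi.natDegree_pos
      omega
    rw [hS1, tau_one, mul_one] at ht
    calc tau M ^ J ≤ (2 ^ k) ^ J := Nat.pow_le_pow_left ht _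
      _ = (2 ^ J) ^ k := by rw [← pow_mul, ← pow_mul, mul_comm]
      _ ≤ q ^ k := Nat.pow_le_pow_left hqJ _
      _ ≤ q ^ M.natDegree := Nat.pow_le_pow_right (by omega) (by omega)
      _ ≤ _ := Nat.le_mul_of_pos_right _ (by positivity)
  · push Not at hqJ
    obtain ⟨S, k, hS, ht, hk, hsm⟩ := exists_smooth_divisor J hM
    let T : Finset F[X] := (Finset.range J).biUnion (monics F)
    have hTc : T.card ≤ J * (2 ^ J) ^ J := by
      refine Finset.card_biUnion_le.trans ?_
      calc ∑ e ∈ Finset.range J, (monics F e).card ≤ ∑ e ∈ Finset.range J, (2 ^ J) ^ J := by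
            refine Finset.sum_le_sum fun e he => ?_
            rw [Finset.mem_range] at he
            rw [card_monics]
            exact (Nat.pow_le_pow_left hqJ.le _).trans
              (Nat.pow_le_pow_right (by positivity) he.le)
        _ = J * (2 ^ J) ^ J := by simp
    have hSt := tau_le_of_irreducible_mem T M.natDegree hS (by omega) fun P hP hPi hd => by
      rw [Finset.mem_biUnion]
      exact ⟨P.natDegree, Finset.mem_range.mpr (hsm P hP hPi hd), mem_monics.mpr ⟨hP, rfl⟩⟩
    calc tau M ^ J ≤ (2 ^ k * (M.natDegree + 1) ^ T.card) ^ J :=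
          Nat.pow_le_pow_left (ht.trans (Nat.mul_le_mul_left _ hSt)) _
      _ = (2 ^ k) ^ J * (M.natDegree + 1) ^ (T.card * J) := by rw [mul_pow, ← pow_mul _ T.card]
      _ ≤ q ^ M.natDegree * (M.natDegree + 1) ^ (J * (2 ^ J) ^ J * J) :=
          Nat.mul_le_mul (hqm k (by omega))
            (Nat.pow_le_pow_right (by omega) (Nat.mul_le_mul_right _ hTc))

/-- Induction on `c`: one factor `tau E` is opened as a sum over factorizations `E = X Y`, and
submultiplicativity separates `X` from `Y`. There are `e + 1` possible degrees of `X`, so the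
exponent `b` becomes `2 b + 1`. -/
theorem sum_tau_pow_le (c : ℕ) : ∃ b : ℕ, ∀ (F : Type*) [Field F] [Finite F] (e : ℕ),
    ∑ E ∈ monics F e, tau E ^ c ≤ Nat.card F ^ e * (e + 1) ^ b := by
  classical
  induction c with
  | zero => exact ⟨0, fun F _ _ e => by simp [card_monics]⟩
  | succ c ih =>
    obtain ⟨b, hb⟩ := ih
    refine ⟨1 + (b + b), fun F _ _ e => ?_⟩
    have h1 : ∀ E ∈ monics F e, tau E ^ (c + 1) = ∑ X ∈ monicDivisors E, tau E ^ c := by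
      intro E _
      rw [Finset.sum_const, smul_eq_mul, ← tau, pow_succ']
    have h2 : ∑ E ∈ monics F e, ∑ X ∈ monicDivisors E, tau E ^ c =
        ∑ x ∈ Finset.range (e + 1), ∑ p ∈ monics F x ×ˢ monics F (e - x),
          tau (p.1 * p.2) ^ c := by
      rw [Finset.sum_sigma', Finset.sum_sigma']
      symm
      refine Finset.sum_bij (fun p _ => ⟨p.2.1 * p.2.2, p.2.1⟩) ?_ ?_ ?_ ?_
      · rintro ⟨x, X, Y⟩ h
        simp only [Finset.mem_sigma, Finset.mem_range, Finset.mem_product] at h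
        have hXY := mul_mem_monics h.2.1 h.2.2
        rw [show x + (e - x) = e by omega] at hXY
        simp only [Finset.mem_sigma]
        refine ⟨hXY, (mem_monicDivisors (mem_monics.mp hXY).1.ne_zero).mpr
          ⟨(mem_monics.mp h.2.1).1, dvd_mul_right _ _⟩⟩
      · rintro ⟨x, X, Y⟩ h ⟨x', X', Y'⟩ h' heq
        simp only [Finset.mem_sigma, Finset.mem_range, Finset.mem_product, mem_monics] at h h'
        simp only [Sigma.mk.injEq, heq_eq_eq] at heq
        obtain ⟨h3, rfl⟩ := heq
        obtain rfl := mul_left_cancel₀ h.2.1.1.ne_zero h3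
        obtain rfl : x = x' := h.2.1.2.symm.trans h'.2.1.2
        rfl
      · rintro ⟨E, X⟩ h
        simp only [Finset.mem_sigma] at h
        have hE := mem_monics.mp h.1
        obtain ⟨hX, Y, rfl⟩ := (mem_monicDivisors hE.1.ne_zero).mp h.2
        have hXm : X ∈ monics F X.natDegree := mem_monics.mpr ⟨hX, rfl⟩
        have h4 := of_mul_mem_monics hXm h.1
        refine ⟨⟨X.natDegree, X, Y⟩, ?_, rfl⟩
        simp only [Finset.mem_sigma, Finset.mem_range, Finset.mem_product]
        exact ⟨by omega, hXm, h4.2⟩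
      · intro _ _
        rfl
    rw [Finset.sum_congr rfl h1, h2]
    calc ∑ x ∈ Finset.range (e + 1), ∑ p ∈ monics F x ×ˢ monics F (e - x), tau (p.1 * p.2) ^ c
        ≤ ∑ x ∈ Finset.range (e + 1), Nat.card F ^ e * (e + 1) ^ (b + b) := by
          refine Finset.sum_le_sum fun x hx => ?_
          rw [Finset.mem_range] at hx
          calc ∑ p ∈ monics F x ×ˢ monics F (e - x), tau (p.1 * p.2) ^ c
              ≤ ∑ p ∈ monics F x ×ˢ monics F (e - x), tau p.1 ^ c * tau p.2 ^ c := by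
                refine Finset.sum_le_sum fun p hp => ?_
                rw [Finset.mem_product, mem_monics, mem_monics] at hp
                rw [← mul_pow]
                exact Nat.pow_le_pow_left (tau_mul_le hp.1.1.ne_zero hp.2.1.ne_zero) _
            _ = (∑ X ∈ monics F x, tau X ^ c) * ∑ Y ∈ monics F (e - x), tau Y ^ c := by
                rw [Finset.sum_mul_sum, Finset.sum_product]
            _ ≤ (Nat.card F ^ x * (x + 1) ^ b) * (Nat.card F ^ (e - x) * (e - x + 1) ^ b) :=
                Nat.mul_le_mul (hb F x) (hb F (e - x))
            _ ≤ (Nat.card F ^ x * (e + 1) ^ b) * (Nat.card F ^ (e - x) * (e + 1) ^ b) := by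
                refine Nat.mul_le_mul (Nat.mul_le_mul_left _ ?_) (Nat.mul_le_mul_left _ ?_) <;>
                exact Nat.pow_le_pow_left (by omega) _
            _ = (Nat.card F ^ x * Nat.card F ^ (e - x)) * (e + 1) ^ (b + b) := by
                rw [pow_add (e + 1)]
                ring
            _ = Nat.card F ^ e * (e + 1) ^ (b + b) := by
                rw [← pow_add, show x + (e - x) = e by omega]
      _ = Nat.card F ^ e * (e + 1) ^ (1 + (b + b)) := by
          rw [Finset.sum_const, Finset.card_range, smul_eq_mul, pow_add (e + 1) 1]
          ring

/-! ### The off-diagonal -/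

/-- Multiplying the congruence by `c⁻¹` exchanges its two sides; it therefore suffices to treat the
case in which `A C` has the larger degree. -/
theorem offCount_eq_inv [Finite F] (Q : F[X]) {c : F} (hc : c ≠ 0) (i j u v : ℕ) :
    offCount Q c i j u v = offCount Q c⁻¹ j i v u := by
  classical
  have key : ∀ c : F, c ≠ 0 → ∀ A B : F[X], (Q ∣ A - C c * B ∧ A ≠ C c * B) →
      (Q ∣ B - C c⁻¹ * A ∧ B ≠ C c⁻¹ * A) := by
    intro c hc A B h
    have h1 : B - C c⁻¹ * A = -C c⁻¹ * (A - C c * B) := by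
      have : C c⁻¹ * C c = 1 := by rw [← C_mul, inv_mul_cancel₀ hc, C_1]
      linear_combination (-B) * this
    refine ⟨h1 ▸ h.1.mul_left _, ?_⟩
    rw [← sub_ne_zero, h1]
    exact mul_ne_zero (neg_ne_zero.mpr (C_ne_zero.mpr (inv_ne_zero hc))) (sub_ne_zero.mpr h.2)
  rw [offCount, offCount]
  refine Finset.card_bij (fun x _ => (x.2, x.1)) ?_ ?_ ?_
  · intro x hx
    rw [Finset.mem_filter, mem_quads] at hx ⊢
    exact ⟨⟨hx.1.2, hx.1.1⟩, key c hc _ _ hx.2⟩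
  · intro x _ y _ h
    rw [Prod.mk.injEq] at h
    exact Prod.ext h.2 h.1
  · intro x hx
    refine ⟨(x.2, x.1), ?_, rfl⟩
    rw [Finset.mem_filter, mem_quads] at hx ⊢
    have := key c⁻¹ (inv_ne_zero hc) _ _ hx.2
    rw [inv_inv] at this
    exact ⟨⟨hx.1.2, hx.1.1⟩, this⟩

theorem offCount_eq_zero [Finite F] {Q : F[X]} {c : F} {i j u v : ℕ}
    (h1 : i + u < Q.natDegree) (h2 : j + v < Q.natDegree) : offCount Q c i j u v = 0 := by
  classical
  rw [offCount, Finset.card_eq_zero, Finset.filter_eq_empty_iff]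
  rintro x hx ⟨hd, hne⟩
  rw [mem_quads] at hx
  have hA := mem_monics.mp (mul_mem_monics hx.1.1 hx.1.2)
  have hB := mem_monics.mp (mul_mem_monics hx.2.1 hx.2.2)
  have h3 := natDegree_le_of_dvd hd (sub_ne_zero.mpr hne)
  have h4 := natDegree_sub_le (x.1.1 * x.1.2) (C c * (x.2.1 * x.2.2))
  have h5 := natDegree_C_mul_le c (x.2.1 * x.2.2)
  omega

theorem monic_C_mul_add_mul [Finite F] {Q N L : F[X]} (hQ : Q.Monic) (c : F) {n r : ℕ}
    (hN : N ∈ monics F n) (hL : L ∈ monics F r) (h : n < Q.natDegree + r) :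
    C c * N + Q * L ∈ monics F (Q.natDegree + r) := by
  have hQL := mem_monics.mp (mul_mem_monics (mem_monics.mpr ⟨hQ, rfl⟩) hL)
  rw [mem_monics] at hN ⊢
  have hlt : (C c * N).natDegree < (Q * L).natDegree := by
    have := natDegree_C_mul_le c N
    omega
  rw [add_comm]
  exact ⟨hQL.1.add_of_left (degree_lt_degree hlt),
    (natDegree_add_eq_left_of_natDegree_lt hlt).trans hQL.2⟩

/-- The shifted divisor sum that bounds the off-diagonal. -/
noncomputable def divisorSum [Finite F] (Q : F[X]) (c : F) (n r : ℕ) : ℕ :=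
  ∑ N ∈ monics F n, ∑ L ∈ monics F r, tau N * tau (C c * N + Q * L)

/-- Put `N = B D` and write `A C = c N + Q L`. Since `A C` has the larger degree, `L` is monic of
degree `r`. The quadruple is recovered from `N`, `L`, the divisor `B` of `N` and the divisor `A` of
`c N + Q L`. -/
theorem offCount_le_divisorSum [Finite F] {Q : F[X]} (hQ : Q.Monic) {c : F} {i j u v r : ℕ}
    (h1 : i + u = Q.natDegree + r) (h2 : j + v < i + u) :
    offCount Q c i j u v ≤ divisorSum Q c (j + v) r := by
  classical
  have hcard : divisorSum Q c (j + v) r = ((monics F (j + v) ×ˢ monics F r).sigma fun p =>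
      monicDivisors p.1 ×ˢ monicDivisors (C c * p.1 + Q * p.2)).card := by
    rw [divisorSum, Finset.card_sigma, Finset.sum_product]
    simp only [Finset.card_product, tau]
  rw [hcard, offCount]
  have hfact : ∀ x ∈ (quads F i j u v).filter fun x =>
      Q ∣ x.1.1 * x.1.2 - C c * (x.2.1 * x.2.2) ∧ x.1.1 * x.1.2 ≠ C c * (x.2.1 * x.2.2),
      Q * ((x.1.1 * x.1.2 - C c * (x.2.1 * x.2.2)) /ₘ Q) =
        x.1.1 * x.1.2 - C c * (x.2.1 * x.2.2) := by
    intro x hx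
    rw [Finset.mem_filter] at hx
    have h3 := modByMonic_add_div (x.1.1 * x.1.2 - C c * (x.2.1 * x.2.2)) Q
    rwa [(modByMonic_eq_zero_iff_dvd hQ).mpr hx.2.1, zero_add] at h3
  refine Finset.card_le_card_of_injOn (fun x => ⟨(x.2.1 * x.2.2,
    (x.1.1 * x.1.2 - C c * (x.2.1 * x.2.2)) /ₘ Q), (x.2.1, x.1.1)⟩) ?_ ?_
  · intro x hx
    have hf := hfact x hx
    rw [Finset.mem_coe, Finset.mem_filter, mem_quads] at hx
    have hA := mul_mem_monics hx.1.1.1 hx.1.1.2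
    have hB := mul_mem_monics hx.1.2.1 hx.1.2.2
    have hQm : Q ∈ monics F Q.natDegree := mem_monics.mpr ⟨hQ, rfl⟩
    have hlt : (C c * (x.2.1 * x.2.2)).natDegree < (x.1.1 * x.1.2).natDegree := by
      have := natDegree_C_mul_le c (x.2.1 * x.2.2)
      rw [(mem_monics.mp hA).2]
      rw [(mem_monics.mp hB).2] at this
      omega
    have hdiff : x.1.1 * x.1.2 - C c * (x.2.1 * x.2.2) ∈ monics F (Q.natDegree + r) := by
      rw [mem_monics]
      exact ⟨(mem_monics.mp hA).1.sub_of_left (degree_lt_degree hlt),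
        (natDegree_sub_eq_left_of_natDegree_lt hlt).trans ((mem_monics.mp hA).2.trans h1)⟩
    have hL := of_mul_mem_monics hQm (hf.symm ▸ hdiff)
    rw [Nat.add_sub_cancel_left] at hL
    simp only [Finset.coe_sigma, Set.mem_sigma_iff, Finset.mem_coe, Finset.mem_product]
    have hN0 := (mem_monics.mp hB).1.ne_zero
    have heq : C c * (x.2.1 * x.2.2) + Q * ((x.1.1 * x.1.2 - C c * (x.2.1 * x.2.2)) /ₘ Q) =
        x.1.1 * x.1.2 := by rw [hf]; ring
    refine ⟨⟨hB, hL.2⟩, (mem_monicDivisors hN0).mpr ⟨(mem_monics.mp hx.1.2.1).1,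
      dvd_mul_right _ _⟩, ?_⟩
    rw [heq, mem_monicDivisors (mem_monics.mp hA).1.ne_zero]
    exact ⟨(mem_monics.mp hx.1.1.1).1, dvd_mul_right _ _⟩
  · rintro x hx y hy heq
    have hfx := hfact x hx
    have hfy := hfact y hy
    rw [Finset.mem_coe, Finset.mem_filter, mem_quads] at hx hy
    simp only [Sigma.mk.injEq, heq_eq_eq, Prod.mk.injEq] at heq
    obtain ⟨⟨h3, h4⟩, h5, h6⟩ := heq
    have h7 : x.2.2 = y.2.2 := by
      rw [h5] at h3
      exact mul_left_cancel₀ (mem_monics.mp hy.1.2.1).1.ne_zero h3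
    have h8 : x.1.2 = y.1.2 := by
      have h9 : x.1.1 * x.1.2 = y.1.1 * y.1.2 := by
        rw [h4, hfy, h3] at hfx
        linear_combination -hfx
      rw [h6] at h9
      exact mul_left_cancel₀ (mem_monics.mp hy.1.1.1).1.ne_zero h9
    exact Prod.ext (Prod.ext h6 h8) (Prod.ext h5 h7)

-- The variable of larger degree is counted with the other one fixed: its degree is at least `deg
-- E`, and divisibility by `E` fixes its residue class. When that variable is `L`, the factor `Q` is
-- invertible modulo `E` because `deg E ≤ r < deg Q`.
open Classical in
theorem card_dvd_C_mul_add_mul_le [Finite F] {Q : F[X]} (hi : Irreducible Q)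
    {c : F} (hc : c ≠ 0) {n r : ℕ} (hr : r < Q.natDegree) {E : F[X]} (hE : E.Monic)
    (hd : E.natDegree ≤ max n r) :
    ((monics F n ×ˢ monics F r).filter fun p => E ∣ C c * p.1 + Q * p.2).card ≤
      Nat.card F ^ (n + r - E.natDegree) := by
  have hQ0 := hi.ne_zero
  rcases le_total r n with h | h
  · rw [max_eq_left h] at hd
    calc ((monics F n ×ˢ monics F r).filter fun p => E ∣ C c * p.1 + Q * p.2).card
        = ∑ L ∈ monics F r, ((monics F n).filter fun N => E ∣ C c * N + Q * L).card := by
          rw [Finset.card_filter, Finset.sum_product_right]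
          simp only [Finset.card_filter]
      _ ≤ ∑ L ∈ monics F r, Nat.card F ^ (n - E.natDegree) := by
          refine Finset.sum_le_sum fun L _ => card_le_of_congr hE hd (Finset.filter_subset _ _)
            fun A hA B hB => ?_
          rw [Finset.mem_filter] at hA hB
          have h1 := dvd_sub hA.2 hB.2
          rw [show C c * A + Q * L - (C c * B + Q * L) = C c * (A - B) by ring] at h1
          exact (isUnit_C.mpr (isUnit_iff_ne_zero.mpr hc)).dvd_mul_left.mp h1
      _ = Nat.card F ^ (n + r - E.natDegree) := by
          rw [Finset.sum_const, card_monics, smul_eq_mul, ← pow_add]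
          congr 1
          omega
  · rw [max_eq_right h] at hd
    have hcop : IsCoprime E Q := by
      refine (hi.coprime_iff_not_dvd.mpr fun hdvd => ?_).symm
      have := natDegree_le_of_dvd hdvd hE.ne_zero
      omega
    calc ((monics F n ×ˢ monics F r).filter fun p => E ∣ C c * p.1 + Q * p.2).card
        = ∑ N ∈ monics F n, ((monics F r).filter fun L => E ∣ C c * N + Q * L).card := by
          rw [Finset.card_filter, Finset.sum_product]
          simp only [Finset.card_filter]
      _ ≤ ∑ N ∈ monics F n, Nat.card F ^ (r - E.natDegree) := by
          refine Finset.sum_le_sum fun N _ => card_le_of_congr hE hd (Finset.filter_subset _ _)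
            fun A hA B hB => ?_
          rw [Finset.mem_filter] at hA hB
          have h1 := dvd_sub hA.2 hB.2
          rw [show C c * N + Q * A - (C c * N + Q * B) = Q * (A - B) by ring] at h1
          exact hcop.dvd_of_dvd_mul_left h1
      _ = Nat.card F ^ (n + r - E.natDegree) := by
          rw [Finset.sum_const, card_monics, smul_eq_mul, ← pow_add]
          congr 1
          omega

/-- The product of two divisor functions is at most the sum of their squares. The square at `N` is
averaged by `sum_tau_pow_le`. For `c N + Q L`, Landreau's inequality passes to a divisor `E` of
degree at most `max n r`, small enough for `card_dvd_C_mul_add_mul_le` to count the pairs it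
divides; only powers of `tau E` remain to be averaged. -/
theorem divisorSum_le_of_small_divisors (K : ℕ) : ∃ (A b : ℕ), ∀ (F : Type*) [Field F] [Finite F]
    (Q : F[X]) (_ : Q.Monic) (_ : Irreducible Q) (c : F) (_ : c ≠ 0) (n r : ℕ),
    r < Q.natDegree → n < Q.natDegree + r → 2 * (Q.natDegree + r) ≤ K * max n r →
    divisorSum Q c n r ≤ A * Nat.card F ^ (n + r) * (n + r + 1) ^ b := by
  classical
  obtain ⟨b₁, hb₁⟩ := sum_tau_pow_le 2
  obtain ⟨b₂, hb₂⟩ := sum_tau_pow_le (K * 2)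
  refine ⟨1 + (2 ^ K) ^ 2, b₁ + (b₂ + 1), fun F _ _ Q hQ hi c hc n r hr hn hK => ?_⟩
  set q := Nat.card F
  set y := max n r with hy
  have hsq : divisorSum Q c n r ≤ (∑ N ∈ monics F n, ∑ L ∈ monics F r, tau N ^ 2) +
      ∑ N ∈ monics F n, ∑ L ∈ monics F r, tau (C c * N + Q * L) ^ 2 := by
    rw [divisorSum, ← Finset.sum_add_distrib]
    refine Finset.sum_le_sum fun N _ => ?_
    rw [← Finset.sum_add_distrib]
    refine Finset.sum_le_sum fun L _ => ?_
    rcases le_total (tau N) (tau (C c * N + Q * L)) with h | h <;> nlinarith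
  have h1 : (∑ N ∈ monics F n, ∑ L ∈ monics F r, tau N ^ 2) ≤
      q ^ (n + r) * (n + r + 1) ^ (b₁ + (b₂ + 1)) := by
    simp only [Finset.sum_const, card_monics, smul_eq_mul]
    rw [← Finset.mul_sum]
    calc q ^ r * ∑ N ∈ monics F n, tau N ^ 2 ≤ q ^ r * (q ^ n * (n + 1) ^ b₁) :=
          Nat.mul_le_mul_left _ (hb₁ F n)
      _ = q ^ (n + r) * (n + 1) ^ b₁ := by rw [pow_add]; ring
      _ ≤ q ^ (n + r) * (n + r + 1) ^ (b₁ + (b₂ + 1)) := by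
          refine Nat.mul_le_mul_left _ ((Nat.pow_le_pow_left (by omega) _).trans
            (Nat.pow_le_pow_right (by omega) (by omega)))
  have h2 : (∑ N ∈ monics F n, ∑ L ∈ monics F r, tau (C c * N + Q * L) ^ 2) ≤
      (2 ^ K) ^ 2 * (q ^ (n + r) * (n + r + 1) ^ (b₁ + (b₂ + 1))) := by
    let T : Finset F[X] := (Finset.range (y + 1)).biUnion (monics F)
    calc (∑ N ∈ monics F n, ∑ L ∈ monics F r, tau (C c * N + Q * L) ^ 2)
        ≤ ∑ p ∈ monics F n ×ˢ monics F r, ∑ E ∈ T,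
            if E ∣ C c * p.1 + Q * p.2 then (2 ^ K) ^ 2 * tau E ^ (K * 2) else 0 := by
          rw [Finset.sum_product]
          refine Finset.sum_le_sum fun N hN => Finset.sum_le_sum fun L hL => ?_
          have hM := mem_monics.mp (monic_C_mul_add_mul hQ c hN hL hn)
          obtain ⟨E, hE, hEd, hEy, ht⟩ := exists_small_divisor K y hM.1 (by rw [hM.2]; exact hK)
          have hET : E ∈ T := Finset.mem_biUnion.mpr
            ⟨E.natDegree, Finset.mem_range.mpr (by omega), mem_monics.mpr ⟨hE, rfl⟩⟩
          refine le_trans ?_ (Finset.single_le_sum (fun _ _ => Nat.zero_le _) hET)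
          rw [if_pos hEd, pow_mul, ← mul_pow]
          exact Nat.pow_le_pow_left ht 2
      _ = ∑ E ∈ T, ((monics F n ×ˢ monics F r).filter
            fun p => E ∣ C c * p.1 + Q * p.2).card * ((2 ^ K) ^ 2 * tau E ^ (K * 2)) := by
          rw [Finset.sum_comm]
          refine Finset.sum_congr rfl fun E _ => ?_
          rw [← Finset.sum_filter, Finset.sum_const, smul_eq_mul]
      _ ≤ ∑ E ∈ T, q ^ (n + r - E.natDegree) * ((2 ^ K) ^ 2 * tau E ^ (K * 2)) := by
          refine Finset.sum_le_sum fun E hE => Nat.mul_le_mul_right _ ?_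
          rw [Finset.mem_biUnion] at hE
          obtain ⟨e, he, hEe⟩ := hE
          rw [Finset.mem_range] at he
          rw [mem_monics] at hEe
          exact card_dvd_C_mul_add_mul_le hi hc hr hEe.1 (by omega)
      _ ≤ ∑ e ∈ Finset.range (y + 1), ∑ E ∈ monics F e,
            q ^ (n + r - E.natDegree) * ((2 ^ K) ^ 2 * tau E ^ (K * 2)) := by
          refine (Finset.sum_biUnion fun e _ e' _ hne => ?_).le
          refine Finset.disjoint_left.mpr fun E h h' => hne ?_
          exact (mem_monics.mp h).2.symm.trans (mem_monics.mp h').2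
      _ ≤ ∑ e ∈ Finset.range (y + 1), (2 ^ K) ^ 2 * (q ^ (n + r) * (n + r + 1) ^ b₂) := by
          refine Finset.sum_le_sum fun e he => ?_
          rw [Finset.mem_range] at he
          have hen : e ≤ n + r := by omega
          calc ∑ E ∈ monics F e, q ^ (n + r - E.natDegree) * ((2 ^ K) ^ 2 * tau E ^ (K * 2))
              = q ^ (n + r - e) * (2 ^ K) ^ 2 * ∑ E ∈ monics F e, tau E ^ (K * 2) := by
                rw [Finset.mul_sum]
                refine Finset.sum_congr rfl fun E hE => ?_
                rw [(mem_monics.mp hE).2]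
                ring
            _ ≤ q ^ (n + r - e) * (2 ^ K) ^ 2 * (q ^ e * (e + 1) ^ b₂) :=
                Nat.mul_le_mul_left _ (hb₂ F e)
            _ = (2 ^ K) ^ 2 * ((q ^ (n + r - e) * q ^ e) * (e + 1) ^ b₂) := by ring
            _ ≤ _ := by
                rw [← pow_add, show n + r - e + e = n + r by omega]
                exact Nat.mul_le_mul_left _ (Nat.mul_le_mul_left _
                  (Nat.pow_le_pow_left (by omega) _))
      _ = (2 ^ K) ^ 2 * (q ^ (n + r) * ((y + 1) * (n + r + 1) ^ b₂)) := by
          rw [Finset.sum_const, Finset.card_range, smul_eq_mul]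
          ring
      _ ≤ _ := by
          refine Nat.mul_le_mul_left _ (Nat.mul_le_mul_left _ ?_)
          calc (y + 1) * (n + r + 1) ^ b₂ ≤ (n + r + 1) * (n + r + 1) ^ b₂ :=
                Nat.mul_le_mul_right _ (by omega)
            _ = (n + r + 1) ^ (b₂ + 1) := by ring
            _ ≤ _ := Nat.pow_le_pow_right (by omega) (by omega)
  calc divisorSum Q c n r ≤ _ := hsq.trans (add_le_add h1 h2)
    _ = _ := by ring

/-- Meant for the range where `n` and `r` are too small for Landreau's inequality: one divisor
function is bounded pointwise, and only the other is averaged. -/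
theorem divisorSum_le_of_tau_le : ∃ b : ℕ, ∀ (F : Type*) [Field F] [Finite F]
    (Q : F[X]) (_ : Q.Monic) (c : F) (n r : ℕ) (t : ℝ), n < Q.natDegree + r →
    (∀ M ∈ monics F (Q.natDegree + r), (tau M : ℝ) ≤ t) →
    (divisorSum Q c n r : ℝ) ≤ t * ((Nat.card F : ℝ) ^ (n + r) * ((n : ℝ) + 1) ^ b) := by
  obtain ⟨b, hb⟩ := sum_tau_pow_le 1
  refine ⟨b, fun F _ _ Q hQ c n r t hn ht => ?_⟩
  have h1 := hb F n
  simp only [pow_one] at h1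
  have h2 : (∑ N ∈ monics F n, (tau N : ℝ)) ≤ (Nat.card F : ℝ) ^ n * ((n : ℝ) + 1) ^ b := by
    exact_mod_cast h1
  have hmem : X ^ (Q.natDegree + r) ∈ monics F (Q.natDegree + r) :=
    mem_monics.mpr ⟨monic_X_pow _, natDegree_X_pow _⟩
  have ht0 : 0 ≤ t := (Nat.cast_nonneg _).trans (ht _ hmem)
  calc (divisorSum Q c n r : ℝ)
      = ∑ N ∈ monics F n, ∑ L ∈ monics F r, (tau N : ℝ) * tau (C c * N + Q * L) := by
        rw [divisorSum]
        push_cast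
        rfl
    _ ≤ ∑ N ∈ monics F n, ∑ L ∈ monics F r, (tau N : ℝ) * t := by
        refine Finset.sum_le_sum fun N hN => Finset.sum_le_sum fun L hL => ?_
        exact mul_le_mul_of_nonneg_left (ht _ (monic_C_mul_add_mul hQ c hN hL hn))
          (Nat.cast_nonneg _)
    _ = (Nat.card F : ℝ) ^ r * t * ∑ N ∈ monics F n, (tau N : ℝ) := by
        rw [Finset.mul_sum]
        refine Finset.sum_congr rfl fun N _ => ?_
        rw [Finset.sum_const, card_monics, nsmul_eq_mul]
        push_cast
        ring
    _ ≤ (Nat.card F : ℝ) ^ r * t * ((Nat.card F : ℝ) ^ n * ((n : ℝ) + 1) ^ b) :=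
        mul_le_mul_of_nonneg_left h2 (by positivity)
    _ = _ := by rw [pow_add]; ring

/-- The off-diagonal decays exponentially in `2 deg Q - (i + j + u + v)`, up to a power of
`deg Q`. -/
theorem offCount_div_le : ∃ (A : ℝ) (b : ℕ), 0 ≤ A ∧ ∀ (F : Type*) [Field F] [Finite F]
    (Q : F[X]) (_ : Q.Monic) (_ : Irreducible Q) (D : ℕ) (_ : Q.natDegree = D + 1) (c : F)
    (_ : c ≠ 0), ∀ x ∈ triangle D, ∀ y ∈ triangle D,
    (Real.sqrt (Nat.card F) ^ (x.1 + x.2 + y.1 + y.2))⁻¹ * offCount Q c x.1 x.2 y.1 y.2 ≤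
      A * ((D : ℝ) + 1) ^ b * (((2 : ℝ) ^ (1 / 4 : ℝ)) ^
        (2 * (D + 1) - (x.1 + x.2 + y.1 + y.2)))⁻¹ := by
  obtain ⟨A, b₁, h₁⟩ := divisorSum_le_of_small_divisors 16
  obtain ⟨b₂, h₂⟩ := tau_pow_le_card_pow 16
  obtain ⟨b₃, h₃⟩ := divisorSum_le_of_tau_le
  refine ⟨A + 2 ^ b₂, b₁ + b₂ + b₃, by positivity, ?_⟩
  intro F _ _ Q hQ hi D hD
  set q : ℝ := (Nat.card F : ℝ) with hq
  have hq2 : (2 : ℝ) ≤ q := by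
    rw [hq]
    exact_mod_cast two_le_card (F := F)
  set θ : ℝ := (2 : ℝ) ^ (1 / 4 : ℝ) with hθ
  have hθ1 : 1 ≤ θ := Real.one_le_rpow (by norm_num) (by norm_num)
  set ω : ℝ := q ^ (1 / 4 : ℝ) with hω
  have hθω : θ ≤ ω := Real.rpow_le_rpow (by norm_num) hq2 (by norm_num)
  have hω1 : 1 ≤ ω := hθ1.trans hθω
  have hω2 : ω ^ 2 = Real.sqrt q := by
    rw [hω, Real.sqrt_eq_rpow, ← Real.rpow_natCast, ← Real.rpow_mul (by linarith)]
    norm_num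
  have hω4 : ω ^ 4 = q := by
    rw [show (4 : ℕ) = 2 * 2 by norm_num, pow_mul, hω2, Real.sq_sqrt (by linarith)]
  have hd1 : (1 : ℝ) ≤ (D : ℝ) + 1 := by
    have : (0 : ℝ) ≤ D := Nat.cast_nonneg _
    linarith
  have main : ∀ c : F, c ≠ 0 → ∀ i j u v : ℕ, i + j ≤ D → u + v ≤ D → j + v < i + u →
      (Real.sqrt q ^ (i + j + u + v))⁻¹ * offCount Q c i j u v ≤
        (A + 2 ^ b₂) * ((D : ℝ) + 1) ^ (b₁ + b₂ + b₃) *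
          (θ ^ (2 * (D + 1) - (i + j + u + v)))⁻¹ := by
    intro c hc i j u v hij huv hlt
    by_cases hm : i + u < Q.natDegree
    · rw [offCount_eq_zero hm (by omega)]
      simp only [Nat.cast_zero, mul_zero]
      positivity
    · obtain ⟨r, hr⟩ := Nat.exists_eq_add_of_le (not_lt.mp hm)
      have hoff : (offCount Q c i j u v : ℝ) ≤ divisorSum Q c (j + v) r := by
        exact_mod_cast offCount_le_divisorSum hQ hr hlt
      set n := j + v with hn
      set s := 2 * (D + 1) - (i + j + u + v) with hs
      have hsr : i + j + u + v + s = 2 * (D + 1) := by omega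
      have hns : n + r + s = D + 1 := by omega
      -- Trivial counting of the pairs `(N, L)` already saves `q ^ (-s/2)`, where `s` is the
      -- distance of the total degree from `2 deg Q`.
      have hqpow : (Real.sqrt q ^ (i + j + u + v))⁻¹ * q ^ (n + r) = (ω ^ (2 * s))⁻¹ := by
        rw [← hω2, ← hω4, ← pow_mul, ← pow_mul, inv_mul_eq_iff_eq_mul₀ (by positivity),
          eq_mul_inv_iff_mul_eq₀ (by positivity), ← pow_add]
        congr 1
        omega
      have hωθ : (ω ^ s)⁻¹ ≤ (θ ^ s)⁻¹ :=
        inv_anti₀ (by positivity) (pow_le_pow_left₀ (by positivity) hθω _)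
      have hn1 : (n : ℝ) + 1 ≤ (D : ℝ) + 1 := by
        have : (n : ℝ) ≤ D := by exact_mod_cast (by omega : n ≤ D)
        linarith
      have hsqrt0 : 0 ≤ (Real.sqrt q ^ (i + j + u + v))⁻¹ := by positivity
      -- As `n + r + s = D + 1`, small `s` makes `max n r` at least `(D + 1) / 4`, and `16` is large
      -- enough in Landreau's inequality. If `s > (D + 1) / 2`, the degree `deg Q + r` is below `4
      -- s`, so the divisor bound with exponent `16` loses only `q ^ (s/4)`, half of the saving.
      -- What remains is at most `2 ^ (-s/4)`, uniformly in `q`.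
      by_cases h2s : 2 * s ≤ D + 1
      · have h4 := h₁ F Q hQ hi c hc n r (by omega) (by omega) (by
          rcases le_total n r with h | h
          · rw [max_eq_right h]; omega
          · rw [max_eq_left h]; omega)
        have h5 : (divisorSum Q c n r : ℝ) ≤ A * q ^ (n + r) * ((n : ℝ) + r + 1) ^ b₁ := by
          rw [hq]
          exact_mod_cast h4
        have hnr : (n : ℝ) + r + 1 ≤ (D : ℝ) + 1 := by
          have : (n : ℝ) + r ≤ D := by exact_mod_cast (by omega : n + r ≤ D)
          linarith
        calc (Real.sqrt q ^ (i + j + u + v))⁻¹ * (offCount Q c i j u v : ℝ)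
            ≤ (Real.sqrt q ^ (i + j + u + v))⁻¹ *
                (A * q ^ (n + r) * ((n : ℝ) + r + 1) ^ b₁) :=
              mul_le_mul_of_nonneg_left (hoff.trans h5) hsqrt0
          _ = A * ((n : ℝ) + r + 1) ^ b₁ *
                ((Real.sqrt q ^ (i + j + u + v))⁻¹ * q ^ (n + r)) := by ring
          _ = A * ((n : ℝ) + r + 1) ^ b₁ * (ω ^ (2 * s))⁻¹ := by rw [hqpow]
          _ ≤ (A + 2 ^ b₂) * ((D : ℝ) + 1) ^ (b₁ + b₂ + b₃) * (θ ^ s)⁻¹ := by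
              gcongr
              · have : (0 : ℝ) ≤ 2 ^ b₂ := by positivity
                linarith
              · calc ((n : ℝ) + r + 1) ^ b₁ ≤ ((D : ℝ) + 1) ^ b₁ :=
                      pow_le_pow_left₀ (by positivity) hnr _
                  _ ≤ _ := pow_le_pow_right₀ hd1 (by omega)
              · calc θ ^ s ≤ ω ^ s := pow_le_pow_left₀ (by positivity) hθω _
                  _ ≤ ω ^ (2 * s) := pow_le_pow_right₀ hω1 (by omega)
      · have ht : ∀ M ∈ monics F (Q.natDegree + r),
            (tau M : ℝ) ≤ ω ^ s * (2 * ((D : ℝ) + 1)) ^ b₂ := by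
          intro M hM
          rw [mem_monics] at hM
          have h4 := h₂ F M hM.1
          rw [hM.2] at h4
          have h5 : (tau M : ℝ) ^ 16 ≤ q ^ (Q.natDegree + r) *
              (((Q.natDegree + r : ℕ) : ℝ) + 1) ^ b₂ := by
            rw [hq]
            exact_mod_cast h4
          refine (pow_le_pow_iff_left₀ (Nat.cast_nonneg _) (by positivity)
            (by norm_num : 16 ≠ 0)).mp (h5.trans ?_)
          rw [mul_pow, ← pow_mul, ← pow_mul]
          have hle : ((Q.natDegree + r : ℕ) : ℝ) + 1 ≤ 2 * ((D : ℝ) + 1) := by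
            exact_mod_cast (by omega : Q.natDegree + r + 1 ≤ 2 * (D + 1))
          refine mul_le_mul ?_ ?_ (by positivity) (by positivity)
          · rw [← hω4, ← pow_mul]
            exact pow_le_pow_right₀ hω1 (by omega)
          · calc (((Q.natDegree + r : ℕ) : ℝ) + 1) ^ b₂ ≤ (2 * ((D : ℝ) + 1)) ^ b₂ :=
                  pow_le_pow_left₀ (by positivity) hle _
              _ ≤ _ := pow_le_pow_right₀ (by linarith) (by omega)
        have h5 := h₃ F Q hQ c n r _ (by omega) ht
        calc (Real.sqrt q ^ (i + j + u + v))⁻¹ * (offCount Q c i j u v : ℝ)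
            ≤ (Real.sqrt q ^ (i + j + u + v))⁻¹ *
                (ω ^ s * (2 * ((D : ℝ) + 1)) ^ b₂ * (q ^ (n + r) * ((n : ℝ) + 1) ^ b₃)) :=
              mul_le_mul_of_nonneg_left (hoff.trans h5) hsqrt0
          _ = ((Real.sqrt q ^ (i + j + u + v))⁻¹ * q ^ (n + r)) *
                (ω ^ s * (2 ^ b₂ * ((D : ℝ) + 1) ^ b₂ * ((n : ℝ) + 1) ^ b₃)) := by
              rw [mul_pow]
              ring
          _ = 2 ^ b₂ * (((D : ℝ) + 1) ^ b₂ * ((n : ℝ) + 1) ^ b₃) * (ω ^ s)⁻¹ := by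
              rw [hqpow, two_mul s, pow_add]
              field_simp
          _ ≤ (A + 2 ^ b₂) * ((D : ℝ) + 1) ^ (b₁ + b₂ + b₃) * (θ ^ s)⁻¹ := by
              refine mul_le_mul (mul_le_mul ?_ ?_ (by positivity) (by positivity)) hωθ
                (by positivity) (by positivity)
              · have : (0 : ℝ) ≤ A := Nat.cast_nonneg _
                linarith
              · calc ((D : ℝ) + 1) ^ b₂ * ((n : ℝ) + 1) ^ b₃
                    ≤ ((D : ℝ) + 1) ^ b₂ * ((D : ℝ) + 1) ^ b₃ := by gcongr
                  _ = ((D : ℝ) + 1) ^ (b₂ + b₃) := by rw [pow_add]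
                  _ ≤ _ := pow_le_pow_right₀ hd1 (by omega)
  intro c hc x hx y hy
  rw [mem_triangle] at hx hy
  -- If both products have the same degree, it is at most `D < deg Q`, so the congruence is an
  -- equality and nothing lies off the diagonal.
  rcases lt_trichotomy (x.1 + y.1) (x.2 + y.2) with h | h | h
  · have h4 := main c⁻¹ (inv_ne_zero hc) x.2 x.1 y.2 y.1 (by omega) (by omega) h
    rw [offCount_eq_inv Q hc]
    rwa [show x.2 + x.1 + y.2 + y.1 = x.1 + x.2 + y.1 + y.2 by ring] at h4
  · rw [offCount_eq_zero (by omega) (by omega)]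
    simp only [Nat.cast_zero, mul_zero]
    positivity
  · exact main c hc x.1 x.2 y.1 y.2 hx hy h

/-! ### Estimates for the weights -/

/-- A kernel of total mass one with exponential decay. -/
structure IsDecayingKernel (κ : ℕ → ℝ) : Prop where
  abs_le : ∀ e, |κ e| ≤ 2 * (3 / 4) ^ e
  abs_sum_sub_one_le : ∀ x, |(∑ e ∈ Finset.range (x + 1), κ e) - 1| ≤ 2 * (3 / 4) ^ x

theorem isDecayingKernel_oddKernel : IsDecayingKernel oddKernel := by
  refine ⟨fun e => ?_, fun x => ?_⟩
  · rw [oddKernel]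
    split_ifs with h
    · rw [h]; norm_num
    · rw [abs_zero]; positivity
  · have : ∑ e ∈ Finset.range (x + 1), oddKernel e = 1 := by
      simp [oddKernel]
    rw [this, sub_self, abs_zero]
    positivity

/-- In the limit the positive terms add up to `1 + 1/√q`, which the negative term at `e = 0`
corrects to `1`. -/
theorem sum_evenKernel {q : ℕ} (hq : 2 ≤ q) (x : ℕ) :
    ∑ e ∈ Finset.range (x + 1), evenKernel q e =
      1 - (1 + (Real.sqrt q)⁻¹) * (Real.sqrt q ^ x)⁻¹ := by
  have hs : (0 : ℝ) < Real.sqrt q := Real.sqrt_pos.mpr (by exact_mod_cast (by omega : 0 < q))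
  have hsq : (q : ℝ) = Real.sqrt q ^ 2 := (Real.sq_sqrt (Nat.cast_nonneg _)).symm
  induction x with
  | zero => simp [evenKernel]
  | succ x ih =>
    rw [Finset.sum_range_succ, ih, evenKernel, if_neg (by omega)]
    nth_rewrite 3 [hsq]
    field_simp
    ring

theorem isDecayingKernel_evenKernel {q : ℕ} (hq : 2 ≤ q) : IsDecayingKernel (evenKernel q) := by
  have hq2 : (2 : ℝ) ≤ q := by exact_mod_cast hq
  have hs0 : (0 : ℝ) < Real.sqrt q := Real.sqrt_pos.mpr (by linarith)
  -- The ratio `3/4` exceeds `1/√2`, so it works for every `q ≥ 2`.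
  have hs : 4 / 3 ≤ Real.sqrt q := Real.le_sqrt_of_sq_le (by norm_num; linarith)
  have hsq : Real.sqrt q ^ 2 = (q : ℝ) := Real.sq_sqrt (Nat.cast_nonneg _)
  have hinv : (Real.sqrt q)⁻¹ ≤ 3 / 4 := by
    rw [inv_le_comm₀ hs0 (by norm_num)]
    norm_num
    linarith
  have hpow : ∀ x : ℕ, (Real.sqrt q ^ x)⁻¹ ≤ (3 / 4) ^ x := fun x => by
    rw [← inv_pow]
    exact pow_le_pow_left₀ (by positivity) hinv x
  refine ⟨fun e => ?_, fun x => ?_⟩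
  · rw [evenKernel]
    split_ifs with h
    · rw [h, abs_neg, abs_of_pos (by positivity)]
      linarith
    · rw [abs_of_nonneg (mul_nonneg (mul_nonneg (by linarith) (by positivity)) (by positivity))]
      obtain ⟨e, rfl⟩ := Nat.exists_eq_succ_of_ne_zero h
      have h1 : ((q : ℝ) - 1) * (Real.sqrt q)⁻¹ * (Real.sqrt q ^ (e + 1))⁻¹ ≤
          (Real.sqrt q ^ e)⁻¹ := by
        rw [pow_succ, mul_inv, show (q : ℝ) - 1 = Real.sqrt q ^ 2 - 1 by rw [hsq]]
        have h2 : (Real.sqrt q ^ 2 - 1) * (Real.sqrt q)⁻¹ * ((Real.sqrt q ^ e)⁻¹ *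
            (Real.sqrt q)⁻¹) = (Real.sqrt q ^ e)⁻¹ * (1 - (Real.sqrt q)⁻¹ ^ 2) := by
          field_simp
        rw [h2]
        refine mul_le_of_le_one_right (by positivity) ?_
        have : 0 ≤ (Real.sqrt q)⁻¹ ^ 2 := by positivity
        linarith
      refine (h1.trans (hpow e)).trans ?_
      rw [Nat.succ_eq_add_one, pow_succ]
      have : (0 : ℝ) ≤ (3 / 4) ^ e := by positivity
      linarith
  · rw [sum_evenKernel hq, sub_right_comm, sub_self, zero_sub, abs_neg,
      abs_of_nonneg (by positivity)]
    exact mul_le_mul (by linarith) (hpow x) (by positivity) (by norm_num)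

/-! ### Comparison of the weights with their limiting shape -/

theorem reflectedWeight_eq_sum_shift (κ p : ℕ → ℝ) (D a b : ℕ) :
    reflectedWeight κ p D a b = ∑ e ∈ Finset.range (D - a - b), ∑ f ∈ Finset.range (D - a - b),
      if e + f < D - a - b then κ e * κ f * (p (D - (a + e)) * p (D - (b + f))) else 0 := by
  rw [reflectedWeight, ← Finset.sum_product', ← Finset.sum_product', ← Finset.sum_filter,
    ← Finset.sum_filter]
  refine Finset.sum_bij' (fun x _ => (x.1 - a, x.2 - b)) (fun x _ => (a + x.1, b + x.2))
    ?_ ?_ ?_ ?_ ?_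
  · intro x hx
    simp only [Finset.mem_filter, Finset.mem_product, Finset.mem_range] at hx ⊢
    omega
  · intro x hx
    simp only [Finset.mem_filter, Finset.mem_product, Finset.mem_range] at hx ⊢
    omega
  · intro x hx
    simp only [Finset.mem_filter, Finset.mem_product, Finset.mem_range] at hx
    exact Prod.ext (by simp only; omega) (by simp only; omega)
  · intro x _
    simp
  · intro x hx
    simp only [Finset.mem_filter, Finset.mem_product, Finset.mem_range] at hx
    simp only
    rw [show a + (x.1 - a) = x.1 by omega, show b + (x.2 - b) = x.2 by omega]

theorem sum_geometric_le (n : ℕ) : ∑ e ∈ Finset.range n, (3 / 4 : ℝ) ^ e ≤ 4 := by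
  have h := geom_sum_eq (by norm_num : (3 / 4 : ℝ) ≠ 1) n
  rw [h, div_le_iff_of_neg (by norm_num)]
  have : (0 : ℝ) ≤ (3 / 4) ^ n := by positivity
  linarith

theorem sum_succ_mul_geometric_le (n : ℕ) :
    ∑ e ∈ Finset.range n, ((e : ℝ) + 1) * (3 / 4 : ℝ) ^ e ≤ 16 := by
  have h : ∀ n : ℕ, ∑ e ∈ Finset.range n, ((e : ℝ) + 1) * (3 / 4 : ℝ) ^ e =
      16 - (4 * n + 16) * (3 / 4) ^ n := by
    intro n
    induction n with
    | zero => simp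
    | succ n ih =>
      rw [Finset.sum_range_succ, ih, pow_succ]
      push_cast
      ring
  rw [h]
  have : (0 : ℝ) ≤ (4 * n + 16) * (3 / 4) ^ n := by positivity
  linarith

theorem abs_pow_mul_pow_sub_le (k : ℕ) {y z y' z' : ℝ} (hy : 0 ≤ y) (hy1 : y ≤ 1) (hz : 0 ≤ z)
    (hz1 : z ≤ 1) (hy' : 0 ≤ y') (hy1' : y' ≤ 1) (hz' : 0 ≤ z') (hz1' : z' ≤ 1) :
    |y ^ k * z ^ k - y' ^ k * z' ^ k| ≤ k * (|y - y'| + |z - z'|) := by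
  rw [← mul_pow, ← mul_pow]
  refine (abs_pow_sub_pow_le _ _ _).trans ?_
  have h1 : |y * z - y' * z'| ≤ |y - y'| + |z - z'| := by
    have : y * z - y' * z' = (y - y') * z + y' * (z - z') := by ring
    rw [this]
    refine (abs_add_le _ _).trans (add_le_add ?_ ?_)
    · rw [abs_mul, abs_of_nonneg hz]
      exact mul_le_of_le_one_right (abs_nonneg _) hz1
    · rw [abs_mul, abs_of_nonneg hy']
      exact mul_le_of_le_one_left (abs_nonneg _) hy1'
  have h2 : max |y * z| |y' * z'| ^ (k - 1) ≤ 1 := by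
    refine pow_le_one₀ (le_max_of_le_left (abs_nonneg _)) (max_le ?_ ?_)
    · rw [abs_of_nonneg (by positivity)]
      exact mul_le_one₀ hy1 hz hz1
    · rw [abs_of_nonneg (by positivity)]
      exact mul_le_one₀ hy1' hz' hz1'
  calc |y * z - y' * z'| * k * max |y * z| |y' * z'| ^ (k - 1) ≤ |y * z - y' * z'| * k * 1 :=
        mul_le_mul_of_nonneg_left h2 (by positivity)
    _ ≤ k * (|y - y'| + |z - z'|) := by
        rw [mul_one, mul_comm]
        exact mul_le_mul_of_nonneg_left h1 (Nat.cast_nonneg _)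

/-- A summable function controlling the boundary terms of `weight`. -/
noncomputable def boundaryDecay (x : ℕ) : ℝ := ((x : ℝ) + 1) ^ 2 * (3 / 4) ^ x

theorem boundaryDecay_nonneg (x : ℕ) : 0 ≤ boundaryDecay x := by
  rw [boundaryDecay]; positivity

theorem exists_sum_boundaryDecay_le :
    ∃ S : ℝ, 0 ≤ S ∧ ∀ t : Finset ℕ, ∑ x ∈ t, boundaryDecay x ≤ S := by
  have h : Summable boundaryDecay := by
    have h0 := summable_pow_mul_geometric_of_norm_lt_one (R := ℝ) 0 (r := 3 / 4) (by norm_num)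
    have h1 := summable_pow_mul_geometric_of_norm_lt_one (R := ℝ) 1 (r := 3 / 4) (by norm_num)
    have h2 := summable_pow_mul_geometric_of_norm_lt_one (R := ℝ) 2 (r := 3 / 4) (by norm_num)
    refine ((h2.add (h1.mul_left 2)).add h0).congr fun x => ?_
    rw [boundaryDecay]
    ring
  exact ⟨∑' x, boundaryDecay x, tsum_nonneg boundaryDecay_nonneg,
    fun t => h.sum_le_tsum t fun x _ => boundaryDecay_nonneg x⟩

theorem abs_kernel_mul_le {κ : ℕ → ℝ} (hκ : IsDecayingKernel κ) (e f : ℕ) :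
    |κ e * κ f| ≤ 4 * ((3 / 4) ^ e * (3 / 4) ^ f) := by
  rw [abs_mul]
  calc |κ e| * |κ f| ≤ (2 * (3 / 4) ^ e) * (2 * (3 / 4) ^ f) :=
        mul_le_mul (hκ.abs_le e) (hκ.abs_le f) (abs_nonneg _) (by positivity)
    _ = _ := by ring

/-- The sum over the full square is the square of a partial mass, hence exponentially close to `1`.
The missing corner `e + f ≥ x` has at most `x ^ 2` terms, each at most `4 (3/4) ^ x`; hence the
polynomial factor in `boundaryDecay`. -/
theorem abs_sum_kernel_triangle_sub_one_le {κ : ℕ → ℝ} (hκ : IsDecayingKernel κ) (x : ℕ) :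
    |(∑ e ∈ Finset.range x, ∑ f ∈ Finset.range x, if e + f < x then κ e * κ f else 0) - 1| ≤
      16 * boundaryDecay x := by
  rcases x with _ | x
  · simp [boundaryDecay]
  have hs := hκ.abs_sum_sub_one_le x
  set s := ∑ e ∈ Finset.range (x + 1), κ e with hsdef
  have hfull : s ^ 2 = (∑ e ∈ Finset.range (x + 1), ∑ f ∈ Finset.range (x + 1),
      if e + f < x + 1 then κ e * κ f else 0) +
      ∑ e ∈ Finset.range (x + 1), ∑ f ∈ Finset.range (x + 1),
        if e + f < x + 1 then 0 else κ e * κ f := by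
    rw [sq, hsdef, Finset.sum_mul_sum, ← Finset.sum_add_distrib]
    refine Finset.sum_congr rfl fun e _ => ?_
    rw [← Finset.sum_add_distrib]
    refine Finset.sum_congr rfl fun f _ => ?_
    split_ifs <;> simp
  have hout : |∑ e ∈ Finset.range (x + 1), ∑ f ∈ Finset.range (x + 1),
        if e + f < x + 1 then 0 else κ e * κ f| ≤ ((x : ℝ) + 1) ^ 2 * (4 * (3 / 4) ^ (x + 1)) := by
    calc _ ≤ ∑ e ∈ Finset.range (x + 1), ∑ f ∈ Finset.range (x + 1),
          |if e + f < x + 1 then 0 else κ e * κ f| :=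
          (Finset.abs_sum_le_sum_abs _ _).trans
            (Finset.sum_le_sum fun _ _ => Finset.abs_sum_le_sum_abs _ _)
      _ ≤ ∑ e ∈ Finset.range (x + 1), ∑ f ∈ Finset.range (x + 1), 4 * (3 / 4 : ℝ) ^ (x + 1) := by
          refine Finset.sum_le_sum fun e _ => Finset.sum_le_sum fun f _ => ?_
          split_ifs with h
          · rw [abs_zero]; positivity
          · refine (abs_kernel_mul_le hκ e f).trans ?_
            rw [← pow_add]
            exact mul_le_mul_of_nonneg_left (pow_le_pow_of_le_one (by norm_num) (by norm_num)
              (not_lt.mp h)) (by norm_num)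
      _ = _ := by
          simp only [Finset.sum_const, Finset.card_range, nsmul_eq_mul]
          push_cast
          ring
  have hs2 : |s ^ 2 - 1| ≤ 8 * (3 / 4) ^ x := by
    have h1 : (3 / 4 : ℝ) ^ x ≤ 1 := pow_le_one₀ (by norm_num) (by norm_num)
    have h2 : |s + 1| ≤ 4 := by
      have := abs_le.mp hs
      rw [abs_le]
      constructor <;> linarith
    rw [show s ^ 2 - 1 = (s - 1) * (s + 1) by ring, abs_mul]
    calc |s - 1| * |s + 1| ≤ (2 * (3 / 4) ^ x) * 4 :=
          mul_le_mul hs h2 (abs_nonneg _) (by positivity)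
      _ = _ := by ring
  have heq : (∑ e ∈ Finset.range (x + 1), ∑ f ∈ Finset.range (x + 1),
      if e + f < x + 1 then κ e * κ f else 0) - 1 = (s ^ 2 - 1) -
      ∑ e ∈ Finset.range (x + 1), ∑ f ∈ Finset.range (x + 1),
        if e + f < x + 1 then 0 else κ e * κ f := by
    rw [hfull]; ring
  rw [heq]
  refine (abs_sub _ _).trans ((add_le_add hs2 hout).trans ?_)
  rw [boundaryDecay]
  push_cast
  have h3 : (0 : ℝ) ≤ (3 / 4) ^ x := by positivity
  have hx0 : (0 : ℝ) ≤ x := Nat.cast_nonneg _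
  rw [pow_succ (3 / 4 : ℝ) x]
  nlinarith [mul_nonneg h3 hx0, mul_nonneg h3 (mul_nonneg hx0 hx0)]

theorem sum_sum_geometric_le (n : ℕ) : ∑ e ∈ Finset.range n, ∑ f ∈ Finset.range n,
    (3 / 4 : ℝ) ^ e * (3 / 4) ^ f ≤ 16 := by
  rw [← Finset.sum_mul_sum]
  have h := sum_geometric_le n
  have h0 : 0 ≤ ∑ e ∈ Finset.range n, (3 / 4 : ℝ) ^ e := Finset.sum_nonneg fun _ _ => by positivity
  nlinarith

theorem sum_sum_mul_geometric_le (n : ℕ) : ∑ e ∈ Finset.range n, ∑ f ∈ Finset.range n,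
    (((e : ℝ) + 1) + ((f : ℝ) + 1)) * ((3 / 4 : ℝ) ^ e * (3 / 4) ^ f) ≤ 128 := by
  have h1 : ∑ e ∈ Finset.range n, ∑ f ∈ Finset.range n,
      (((e : ℝ) + 1) + ((f : ℝ) + 1)) * ((3 / 4 : ℝ) ^ e * (3 / 4) ^ f) =
      (∑ e ∈ Finset.range n, ((e : ℝ) + 1) * (3 / 4 : ℝ) ^ e) *
        (∑ f ∈ Finset.range n, (3 / 4 : ℝ) ^ f) +
      (∑ e ∈ Finset.range n, (3 / 4 : ℝ) ^ e) *
        ∑ f ∈ Finset.range n, ((f : ℝ) + 1) * (3 / 4 : ℝ) ^ f := by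
    rw [Finset.sum_mul_sum, Finset.sum_mul_sum, ← Finset.sum_add_distrib]
    refine Finset.sum_congr rfl fun e _ => ?_
    rw [← Finset.sum_add_distrib]
    exact Finset.sum_congr rfl fun f _ => by ring
  rw [h1]
  have h2 := sum_geometric_le n
  have h3 := sum_succ_mul_geometric_le n
  have h4 : 0 ≤ ∑ e ∈ Finset.range n, (3 / 4 : ℝ) ^ e := Finset.sum_nonneg fun _ _ => by positivity
  have h5 : 0 ≤ ∑ e ∈ Finset.range n, ((e : ℝ) + 1) * (3 / 4 : ℝ) ^ e :=
    Finset.sum_nonneg fun _ _ => by positivity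
  nlinarith

theorem pow_mul_pow_le {k : ℕ} {d y z : ℝ} (hy : 0 ≤ y) (hyd : y ≤ d) (hz : 0 ≤ z)
    (hzd : z ≤ d) : y ^ k * z ^ k ≤ d ^ (2 * k) := by
  rw [two_mul, pow_add]
  exact mul_le_mul (pow_le_pow_left₀ hy hyd _) (pow_le_pow_left₀ hz hzd _) (by positivity)
    (pow_nonneg (hy.trans hyd) _)

/-- The kernel is absolutely summable, so reflection costs only a constant: `65 = 1 + 4 * 16`, one
for the direct term and the rest for the reflected one. -/
theorem abs_weight_le {κ : ℕ → ℝ} (hκ : IsDecayingKernel κ) (k : ℕ) {D a b : ℕ}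
    (hab : a + b ≤ D) :
    |weight κ (fun n => (n : ℝ) ^ k) D a b| ≤ 65 * ((D : ℝ) + 1) ^ (2 * k) := by
  have hle : ∀ n : ℕ, n ≤ D → (n : ℝ) ≤ (D : ℝ) + 1 := fun n hn => by
    have : (n : ℝ) ≤ D := by exact_mod_cast hn
    linarith
  have hd : (0 : ℝ) ≤ ((D : ℝ) + 1) ^ (2 * k) := by positivity
  have h1 : |((a : ℝ) ^ k * (b : ℝ) ^ k)| ≤ ((D : ℝ) + 1) ^ (2 * k) := by
    rw [abs_of_nonneg (by positivity)]
    exact pow_mul_pow_le (Nat.cast_nonneg _) (hle a (by omega)) (Nat.cast_nonneg _)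
      (hle b (by omega))
  have h2 : |reflectedWeight κ (fun n => (n : ℝ) ^ k) D a b| ≤
      64 * ((D : ℝ) + 1) ^ (2 * k) := by
    rw [reflectedWeight_eq_sum_shift]
    set X := D - a - b
    calc _ ≤ ∑ e ∈ Finset.range X, ∑ f ∈ Finset.range X, |if e + f < X then
          κ e * κ f * (((D - (a + e) : ℕ) : ℝ) ^ k * ((D - (b + f) : ℕ) : ℝ) ^ k) else 0| :=
          (Finset.abs_sum_le_sum_abs _ _).trans
            (Finset.sum_le_sum fun _ _ => Finset.abs_sum_le_sum_abs _ _)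
      _ ≤ ∑ e ∈ Finset.range X, ∑ f ∈ Finset.range X,
          4 * ((D : ℝ) + 1) ^ (2 * k) * ((3 / 4) ^ e * (3 / 4) ^ f) := by
          refine Finset.sum_le_sum fun e _ => Finset.sum_le_sum fun f _ => ?_
          split_ifs
          · rw [abs_mul, abs_of_nonneg (by positivity :
              (0 : ℝ) ≤ ((D - (a + e) : ℕ) : ℝ) ^ k * ((D - (b + f) : ℕ) : ℝ) ^ k)]
            calc _ ≤ 4 * ((3 / 4) ^ e * (3 / 4) ^ f) * ((D : ℝ) + 1) ^ (2 * k) :=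
                  mul_le_mul (abs_kernel_mul_le hκ e f)
                    (pow_mul_pow_le (Nat.cast_nonneg _) (hle _ (by omega)) (Nat.cast_nonneg _)
                      (hle _ (by omega))) (by positivity) (by positivity)
              _ = _ := by ring
          · rw [abs_zero]; positivity
      _ = 4 * ((D : ℝ) + 1) ^ (2 * k) * ∑ e ∈ Finset.range X, ∑ f ∈ Finset.range X,
            (3 / 4 : ℝ) ^ e * (3 / 4) ^ f := by
          simp only [Finset.mul_sum]
      _ ≤ 4 * ((D : ℝ) + 1) ^ (2 * k) * 16 :=
          mul_le_mul_of_nonneg_left (sum_sum_geometric_le X) (by positivity)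
      _ = _ := by ring
  rw [weight]
  refine (abs_add_le _ _).trans ?_
  linarith

/-- The limiting shape of `weight`. -/
noncomputable def limitWeight (k : ℕ) (d : ℝ) (a b : ℕ) : ℝ :=
  (a : ℝ) ^ k * (b : ℝ) ^ k + (d - a) ^ k * (d - b) ^ k

/-- The kernel concentrates near `e = f = 0`. Freezing the polynomial factor at its limiting value
costs a relative error of order `(e + f + 2) / d` per term, which is summable against the kernel;
the remaining kernel sum is `1` up to `boundaryDecay`. -/
theorem abs_weight_sub_limitWeight_le {κ : ℕ → ℝ} (hκ : IsDecayingKernel κ) (k : ℕ) {D a b : ℕ}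
    (hab : a + b ≤ D) :
    |weight κ (fun n => (n : ℝ) ^ k) D a b - limitWeight k ((D : ℝ) + 1) a b| ≤
      ((D : ℝ) + 1) ^ (2 * k) *
        (512 * k / ((D : ℝ) + 1) + 16 * boundaryDecay (D - a - b)) := by
  set d : ℝ := (D : ℝ) + 1 with hd
  have hd0 : 0 < d := by positivity
  set X := D - a - b with hX
  set P₀ : ℝ := (d - a) ^ k * (d - b) ^ k with hP0
  have haD : (a : ℝ) ≤ D := by exact_mod_cast (by omega : a ≤ D)
  have hbD : (b : ℝ) ≤ D := by exact_mod_cast (by omega : b ≤ D)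
  have ha0 : (0 : ℝ) ≤ a := Nat.cast_nonneg _
  have hb0 : (0 : ℝ) ≤ b := Nat.cast_nonneg _
  have hP0n : 0 ≤ P₀ := mul_nonneg (pow_nonneg (by linarith) _) (pow_nonneg (by linarith) _)
  have hP0le : P₀ ≤ d ^ (2 * k) :=
    pow_mul_pow_le (by linarith) (by linarith) (by linarith) (by linarith)
  have hdecomp : weight κ (fun n => (n : ℝ) ^ k) D a b - limitWeight k d a b =
      (∑ e ∈ Finset.range X, ∑ f ∈ Finset.range X, if e + f < X then κ e * κ f *
        (((D - (a + e) : ℕ) : ℝ) ^ k * ((D - (b + f) : ℕ) : ℝ) ^ k - P₀) else 0) +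
      P₀ * ((∑ e ∈ Finset.range X, ∑ f ∈ Finset.range X,
        if e + f < X then κ e * κ f else 0) - 1) := by
    rw [weight, limitWeight, reflectedWeight_eq_sum_shift, mul_sub, Finset.mul_sum, ← add_sub_assoc,
      ← Finset.sum_add_distrib]
    simp only [Finset.mul_sum]
    have : ∀ e ∈ Finset.range X, (∑ f ∈ Finset.range X, if e + f < X then κ e * κ f *
        (((D - (a + e) : ℕ) : ℝ) ^ k * ((D - (b + f) : ℕ) : ℝ) ^ k - P₀) else 0) +
        ∑ f ∈ Finset.range X, P₀ * (if e + f < X then κ e * κ f else 0) =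
        ∑ f ∈ Finset.range X, if e + f < X then κ e * κ f *
        (((D - (a + e) : ℕ) : ℝ) ^ k * ((D - (b + f) : ℕ) : ℝ) ^ k) else 0 := by
      intro e _
      rw [← Finset.sum_add_distrib]
      refine Finset.sum_congr rfl fun f _ => ?_
      split_ifs
      · ring
      · ring
    rw [Finset.sum_congr rfl this]
    ring
  have h1 : |∑ e ∈ Finset.range X, ∑ f ∈ Finset.range X, if e + f < X then κ e * κ f *
        (((D - (a + e) : ℕ) : ℝ) ^ k * ((D - (b + f) : ℕ) : ℝ) ^ k - P₀) else 0| ≤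
      d ^ (2 * k) * (512 * k / d) := by
    calc _ ≤ ∑ e ∈ Finset.range X, ∑ f ∈ Finset.range X, |if e + f < X then κ e * κ f *
        (((D - (a + e) : ℕ) : ℝ) ^ k * ((D - (b + f) : ℕ) : ℝ) ^ k - P₀) else 0| :=
          (Finset.abs_sum_le_sum_abs _ _).trans
            (Finset.sum_le_sum fun _ _ => Finset.abs_sum_le_sum_abs _ _)
      _ ≤ ∑ e ∈ Finset.range X, ∑ f ∈ Finset.range X, (4 * (d ^ (2 * k) * (k / d))) *
          ((((e : ℝ) + 1) + ((f : ℝ) + 1)) * ((3 / 4) ^ e * (3 / 4) ^ f)) := by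
          refine Finset.sum_le_sum fun e _ => Finset.sum_le_sum fun f _ => ?_
          split_ifs with hef
          · have hcast1 : ((D - (a + e) : ℕ) : ℝ) = D - (a + e) := by
              rw [Nat.cast_sub (by omega)]; push_cast; ring
            have hcast2 : ((D - (b + f) : ℕ) : ℝ) = D - (b + f) := by
              rw [Nat.cast_sub (by omega)]; push_cast; ring
            have hae : (a : ℝ) + e ≤ D := by exact_mod_cast (by omega : a + e ≤ D)
            have hbf : (b : ℝ) + f ≤ D := by exact_mod_cast (by omega : b + f ≤ D)
            have he0 : (0 : ℝ) ≤ e := Nat.cast_nonneg _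
            have hf0 : (0 : ℝ) ≤ f := Nat.cast_nonneg _
            have hscale : ∀ y z : ℝ, y ^ k * z ^ k = d ^ (2 * k) * ((y / d) ^ k * (z / d) ^ k) := by
              intro y z
              rw [div_pow, div_pow, two_mul, pow_add]
              field_simp
            have hdiff : |((D - (a + e) : ℕ) : ℝ) ^ k * ((D - (b + f) : ℕ) : ℝ) ^ k - P₀| ≤
                d ^ (2 * k) * (k / d) * (((e : ℝ) + 1) + ((f : ℝ) + 1)) := by
              rw [hcast1, hcast2, hP0, hscale, hscale (d - a), ← mul_sub, abs_mul,
                abs_of_pos (by positivity : (0 : ℝ) < d ^ (2 * k)), mul_assoc]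
              refine mul_le_mul_of_nonneg_left ?_ (by positivity)
              have hlem := abs_pow_mul_pow_sub_le k (y := (D - (a + e)) / d)
                (z := (D - (b + f)) / d) (y' := (d - a) / d) (z' := (d - b) / d)
                (div_nonneg (by linarith) hd0.le) ((div_le_one hd0).mpr (by linarith))
                (div_nonneg (by linarith) hd0.le) ((div_le_one hd0).mpr (by linarith))
                (div_nonneg (by linarith) hd0.le) ((div_le_one hd0).mpr (by linarith))
                (div_nonneg (by linarith) hd0.le) ((div_le_one hd0).mpr (by linarith))
              refine hlem.trans (le_of_eq ?_)
              rw [← sub_div, ← sub_div, abs_div, abs_div, abs_of_pos hd0,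
                show (D : ℝ) - (a + e) - (d - a) = -(e + 1) by rw [hd]; ring,
                show (D : ℝ) - (b + f) - (d - b) = -(f + 1) by rw [hd]; ring, abs_neg, abs_neg,
                abs_of_nonneg (by linarith), abs_of_nonneg (by linarith)]
              field_simp
            rw [abs_mul]
            calc _ ≤ (4 * ((3 / 4) ^ e * (3 / 4) ^ f)) *
                  (d ^ (2 * k) * (k / d) * (((e : ℝ) + 1) + ((f : ℝ) + 1))) :=
                  mul_le_mul (abs_kernel_mul_le hκ e f) hdiff (abs_nonneg _) (by positivity)
              _ = _ := by ring
          · rw [abs_zero]; positivity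
      _ = (4 * (d ^ (2 * k) * (k / d))) * ∑ e ∈ Finset.range X, ∑ f ∈ Finset.range X,
            (((e : ℝ) + 1) + ((f : ℝ) + 1)) * ((3 / 4 : ℝ) ^ e * (3 / 4) ^ f) := by
          simp only [Finset.mul_sum]
      _ ≤ (4 * (d ^ (2 * k) * (k / d))) * 128 :=
          mul_le_mul_of_nonneg_left (sum_sum_mul_geometric_le X) (by positivity)
      _ = _ := by ring
  have h2 : |P₀ * ((∑ e ∈ Finset.range X, ∑ f ∈ Finset.range X,
        if e + f < X then κ e * κ f else 0) - 1)| ≤ d ^ (2 * k) * (16 * boundaryDecay X) := by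
    rw [abs_mul, abs_of_nonneg hP0n]
    exact mul_le_mul hP0le (abs_sum_kernel_triangle_sub_one_le hκ X) (abs_nonneg _) (by positivity)
  rw [hdecomp, mul_add]
  exact (abs_add_le _ _).trans (add_le_add h1 h2)

theorem abs_limitWeight_le (k : ℕ) {D a b : ℕ} (hab : a + b ≤ D) :
    |limitWeight k ((D : ℝ) + 1) a b| ≤ 2 * ((D : ℝ) + 1) ^ (2 * k) := by
  have haD : (a : ℝ) ≤ D := by exact_mod_cast (by omega : a ≤ D)
  have hbD : (b : ℝ) ≤ D := by exact_mod_cast (by omega : b ≤ D)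
  have ha0 : (0 : ℝ) ≤ a := Nat.cast_nonneg _
  have hb0 : (0 : ℝ) ≤ b := Nat.cast_nonneg _
  rw [limitWeight, abs_of_nonneg (add_nonneg (by positivity)
    (mul_nonneg (pow_nonneg (by linarith) _) (pow_nonneg (by linarith) _))), two_mul]
  exact add_le_add (pow_mul_pow_le ha0 (by linarith) hb0 (by linarith))
    (pow_mul_pow_le (by linarith) (by linarith) (by linarith) (by linarith))

/-! ### The off-diagonal and the trivial character -/

/-- The contribution of the quadruples with `A C ≡ c B D`, `A C ≠ c B D` to the moments. -/
noncomputable def momentOff [Finite F] (Q : F[X]) (c : F) (i j u v : ℕ) : ℝ :=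
  (Real.sqrt (Nat.card F) ^ (i + j + u + v))⁻¹ * offCount Q c i j u v

theorem momentOff_nonneg [Finite F] (Q : F[X]) (c : F) (i j u v : ℕ) :
    0 ≤ momentOff Q c i j u v := by
  rw [momentOff]; positivity

theorem momentDiag_nonneg [Finite F] (i j u v : ℕ) : 0 ≤ momentDiag F i j u v := by
  rw [momentDiag]; positivity

theorem momentAll_eq [Finite F] (Q : F[X]) (i j u v : ℕ) :
    momentAll Q i j u v = momentDiag F i j u v + momentOff Q 1 i j u v := by
  rw [momentAll, momentDiag, momentOff, congrCount_one]
  push_cast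
  ring

theorem momentEven_eq [Finite F] [Fintype Fˣ] (Q : F[X]) (i j u v : ℕ) :
    momentEven Q i j u v = momentDiag F i j u v / (Nat.card F - 1) +
      (∑ c : Fˣ, momentOff Q (c : F) i j u v) / (Nat.card F - 1) := by
  classical
  have h : ∑ c : Fˣ, (congrCount Q (c : F) i j u v : ℝ) =
      diagCount F i j u v + ∑ c : Fˣ, (offCount Q (c : F) i j u v : ℝ) := by
    rw [← Finset.add_sum_erase _ _ (Finset.mem_univ (1 : Fˣ)),
      ← Finset.add_sum_erase _ (fun c : Fˣ => (offCount Q (c : F) i j u v : ℝ))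
        (Finset.mem_univ (1 : Fˣ)), ← add_assoc, Units.val_one, congrCount_one, Nat.cast_add]
    congr 1
    refine Finset.sum_congr rfl fun c hc => ?_
    rw [congrCount_of_ne_one Q (fun h => Finset.ne_of_mem_erase hc (Units.ext h))]
  rw [momentEven, h]
  simp only [momentDiag, momentOff]
  rw [← Finset.mul_sum]
  ring

/-! ### Uniform upper bounds for the moments -/

theorem totient_eq [Finite F] {Q : F[X]} (hQ : Q.Monic) (hi : Irreducible Q) :
    (totient Q : ℝ) = (Nat.card F : ℝ) ^ Q.natDegree - 1 := by
  have := isMaximal_span hi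
  let := Ideal.Quotient.field (Ideal.span {Q})
  have h2 := two_le_card (F := F)
  rw [totient, Nat.card_units, card_quotient hQ, Nat.cast_sub (Nat.one_le_pow _ _ (by omega))]
  push_cast
  rfl

theorem totient_pos [Finite F] {Q : F[X]} (hQ : Q.Monic) (hi : Irreducible Q) :
    (0 : ℝ) < totient Q := by
  have h2 : (1 : ℝ) < Nat.card F := by exact_mod_cast two_le_card (F := F)
  rw [totient_eq hQ hi, sub_pos]
  exact one_lt_pow₀ h2 hi.natDegree_pos.ne'

/-- By Cauchy-Schwarz, in the form `2 X Y ≤ X ^ 2 + Y ^ 2`, it suffices to bound the sum of `|ℓ_a| ^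
2 |ℓ_b| ^ 2` over all `χ` for `a + b ≤ D`. Both sides of the resulting congruence have degree `a + b
< deg Q`, so only the diagonal contributes, and `momentDiag_le` applies. -/
theorem norm_sum_normCoeff_product_le [Finite F] {Q : F[X]} (hQ : Q.Monic) (hi : Irreducible Q)
    [Fintype (DirichletChar Q)] {D : ℕ} (hD : Q.natDegree = D + 1) (s : Finset (DirichletChar Q))
    {x y : ℕ × ℕ} (hx : x ∈ triangle D) (hy : y ∈ triangle D) :
    ‖∑ χ ∈ s, (normCoeff χ x.1 * starRingEnd ℂ (normCoeff χ x.2)) *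
      (normCoeff χ y.1 * starRingEnd ℂ (normCoeff χ y.2))‖ ≤ totient Q * ((D : ℝ) + 1) := by
  have hsq : ∀ x ∈ triangle D, ∑ χ : DirichletChar Q, (‖normCoeff χ x.1‖ * ‖normCoeff χ x.2‖) ^ 2 ≤
      totient Q * ((D : ℝ) + 1) := by
    intro x hx
    have hx' := mem_triangle.mp hx
    have h1 := sum_normCoeff_product hQ hi (i := x.1) (j := x.2) (u := x.2) (v := x.1)
      (by omega) (by omega)
    have h2 : ∑ χ : DirichletChar Q, (normCoeff χ x.1 * starRingEnd ℂ (normCoeff χ x.2)) *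
        (normCoeff χ x.2 * starRingEnd ℂ (normCoeff χ x.1)) =
        ((∑ χ : DirichletChar Q, (‖normCoeff χ x.1‖ * ‖normCoeff χ x.2‖) ^ 2 : ℝ) : ℂ) := by
      rw [Complex.ofReal_sum]
      refine Finset.sum_congr rfl fun χ _ => ?_
      have ha := Complex.mul_conj' (normCoeff χ x.1)
      have hb := Complex.mul_conj' (normCoeff χ x.2)
      push_cast
      rw [mul_pow, ← ha, ← hb]
      ring
    rw [h2, ← Complex.ofReal_natCast, ← Complex.ofReal_mul, Complex.ofReal_inj] at h1
    rw [h1]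
    refine mul_le_mul_of_nonneg_left ?_ (Nat.cast_nonneg _)
    have h3 := momentAll_eq Q x.1 x.2 x.2 x.1
    rw [momentOff, offCount_eq_zero (by omega) (by omega), momentAll] at h3
    rw [h3]
    have h4 := momentDiag_le (F := F) hx (y := (x.2, x.1)) (mem_triangle.mpr (by simp; omega))
    simpa using h4
  calc ‖∑ χ ∈ s, (normCoeff χ x.1 * starRingEnd ℂ (normCoeff χ x.2)) *
        (normCoeff χ y.1 * starRingEnd ℂ (normCoeff χ y.2))‖
      ≤ ∑ χ ∈ s, (‖normCoeff χ x.1‖ * ‖normCoeff χ x.2‖) *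
          (‖normCoeff χ y.1‖ * ‖normCoeff χ y.2‖) := by
        refine (norm_sum_le _ _).trans (Finset.sum_le_sum fun χ _ => ?_)
        simp only [norm_mul, RCLike.norm_conj, le_refl]
    _ ≤ ∑ χ : DirichletChar Q, (‖normCoeff χ x.1‖ * ‖normCoeff χ x.2‖) *
          (‖normCoeff χ y.1‖ * ‖normCoeff χ y.2‖) :=
        Finset.sum_le_univ_sum_of_nonneg fun χ => by positivity
    _ ≤ ∑ χ : DirichletChar Q, ((‖normCoeff χ x.1‖ * ‖normCoeff χ x.2‖) ^ 2 / 2 +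
          (‖normCoeff χ y.1‖ * ‖normCoeff χ y.2‖) ^ 2 / 2) :=
        Finset.sum_le_sum fun χ _ => by
          nlinarith [sq_nonneg (‖normCoeff χ x.1‖ * ‖normCoeff χ x.2‖ -
            ‖normCoeff χ y.1‖ * ‖normCoeff χ y.2‖)]
    _ ≤ _ := by
        rw [Finset.sum_add_distrib, ← Finset.sum_div, ← Finset.sum_div]
        linarith [hsq x hx, hsq y hy]

theorem momentAll_le [Finite F] {Q : F[X]} (hQ : Q.Monic) (hi : Irreducible Q) {D : ℕ}
    (hD : Q.natDegree = D + 1) {x y : ℕ × ℕ} (hx : x ∈ triangle D) (hy : y ∈ triangle D) :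
    momentAll Q x.1 x.2 y.1 y.2 ≤ (D : ℝ) + 1 := by
  have := finite_dirichletChar hQ
  have := Fintype.ofFinite (DirichletChar Q)
  have hx' := mem_triangle.mp hx
  have hy' := mem_triangle.mp hy
  have h := norm_sum_normCoeff_product_le hQ hi hD Finset.univ hx hy
  rw [sum_normCoeff_product hQ hi (by omega) (by omega), ← Complex.ofReal_natCast,
    ← Complex.ofReal_mul, Complex.norm_real] at h
  exact le_of_mul_le_mul_left ((le_abs_self _).trans h) (totient_pos hQ hi)

theorem momentEven_le [Finite F] [Fintype Fˣ] {Q : F[X]} (hQ : Q.Monic) (hi : Irreducible Q)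
    {D : ℕ} (hD : Q.natDegree = D + 1) {x y : ℕ × ℕ} (hx : x ∈ triangle D) (hy : y ∈ triangle D) :
    momentEven Q x.1 x.2 y.1 y.2 ≤ (D : ℝ) + 1 := by
  classical
  have := finite_dirichletChar hQ
  have := Fintype.ofFinite (DirichletChar Q)
  have hx' := mem_triangle.mp hx
  have hy' := mem_triangle.mp hy
  have h := norm_sum_normCoeff_product_le hQ hi hD (Finset.univ.filter IsEven) hx hy
  rw [sum_even_normCoeff_product hQ hi (by omega) (by omega), ← Complex.ofReal_natCast,
    ← Complex.ofReal_mul, Complex.norm_real] at h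
  exact le_of_mul_le_mul_left ((le_abs_self _).trans h) (totient_pos hQ hi)

/-- A bound for the off-diagonal terms with `s = 2 deg Q - (i + j + u + v)`. -/
noncomputable def offBound (A : ℝ) (b D s : ℕ) : ℝ :=
  min ((D : ℝ) + 1) (A * ((D : ℝ) + 1) ^ b * (((2 : ℝ) ^ (1 / 4 : ℝ)) ^ s)⁻¹)

/-- The diagonal and off-diagonal parts are non-negative, so the bound for the whole moment holds
for the off-diagonal part; the other bound is `offCount_div_le`. In the even case the `q - 1`
constants cancel the denominator. -/
theorem momentOff_le_offBound : ∃ (A : ℝ) (b : ℕ), 0 ≤ A ∧ ∀ (F : Type*) [Field F] [Finite F]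
    [Fintype Fˣ] (Q : F[X]) (_ : Q.Monic) (_ : Irreducible Q) (D : ℕ) (_ : Q.natDegree = D + 1),
    ∀ x ∈ triangle D, ∀ y ∈ triangle D,
      momentOff Q 1 x.1 x.2 y.1 y.2 ≤ offBound A b D (2 * (D + 1) - (x.1 + x.2 + y.1 + y.2)) ∧
      (∑ c : Fˣ, momentOff Q (c : F) x.1 x.2 y.1 y.2) / (Nat.card F - 1) ≤
        offBound A b D (2 * (D + 1) - (x.1 + x.2 + y.1 + y.2)) := by
  obtain ⟨A, b, hA, h⟩ := offCount_div_le
  refine ⟨A, b, hA, fun F _ _ _ Q hQ hi D hD x hx y hy => ?_⟩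
  have hq : (0 : ℝ) < (Nat.card F : ℝ) - 1 := by
    rw [sub_pos]
    exact_mod_cast two_le_card (F := F)
  have hq2 := two_le_card (F := F)
  refine ⟨le_min ?_ (h F Q hQ hi D hD 1 one_ne_zero x hx y hy), le_min ?_ ?_⟩
  · have h1 := momentAll_le hQ hi hD hx hy
    have h2 := momentDiag_nonneg (F := F) x.1 x.2 y.1 y.2
    rw [momentAll_eq] at h1
    linarith
  · have h1 := momentEven_le hQ hi hD hx hy
    have h2 := div_nonneg (momentDiag_nonneg (F := F) x.1 x.2 y.1 y.2) hq.le
    rw [momentEven_eq] at h1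
    linarith
  · rw [div_le_iff₀ hq]
    refine (Finset.sum_le_sum fun (c : Fˣ) _ =>
      h F Q hQ hi D hD (c : F) c.ne_zero x hx y hy).trans ?_
    rw [Finset.sum_const, Finset.card_univ, ← Nat.card_eq_fintype_card, Nat.card_units,
      nsmul_eq_mul, Nat.cast_sub (by omega), Nat.cast_one, mul_comm]

/-! ### Summation of the off-diagonal bounds -/

theorem card_triangle_filter_le (D H : ℕ) :
    ((triangle D).filter fun x => D + 1 ≤ H + (x.1 + x.2)).card ≤ (D + 1) * H := by
  rw [← Finset.card_range (D + 1), ← Finset.card_range H, ← Finset.card_product,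
    Finset.card_range, Finset.card_range]
  refine Finset.card_le_card_of_injOn (fun x => (x.1, D - (x.1 + x.2))) (fun x hx => ?_)
    (fun x hx y hy h => ?_)
  · rw [Finset.mem_coe, Finset.mem_filter, mem_triangle] at hx
    simp only [Finset.coe_product, Finset.coe_range, Set.mem_prod, Set.mem_Iio]
    omega
  · rw [Finset.mem_coe, Finset.mem_filter, mem_triangle] at hx hy
    simp only [Prod.mk.injEq] at h
    ext <;> omega

theorem card_triangle_le (D : ℕ) : (triangle D).card ≤ (D + 1) * (D + 1) := by
  refine le_trans (Finset.card_le_card fun x hx => ?_) (card_triangle_filter_le D (D + 1))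
  rw [Finset.mem_filter]
  exact ⟨hx, by omega⟩

theorem exists_pow_mul_inv_pow_le {θ : ℝ} (hθ : 1 < θ) (n : ℕ) :
    ∃ M : ℝ, 0 ≤ M ∧ ∀ t : ℕ, (t : ℝ) ^ n * (θ ^ t)⁻¹ ≤ M := by
  obtain ⟨M, hM⟩ := (tendsto_pow_const_div_const_pow_of_one_lt n hθ).bddAbove_range
  refine ⟨M, ?_, fun t => ?_⟩
  · refine le_trans ?_ (hM ⟨1, rfl⟩)
    positivity
  · exact hM ⟨t, rfl⟩

/-- Let `H` be about `d ^ (1/4)`. If both pairs lie within `H` of the edge, the bound `d` is used: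
there are at most `(d H) ^ 2` such pairs of pairs, giving `d ^ 3 H ^ 2 ≤ d ^ (7/2)`, the exponent of
the theorem. Otherwise the total degree falls short by at least `H`, and the exponential saving
outweighs every power of `d`. -/
theorem sum_offBound_le {A : ℝ} (hA : 0 ≤ A) (b : ℕ) : ∃ K : ℝ, 0 ≤ K ∧ ∀ D : ℕ,
    ∑ x ∈ triangle D, ∑ y ∈ triangle D,
      offBound A b D (2 * (D + 1) - (x.1 + x.2 + y.1 + y.2)) ≤
      K * ((D : ℝ) + 1) ^ (7 / 2 : ℝ) := by
  set θ : ℝ := (2 : ℝ) ^ (1 / 4 : ℝ) with hθ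
  have hθ1 : 1 < θ := Real.one_lt_rpow (by norm_num) (by norm_num)
  -- The loss is `d ^ b` from the bound times `d ^ 4` from the number of terms, and `d ≤ (H + 1) ^
  -- 4`.
  obtain ⟨M, hM0, hM⟩ := exists_pow_mul_inv_pow_le hθ1 (4 * (b + 4))
  refine ⟨1 + A * (θ * M), by positivity, fun D => ?_⟩
  set d : ℝ := (D : ℝ) + 1 with hd
  have hd1 : 1 ≤ d := by
    rw [hd]
    have : (0 : ℝ) ≤ D := Nat.cast_nonneg _
    linarith
  set H : ℕ := ⌊d ^ (1 / 4 : ℝ)⌋₊ with hH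
  have hH1 : (H : ℝ) ≤ d ^ (1 / 4 : ℝ) := Nat.floor_le (by positivity)
  have hH2 : d ≤ ((H + 1 : ℕ) : ℝ) ^ 4 := by
    have h1 : d ^ (1 / 4 : ℝ) ≤ ((H + 1 : ℕ) : ℝ) := by
      push_cast
      exact (Nat.lt_floor_add_one _).le
    calc d = (d ^ (1 / 4 : ℝ)) ^ 4 := by
          rw [← Real.rpow_natCast, ← Real.rpow_mul (by linarith)]
          norm_num
      _ ≤ _ := pow_le_pow_left₀ (by positivity) h1 4
  have hpt : ∀ x ∈ triangle D, ∀ y ∈ triangle D,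
      offBound A b D (2 * (D + 1) - (x.1 + x.2 + y.1 + y.2)) ≤
      d * ((if D + 1 ≤ H + (x.1 + x.2) then 1 else 0) *
        (if D + 1 ≤ H + (y.1 + y.2) then 1 else 0)) + A * d ^ b * (θ ^ H)⁻¹ := by
    intro x hx y hy
    rw [mem_triangle] at hx hy
    by_cases h : D + 1 ≤ H + (x.1 + x.2) ∧ D + 1 ≤ H + (y.1 + y.2)
    · rw [if_pos h.1, if_pos h.2, mul_one, mul_one]
      refine (min_le_left _ _).trans (le_add_of_nonneg_right (by positivity))
    · refine (min_le_right _ _).trans (le_trans ?_ (le_add_of_nonneg_left (by positivity)))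
      refine mul_le_mul_of_nonneg_left ?_ (by positivity)
      exact inv_anti₀ (by positivity) (pow_le_pow_right₀ hθ1.le (by omega))
  refine (Finset.sum_le_sum fun x hx => Finset.sum_le_sum fun y hy => hpt x hx y hy).trans ?_
  clear_value d H θ
  simp only [Finset.sum_add_distrib, ← Finset.mul_sum, ← Finset.sum_mul, Finset.sum_boole,
    Finset.sum_const, nsmul_eq_mul]
  have hc1 : (((triangle D).filter fun x => D + 1 ≤ H + (x.1 + x.2)).card : ℝ) ≤ d * H := by
    rw [hd]
    exact_mod_cast card_triangle_filter_le D H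
  have hc2 : ((triangle D).card : ℝ) ≤ d * d := by
    rw [hd]
    exact_mod_cast card_triangle_le D
  have h72 : d ^ 3 * (d ^ (1 / 4 : ℝ)) ^ 2 = d ^ (7 / 2 : ℝ) := by
    rw [← Real.rpow_natCast, ← Real.rpow_natCast, ← Real.rpow_mul (by linarith),
      ← Real.rpow_add (by linarith)]
    norm_num
  have h1le : (1 : ℝ) ≤ d ^ (7 / 2 : ℝ) := Real.one_le_rpow hd1 (by norm_num)
  rw [add_mul, one_mul]
  refine add_le_add ?_ ?_
  · calc d * ((((triangle D).filter fun x => D + 1 ≤ H + (x.1 + x.2)).card : ℝ) *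
          (((triangle D).filter fun x => D + 1 ≤ H + (x.1 + x.2)).card : ℝ))
        ≤ d * ((d * H) * (d * H)) := by gcongr
      _ = d ^ 3 * (H : ℝ) ^ 2 := by ring
      _ ≤ d ^ 3 * (d ^ (1 / 4 : ℝ)) ^ 2 := by gcongr
      _ = _ := h72
  · calc A * d ^ b * (((triangle D).card : ℝ) * (((triangle D).card : ℝ) * (θ ^ H)⁻¹))
        ≤ A * d ^ b * ((d * d) * ((d * d) * (θ ^ H)⁻¹)) := by gcongr
      _ = A * (θ * (d ^ (b + 4) * (θ ^ (H + 1))⁻¹)) := by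
          rw [pow_succ θ, pow_add]
          field_simp
      _ ≤ A * (θ * ((((H + 1 : ℕ) : ℝ) ^ 4) ^ (b + 4) * (θ ^ (H + 1))⁻¹)) := by gcongr
      _ ≤ A * (θ * M) := by
          rw [← pow_mul]
          gcongr
          exact hM _
      _ ≤ A * (θ * M) * d ^ (7 / 2 : ℝ) := le_mul_of_one_le_right (by positivity) h1le

/-! ### The trivial character -/

theorem sum_triangle_pow_le {s : ℝ} (hs : 4 / 3 ≤ s) (D : ℕ) :
    ∑ x ∈ triangle D, s ^ (x.1 + x.2) ≤ 3 * ((D : ℝ) + 1) * s ^ (D + 1) := by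
  have hgeo : ∀ m : ℕ, ∑ n ∈ Finset.range m, s ^ n ≤ 3 * s ^ m := by
    intro m
    induction m with
    | zero => simp
    | succ m ih =>
      rw [Finset.sum_range_succ, pow_succ]
      have : 0 < s ^ m := by positivity
      nlinarith
  calc ∑ x ∈ triangle D, s ^ (x.1 + x.2)
      = ∑ z ∈ (triangle D).image fun x => (x.1, x.1 + x.2), s ^ z.2 := by
        rw [Finset.sum_image]
        intro x _ y _ h
        simp only [Prod.mk.injEq] at h
        ext <;> omega
    _ ≤ ∑ z ∈ Finset.range (D + 1) ×ˢ Finset.range (D + 1), s ^ z.2 := by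
        refine Finset.sum_le_sum_of_subset_of_nonneg (fun z hz => ?_) fun _ _ _ => by positivity
        obtain ⟨x, hx, rfl⟩ := Finset.mem_image.mp hz
        rw [mem_triangle] at hx
        simp only [Finset.mem_product, Finset.mem_range]
        omega
    _ = ((D : ℝ) + 1) * ∑ n ∈ Finset.range (D + 1), s ^ n := by
        rw [Finset.sum_product]
        simp
    _ ≤ _ := by
        have := mul_le_mul_of_nonneg_left (hgeo (D + 1)) (by positivity : (0 : ℝ) ≤ (D : ℝ) + 1)
        linarith

theorem abs_sum_weight_mul_pow_le {κ : ℕ → ℝ} (hκ : IsDecayingKernel κ) (k D : ℕ) {s : ℝ}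
    (hs : 4 / 3 ≤ s) :
    |∑ x ∈ triangle D, weight κ (fun n => (n : ℝ) ^ k) D x.1 x.2 * s ^ (x.1 + x.2)| ≤
      195 * ((D : ℝ) + 1) ^ (2 * k + 1) * s ^ (D + 1) := by
  calc |∑ x ∈ triangle D, weight κ (fun n => (n : ℝ) ^ k) D x.1 x.2 * s ^ (x.1 + x.2)|
      ≤ ∑ x ∈ triangle D, 65 * ((D : ℝ) + 1) ^ (2 * k) * s ^ (x.1 + x.2) := by
        refine (Finset.abs_sum_le_sum_abs _ _).trans (Finset.sum_le_sum fun x hx => ?_)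
        have hp : 0 ≤ s ^ (x.1 + x.2) := by positivity
        rw [abs_mul, abs_of_nonneg hp]
        exact mul_le_mul_of_nonneg_right (abs_weight_le hκ k (mem_triangle.mp hx)) hp
    _ ≤ 65 * ((D : ℝ) + 1) ^ (2 * k) * (3 * ((D : ℝ) + 1) * s ^ (D + 1)) := by
        rw [← Finset.mul_sum]
        exact mul_le_mul_of_nonneg_left (sum_triangle_pow_le hs D) (by positivity)
    _ = _ := by ring

/-- The trivial character contributes little. -/
theorem abs_trivial_contribution_le [Finite F] {Q : F[X]} (hQ : Q.Monic) (hi : Irreducible Q)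
    {D : ℕ} (hD : Q.natDegree = D + 1) {κ : ℕ → ℝ} (hκ : IsDecayingKernel κ) (k l : ℕ) :
    |(∑ x ∈ triangle D, weight κ (fun n => (n : ℝ) ^ k) D x.1 x.2 *
        Real.sqrt (Nat.card F) ^ (x.1 + x.2)) *
      (∑ x ∈ triangle D, weight κ (fun n => (n : ℝ) ^ l) D x.1 x.2 *
        Real.sqrt (Nat.card F) ^ (x.1 + x.2))| / totient Q ≤
      100000 * ((D : ℝ) + 1) ^ (2 * k + 2 * l + 2) := by
  have hq2 : (2 : ℝ) ≤ Nat.card F := by exact_mod_cast two_le_card (F := F)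
  have hs : 4 / 3 ≤ Real.sqrt (Nat.card F) := Real.le_sqrt_of_sq_le (by norm_num; linarith)
  have hsq : Real.sqrt (Nat.card F) ^ 2 = (Nat.card F : ℝ) := Real.sq_sqrt (by linarith)
  rw [div_le_iff₀ (totient_pos hQ hi), totient_eq hQ hi, hD, abs_mul]
  -- Ensures `q ^ (D + 1) ≤ 2 φ(Q)`, so the totient cancels the exponential size of the product;
  -- `100000` exceeds `2 * 195 ^ 2`.
  have hqd : (2 : ℝ) ≤ (Nat.card F : ℝ) ^ (D + 1) :=
    hq2.trans (le_self_pow₀ (by linarith) (by omega))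
  calc _ ≤ (195 * ((D : ℝ) + 1) ^ (2 * k + 1) * Real.sqrt (Nat.card F) ^ (D + 1)) *
        (195 * ((D : ℝ) + 1) ^ (2 * l + 1) * Real.sqrt (Nat.card F) ^ (D + 1)) :=
        mul_le_mul (abs_sum_weight_mul_pow_le hκ k D hs) (abs_sum_weight_mul_pow_le hκ l D hs)
          (abs_nonneg _) (by positivity)
    _ = 38025 * ((D : ℝ) + 1) ^ (2 * k + 2 * l + 2) * (Nat.card F : ℝ) ^ (D + 1) := by
        rw [show (Nat.card F : ℝ) ^ (D + 1) = (Real.sqrt (Nat.card F) ^ (D + 1)) ^ 2 by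
          rw [← hsq, Real.sqrt_sq (by positivity), ← pow_mul, ← pow_mul, mul_comm]]
        ring
    _ ≤ _ := by
        have h : (0 : ℝ) ≤ ((D : ℝ) + 1) ^ (2 * k + 2 * l + 2) := by positivity
        nlinarith [mul_nonneg h (by linarith : (0 : ℝ) ≤ (Nat.card F : ℝ) ^ (D + 1) - 2)]

/-! ### The diagonal main term -/

/-- A device for sums concentrated near a face of the cone: `n` is the distance to the face and `c`
collects the other coordinates. For each value of `c` the distances are distinct, so the inner sum
is at most `S`. -/
theorem sum_comp_le_card_mul {α β : Type*} {s : Finset α} {B : Finset β} {c : α → β} {n : α → ℕ}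
    {φ : ℕ → ℝ} {S : ℝ} (hφ : ∀ m, 0 ≤ φ m) (hS : ∀ t : Finset ℕ, ∑ m ∈ t, φ m ≤ S)
    (hc : ∀ p ∈ s, c p ∈ B) (hinj : Set.InjOn (fun p => (c p, n p)) s) :
    ∑ p ∈ s, φ (n p) ≤ B.card * S := by
  classical
  calc ∑ p ∈ s, φ (n p) = ∑ z ∈ s.image fun p => (c p, n p), φ z.2 :=
        (Finset.sum_image (f := fun z : β × ℕ => φ z.2) hinj).symm
    _ ≤ ∑ z ∈ B ×ˢ s.image n, φ z.2 := by
        refine Finset.sum_le_sum_of_subset_of_nonneg (fun z hz => ?_) fun _ _ _ => hφ _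
        obtain ⟨p, hp, rfl⟩ := Finset.mem_image.mp hz
        exact Finset.mem_product.mpr ⟨hc p hp, Finset.mem_image_of_mem n hp⟩
    _ = B.card * ∑ m ∈ s.image n, φ m := by
        rw [Finset.sum_product]
        simp only [Finset.sum_const, nsmul_eq_mul]
    _ ≤ _ := mul_le_mul_of_nonneg_left (hS _) (Nat.cast_nonneg _)

/-- The triples of natural numbers below `m`. -/
def box (m : ℕ) : Finset (ℕ × ℕ × ℕ) :=
  Finset.range m ×ˢ Finset.range m ×ˢ Finset.range m

theorem card_box (m : ℕ) : (box m).card = m ^ 3 := by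
  simp only [box, Finset.card_product, Finset.card_range]
  ring

theorem card_cone_le (D : ℕ) : ((cone D).card : ℝ) ≤ ((D : ℝ) + 1) ^ 4 := by
  refine le_trans (Nat.cast_le.mpr (Finset.card_filter_le _ _)) (le_of_eq ?_)
  simp only [Finset.card_product, Finset.card_range]
  push_cast
  ring

/-- For fixed `(h, r, s)` the distance `D - 2 g - r - s`, never truncated on the cone, determines
`g`. Summability of `φ` thus gains one dimension: `d ^ 3` instead of `d ^ 4`. -/
theorem sum_cone_fst_le {φ : ℕ → ℝ} {S : ℝ} (hφ : ∀ m, 0 ≤ φ m)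
    (hS : ∀ t : Finset ℕ, ∑ m ∈ t, φ m ≤ S) (D : ℕ) :
    ∑ p ∈ cone D, φ (D - (p.1.1 + p.2.1) - (p.1.1 + p.2.2)) ≤ ((D : ℝ) + 1) ^ 3 * S := by
  have h := sum_comp_le_card_mul (s := cone D) (B := box (D + 1))
    (c := fun p => (p.1.2, p.2.1, p.2.2)) (n := fun p => D - (p.1.1 + p.2.1) - (p.1.1 + p.2.2))
    hφ hS (fun p hp => ?_) (fun p hp p' hp' h => ?_)
  · rw [card_box] at h
    exact_mod_cast h
  · rw [mem_cone] at hp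
    simp only [box, Finset.mem_product, Finset.mem_range]
    omega
  · rw [Finset.mem_coe, mem_cone] at hp hp'
    simp only [Prod.mk.injEq] at h
    ext <;> omega

theorem sum_cone_snd_le {φ : ℕ → ℝ} {S : ℝ} (hφ : ∀ m, 0 ≤ φ m)
    (hS : ∀ t : Finset ℕ, ∑ m ∈ t, φ m ≤ S) (D : ℕ) :
    ∑ p ∈ cone D, φ (D - (p.1.2 + p.2.2) - (p.1.2 + p.2.1)) ≤ ((D : ℝ) + 1) ^ 3 * S := by
  have h := sum_comp_le_card_mul (s := cone D) (B := box (D + 1))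
    (c := fun p => (p.1.1, p.2.1, p.2.2)) (n := fun p => D - (p.1.2 + p.2.2) - (p.1.2 + p.2.1))
    hφ hS (fun p hp => ?_) (fun p hp p' hp' h => ?_)
  · rw [card_box] at h
    exact_mod_cast h
  · rw [mem_cone] at hp
    simp only [box, Finset.mem_product, Finset.mem_range]
    omega
  · rw [Finset.mem_coe, mem_cone] at hp hp'
    simp only [Prod.mk.injEq] at h
    ext <;> omega

theorem card_cone_axis_le (D : ℕ) :
    (((cone D).filter fun p => p.2.1 = 0 ∨ p.2.2 = 0).card : ℝ) ≤ 2 * ((D : ℝ) + 1) ^ 3 := by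
  have h1 : ((cone D).filter fun p => p.2.1 = 0).card ≤ (D + 1) ^ 3 := by
    rw [← card_box]
    refine Finset.card_le_card_of_injOn (fun p => (p.1.1, p.1.2, p.2.2)) (fun p hp => ?_)
      (fun p hp p' hp' h => ?_)
    · rw [Finset.mem_coe, Finset.mem_filter, mem_cone] at hp
      simp only [box, Finset.mem_coe, Finset.mem_product, Finset.mem_range]
      omega
    · rw [Finset.mem_coe, Finset.mem_filter, mem_cone] at hp hp'
      simp only [Prod.mk.injEq] at h
      ext <;> omega
  have h2 : ((cone D).filter fun p => p.2.2 = 0).card ≤ (D + 1) ^ 3 := by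
    rw [← card_box]
    refine Finset.card_le_card_of_injOn (fun p => (p.1.1, p.1.2, p.2.1)) (fun p hp => ?_)
      (fun p hp p' hp' h => ?_)
    · rw [Finset.mem_coe, Finset.mem_filter, mem_cone] at hp
      simp only [box, Finset.mem_coe, Finset.mem_product, Finset.mem_range]
      omega
    · rw [Finset.mem_coe, Finset.mem_filter, mem_cone] at hp hp'
      simp only [Prod.mk.injEq] at h
      ext <;> omega
  rw [Finset.filter_or]
  have h3 := (Finset.card_union_le ((cone D).filter fun p => p.2.1 = 0)
    ((cone D).filter fun p => p.2.2 = 0)).trans (add_le_add h1 h2)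
  rw [← two_mul] at h3
  exact_mod_cast h3

/-- The limiting summand of the diagonal. -/
noncomputable def coneTerm (k l : ℕ) (d : ℝ) (p : (ℕ × ℕ) × (ℕ × ℕ)) : ℝ :=
  limitWeight k d (p.1.1 + p.2.1) (p.1.1 + p.2.2) * limitWeight l d (p.1.2 + p.2.2) (p.1.2 + p.2.1)

theorem abs_coneTerm_le (k l : ℕ) {D : ℕ} {p : (ℕ × ℕ) × (ℕ × ℕ)} (hp : p ∈ cone D) :
    |coneTerm k l ((D : ℝ) + 1) p| ≤ 4 * ((D : ℝ) + 1) ^ (2 * k + 2 * l) := by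
  rw [mem_cone] at hp
  rw [coneTerm, abs_mul]
  calc _ ≤ (2 * ((D : ℝ) + 1) ^ (2 * k)) * (2 * ((D : ℝ) + 1) ^ (2 * l)) :=
        mul_le_mul (abs_limitWeight_le k (by omega)) (abs_limitWeight_le l (by omega))
          (abs_nonneg _) (by positivity)
    _ = _ := by ring

/-- The density equals `1 - 1/q` exactly unless `r = 0` or `s = 0`, and only `O(d ^ 3)` points of
the cone lie there. -/
theorem abs_sum_coneTerm_mul_coprimeDensity_sub_le [Finite F] (k l D : ℕ) :
    |(∑ p ∈ cone D, coneTerm k l ((D : ℝ) + 1) p * coprimeDensity F p.2.1 p.2.2) -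
      (1 - (Nat.card F : ℝ)⁻¹) * ∑ p ∈ cone D, coneTerm k l ((D : ℝ) + 1) p| ≤
      8 * ((D : ℝ) + 1) ^ (2 * k + 2 * l + 3) := by
  have hq : (0 : ℝ) ≤ (Nat.card F : ℝ)⁻¹ := by positivity
  have hq1 : (Nat.card F : ℝ)⁻¹ ≤ 1 :=
    inv_le_one_of_one_le₀ (by exact_mod_cast (two_le_card (F := F)).trans' one_le_two)
  rw [Finset.mul_sum, ← Finset.sum_sub_distrib]
  calc _ ≤ ∑ p ∈ cone D, if p.2.1 = 0 ∨ p.2.2 = 0 then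
        4 * ((D : ℝ) + 1) ^ (2 * k + 2 * l) else 0 := by
        refine (Finset.abs_sum_le_sum_abs _ _).trans (Finset.sum_le_sum fun p hp => ?_)
        split_ifs with h
        · rw [coprimeDensity_of_eq_zero h, show coneTerm k l ((D : ℝ) + 1) p * 1 -
            (1 - (Nat.card F : ℝ)⁻¹) * coneTerm k l ((D : ℝ) + 1) p =
            coneTerm k l ((D : ℝ) + 1) p * (Nat.card F : ℝ)⁻¹ by ring, abs_mul, abs_of_nonneg hq]
          exact (mul_le_of_le_one_right (abs_nonneg _) hq1).trans (abs_coneTerm_le k l hp)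
        · rw [coprimeDensity_of_pos (by tauto) (by tauto), mul_comm, sub_self, abs_zero]
    _ = ((cone D).filter fun p => p.2.1 = 0 ∨ p.2.2 = 0).card *
          (4 * ((D : ℝ) + 1) ^ (2 * k + 2 * l)) := by
        rw [← Finset.sum_filter, Finset.sum_const, nsmul_eq_mul]
    _ ≤ (2 * ((D : ℝ) + 1) ^ 3) * (4 * ((D : ℝ) + 1) ^ (2 * k + 2 * l)) :=
        mul_le_mul_of_nonneg_right (card_cone_axis_le D) (by positivity)
    _ = _ := by ring

theorem abs_weight_mul_weight_sub_le {κ : ℕ → ℝ} (hκ : IsDecayingKernel κ) (k l : ℕ)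
    {D a b u v : ℕ} (hab : a + b ≤ D) (huv : u + v ≤ D) :
    |weight κ (fun n => (n : ℝ) ^ k) D a b * weight κ (fun n => (n : ℝ) ^ l) D u v -
      limitWeight k ((D : ℝ) + 1) a b * limitWeight l ((D : ℝ) + 1) u v| ≤
      ((D : ℝ) + 1) ^ (2 * k + 2 * l) * (33280 * (k + l) / ((D : ℝ) + 1) +
        1040 * (boundaryDecay (D - a - b) + boundaryDecay (D - u - v))) := by
  have h1 := abs_weight_sub_limitWeight_le hκ k hab
  have h2 := abs_weight_sub_limitWeight_le hκ l huv
  have h3 := abs_weight_le hκ l huv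
  have h4 := abs_limitWeight_le k hab
  have hb1 := boundaryDecay_nonneg (D - a - b)
  have hb2 := boundaryDecay_nonneg (D - u - v)
  set d : ℝ := (D : ℝ) + 1 with hd
  have hd0 : 0 < d := by positivity
  set W := weight κ (fun n => (n : ℝ) ^ k) D a b
  set W' := weight κ (fun n => (n : ℝ) ^ l) D u v
  set L := limitWeight k d a b
  set L' := limitWeight l d u v
  calc |W * W' - L * L'| = |(W - L) * W' + L * (W' - L')| := by ring_nf
    _ ≤ |W - L| * |W'| + |L| * |W' - L'| := by
        rw [← abs_mul, ← abs_mul]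
        exact abs_add_le _ _
    _ ≤ (d ^ (2 * k) * (512 * k / d + 16 * boundaryDecay (D - a - b))) * (65 * d ^ (2 * l)) +
          (2 * d ^ (2 * k)) * (d ^ (2 * l) * (512 * l / d + 16 * boundaryDecay (D - u - v))) := by
        gcongr
    _ = d ^ (2 * k + 2 * l) * (65 * (512 * k / d + 16 * boundaryDecay (D - a - b)) +
          2 * (512 * l / d + 16 * boundaryDecay (D - u - v))) := by ring
    _ ≤ _ := by
        refine mul_le_mul_of_nonneg_left ?_ (by positivity)
        have h5 : 0 ≤ (l : ℝ) / d := by positivity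
        have h6 : 33280 * ((k : ℝ) + l) / d = 33280 * (k / d) + 33280 * (l / d) := by ring
        have h7 : 512 * (k : ℝ) / d = 512 * (k / d) := by ring
        have h8 : 512 * (l : ℝ) / d = 512 * (l / d) := by ring
        rw [h6, h7, h8]
        linarith

/-- The main terms of the expansion after averaging over the characters. -/
noncomputable def averagedExpansion [Finite F] [Fintype Fˣ] (Q : F[X]) (D k l : ℕ) : ℝ :=
  ∑ x ∈ triangle D, ∑ y ∈ triangle D,
    (weight oddKernel (fun n => (n : ℝ) ^ k) D x.1 x.2 *
        weight oddKernel (fun n => (n : ℝ) ^ l) D y.1 y.2 *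
          (momentAll Q x.1 x.2 y.1 y.2 - momentEven Q x.1 x.2 y.1 y.2) +
      weight (evenKernel (Nat.card F)) (fun n => (n : ℝ) ^ k) D x.1 x.2 *
        weight (evenKernel (Nat.card F)) (fun n => (n : ℝ) ^ l) D y.1 y.2 *
          momentEven Q x.1 x.2 y.1 y.2)

/-- The average of the weights over odd and even characters. -/
noncomputable def averagedWeight (q D k l : ℕ) (x y : ℕ × ℕ) : ℝ :=
  weight oddKernel (fun n => (n : ℝ) ^ k) D x.1 x.2 *
      weight oddKernel (fun n => (n : ℝ) ^ l) D y.1 y.2 * (1 - ((q : ℝ) - 1)⁻¹) +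
    weight (evenKernel q) (fun n => (n : ℝ) ^ k) D x.1 x.2 *
      weight (evenKernel q) (fun n => (n : ℝ) ^ l) D y.1 y.2 * ((q : ℝ) - 1)⁻¹

/-- The average is a convex combination, with coefficient `1 / (q - 1)` in `[0, 1]`, of two products
that satisfy the same estimate. -/
theorem abs_averagedWeight_sub_le {q : ℕ} (hq : 2 ≤ q) (k l : ℕ) {D : ℕ} {x y : ℕ × ℕ}
    (hx : x ∈ triangle D) (hy : y ∈ triangle D) :
    |averagedWeight q D k l x y - limitWeight k ((D : ℝ) + 1) x.1 x.2 *
      limitWeight l ((D : ℝ) + 1) y.1 y.2| ≤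
      ((D : ℝ) + 1) ^ (2 * k + 2 * l) * (33280 * (k + l) / ((D : ℝ) + 1) +
        1040 * (boundaryDecay (D - x.1 - x.2) + boundaryDecay (D - y.1 - y.2))) := by
  rw [mem_triangle] at hx hy
  have h1 := abs_weight_mul_weight_sub_le isDecayingKernel_oddKernel k l hx hy
  have h2 := abs_weight_mul_weight_sub_le (isDecayingKernel_evenKernel hq) k l hx hy
  have hq1 : (1 : ℝ) ≤ (q : ℝ) - 1 := by
    have : (2 : ℝ) ≤ q := by exact_mod_cast hq
    linarith
  have he0 : 0 ≤ ((q : ℝ) - 1)⁻¹ := by positivity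
  have he1 : ((q : ℝ) - 1)⁻¹ ≤ 1 := inv_le_one_of_one_le₀ hq1
  rw [averagedWeight]
  generalize ((q : ℝ) - 1)⁻¹ = e at he0 he1 ⊢
  rw [abs_le] at h1 h2 ⊢
  constructor <;> nlinarith [mul_nonneg he0 (sub_nonneg.mpr h1.1), mul_nonneg he0 (sub_nonneg.mpr h1.2),
    mul_nonneg he0 (sub_nonneg.mpr h2.1), mul_nonneg he0 (sub_nonneg.mpr h2.2),
    mul_nonneg (sub_nonneg.mpr he1) (sub_nonneg.mpr h1.1),
    mul_nonneg (sub_nonneg.mpr he1) (sub_nonneg.mpr h1.2)]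

/-- The even moment contains the diagonal with coefficient `1 / (q - 1)`, which is how
`averagedWeight` arises. The rest is off-diagonal, multiplied by at most two products of weights of
size `65 * 65` each; hence `8450`. -/
theorem abs_averagedExpansion_sub_diag_le : ∃ (A : ℝ) (b : ℕ), 0 ≤ A ∧ ∀ (F : Type*) [Field F]
    [Finite F] [Fintype Fˣ] (Q : F[X]) (_ : Q.Monic) (_ : Irreducible Q) (D : ℕ)
    (_ : Q.natDegree = D + 1) (k l : ℕ),
    |averagedExpansion Q D k l - ∑ x ∈ triangle D, ∑ y ∈ triangle D,
        averagedWeight (Nat.card F) D k l x y * momentDiag F x.1 x.2 y.1 y.2| ≤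
      8450 * ((D : ℝ) + 1) ^ (2 * k + 2 * l) * ∑ x ∈ triangle D, ∑ y ∈ triangle D,
        offBound A b D (2 * (D + 1) - (x.1 + x.2 + y.1 + y.2)) := by
  obtain ⟨A, b, hA, h⟩ := momentOff_le_offBound
  refine ⟨A, b, hA, fun F _ _ _ Q hQ hi D hD k l => ?_⟩
  rw [averagedExpansion, ← Finset.sum_sub_distrib, Finset.mul_sum]
  refine (Finset.abs_sum_le_sum_abs _ _).trans (Finset.sum_le_sum fun x hx => ?_)
  rw [← Finset.sum_sub_distrib, Finset.mul_sum]
  refine (Finset.abs_sum_le_sum_abs _ _).trans (Finset.sum_le_sum fun y hy => ?_)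
  obtain ⟨h1, h2⟩ := h F Q hQ hi D hD x hx y hy
  have hq1 : (0 : ℝ) ≤ (Nat.card F : ℝ) - 1 := by
    have : (2 : ℝ) ≤ Nat.card F := by exact_mod_cast two_le_card (F := F)
    linarith
  have h3 := momentOff_nonneg Q 1 x.1 x.2 y.1 y.2
  have h4 : 0 ≤ (∑ c : Fˣ, momentOff Q (c : F) x.1 x.2 y.1 y.2) / (Nat.card F - 1) :=
    div_nonneg (Finset.sum_nonneg fun c _ => momentOff_nonneg _ _ _ _ _ _) hq1
  rw [momentAll_eq, momentEven_eq, averagedWeight]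
  rw [mem_triangle] at hx hy
  have hW : ∀ κ : ℕ → ℝ, IsDecayingKernel κ → |weight κ (fun n => (n : ℝ) ^ k) D x.1 x.2 *
      weight κ (fun n => (n : ℝ) ^ l) D y.1 y.2| ≤ 4225 * ((D : ℝ) + 1) ^ (2 * k + 2 * l) := by
    intro κ hκ
    rw [abs_mul]
    calc _ ≤ (65 * ((D : ℝ) + 1) ^ (2 * k)) * (65 * ((D : ℝ) + 1) ^ (2 * l)) :=
          mul_le_mul (abs_weight_le hκ k hx) (abs_weight_le hκ l hy) (abs_nonneg _)
            (by positivity)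
      _ = _ := by ring
  have ho := hW _ isDecayingKernel_oddKernel
  have he := hW _ (isDecayingKernel_evenKernel (two_le_card (F := F)))
  generalize weight oddKernel (fun n => (n : ℝ) ^ k) D x.1 x.2 *
      weight oddKernel (fun n => (n : ℝ) ^ l) D y.1 y.2 = Wo at ho ⊢
  generalize weight (evenKernel (Nat.card F)) (fun n => (n : ℝ) ^ k) D x.1 x.2 *
      weight (evenKernel (Nat.card F)) (fun n => (n : ℝ) ^ l) D y.1 y.2 = We at he ⊢
  generalize (∑ c : Fˣ, momentOff Q (c : F) x.1 x.2 y.1 y.2) / (Nat.card F - 1) = oe at h2 h4 ⊢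
  generalize momentOff Q 1 x.1 x.2 y.1 y.2 = oa at h1 h3 ⊢
  generalize momentDiag F x.1 x.2 y.1 y.2 = m
  generalize offBound A b D (2 * (D + 1) - (x.1 + x.2 + y.1 + y.2)) = B at h1 h2 ⊢
  have heq : Wo * (m + oa - (m / ((Nat.card F : ℝ) - 1) + oe)) +
      We * (m / ((Nat.card F : ℝ) - 1) + oe) -
      (Wo * (1 - ((Nat.card F : ℝ) - 1)⁻¹) + We * ((Nat.card F : ℝ) - 1)⁻¹) * m =
      Wo * (oa - oe) + We * oe := by ring
  rw [heq]
  have h5 : |oa - oe| ≤ B := by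
    rw [abs_le]
    constructor <;> linarith
  calc |Wo * (oa - oe) + We * oe| ≤ |Wo| * |oa - oe| + |We| * |oe| := by
        rw [← abs_mul, ← abs_mul]
        exact abs_add_le _ _
    _ ≤ (4225 * ((D : ℝ) + 1) ^ (2 * k + 2 * l)) * B +
          (4225 * ((D : ℝ) + 1) ^ (2 * k + 2 * l)) * B := by
        rw [abs_of_nonneg h4]
        gcongr
    _ = _ := by ring

/-- Replacing the weights by their limits costs `1/d` relatively on all of the cone and
`boundaryDecay` near its two faces; replacing the density costs the points on the axes. Each loss is
one power of `d` below the main term. -/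
theorem abs_sum_diag_sub_le (k l : ℕ) : ∃ K : ℝ, 0 ≤ K ∧ ∀ (F : Type*) [Field F] [Finite F]
    (D : ℕ),
    |(∑ x ∈ triangle D, ∑ y ∈ triangle D,
        averagedWeight (Nat.card F) D k l x y * momentDiag F x.1 x.2 y.1 y.2) -
      (1 - (Nat.card F : ℝ)⁻¹) * ∑ p ∈ cone D, coneTerm k l ((D : ℝ) + 1) p| ≤
      K * ((D : ℝ) + 1) ^ (2 * k + 2 * l + 3) := by
  obtain ⟨S, hS0, hS⟩ := exists_sum_boundaryDecay_le
  refine ⟨33280 * (k + l) + 2080 * S + 8, by positivity, fun F _ _ D => ?_⟩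
  have h1 := abs_sum_coneTerm_mul_coprimeDensity_sub_le (F := F) k l D
  rw [sum_mul_momentDiag]
  set d : ℝ := (D : ℝ) + 1 with hd
  have hd0 : 0 < d := by positivity
  have h2 : |(∑ p ∈ cone D, averagedWeight (Nat.card F) D k l (productDegrees p).1
      (productDegrees p).2 * coprimeDensity F p.2.1 p.2.2) -
      ∑ p ∈ cone D, coneTerm k l d p * coprimeDensity F p.2.1 p.2.2| ≤
      (33280 * (k + l) + 2080 * S) * d ^ (2 * k + 2 * l + 3) := by
    rw [← Finset.sum_sub_distrib]
    calc _ ≤ ∑ p ∈ cone D, d ^ (2 * k + 2 * l) * (33280 * (k + l) / d +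
          1040 * (boundaryDecay (D - (p.1.1 + p.2.1) - (p.1.1 + p.2.2)) +
            boundaryDecay (D - (p.1.2 + p.2.2) - (p.1.2 + p.2.1)))) := by
          refine (Finset.abs_sum_le_sum_abs _ _).trans (Finset.sum_le_sum fun p hp => ?_)
          obtain ⟨hx, hy⟩ := productDegrees_mem_triangle hp
          rw [← sub_mul, abs_mul, abs_of_nonneg (coprimeDensity_nonneg _ _)]
          refine (mul_le_of_le_one_right (abs_nonneg _) (coprimeDensity_le_one _ _)).trans ?_
          exact abs_averagedWeight_sub_le (two_le_card (F := F)) k l hx hy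
      _ = d ^ (2 * k + 2 * l) * ((cone D).card * (33280 * (k + l) / d) +
          1040 * (∑ p ∈ cone D, boundaryDecay (D - (p.1.1 + p.2.1) - (p.1.1 + p.2.2)) +
            ∑ p ∈ cone D, boundaryDecay (D - (p.1.2 + p.2.2) - (p.1.2 + p.2.1)))) := by
          rw [← Finset.mul_sum, Finset.sum_add_distrib, Finset.sum_const, nsmul_eq_mul,
            ← Finset.mul_sum, Finset.sum_add_distrib]
      _ ≤ d ^ (2 * k + 2 * l) * (d ^ 4 * (33280 * (k + l) / d) +
          1040 * (d ^ 3 * S + d ^ 3 * S)) := by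
          have h3 := card_cone_le D
          have h4 := sum_cone_fst_le boundaryDecay_nonneg hS D
          have h5 := sum_cone_snd_le boundaryDecay_nonneg hS D
          rw [← hd] at h3 h4 h5
          gcongr
      _ = _ := by
          field_simp
          ring
  calc _ ≤ (33280 * (k + l) + 2080 * S) * d ^ (2 * k + 2 * l + 3) +
        8 * d ^ (2 * k + 2 * l + 3) := (abs_sub_le _ _ _).trans (add_le_add h2 h1)
    _ = _ := by ring

/-! ### The Riemann sum -/

/-- The integrand of the main term. -/
noncomputable def integrand (k l : ℕ) (a : Fin 4 → ℝ) : ℝ :=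
  f k (a 0 + a 2) (a 0 + a 3) 1 * f l (a 1 + a 3) (a 1 + a 2) 1

/-- The closure of `region`. -/
def closedRegion : Set (Fin 4 → ℝ) :=
  {a | (∀ i, 0 ≤ a i) ∧ 2 * a 0 + a 2 + a 3 ≤ 1 ∧ 2 * a 1 + a 2 + a 3 ≤ 1}

theorem region_subset_closedRegion : region ⊆ closedRegion :=
  fun _ ha => ⟨ha.1, ha.2.1.le, ha.2.2.le⟩

theorem f_one_mem_Icc {k : ℕ} {x y : ℝ} (hx : 0 ≤ x) (hx1 : x ≤ 1) (hy : 0 ≤ y) (hy1 : y ≤ 1) :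
    0 ≤ f k x y 1 ∧ f k x y 1 ≤ 2 := by
  have h1 : 0 ≤ 1 - x := by linarith
  have h2 : 0 ≤ 1 - y := by linarith
  refine ⟨by rw [f]; positivity, ?_⟩
  have h3 := pow_mul_pow_le (k := k) hx hx1 hy hy1
  have h4 := pow_mul_pow_le (k := k) h1 (by linarith : 1 - x ≤ 1) h2 (by linarith : 1 - y ≤ 1)
  rw [one_pow] at h3 h4
  rw [f]
  linarith

theorem abs_f_one_sub_le {k : ℕ} {x y x' y' : ℝ} (hx : 0 ≤ x) (hx1 : x ≤ 1) (hy : 0 ≤ y)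
    (hy1 : y ≤ 1) (hx' : 0 ≤ x') (hx1' : x' ≤ 1) (hy' : 0 ≤ y') (hy1' : y' ≤ 1) :
    |f k x y 1 - f k x' y' 1| ≤ 2 * k * (|x - x'| + |y - y'|) := by
  have h1 := abs_pow_mul_pow_sub_le k hx hx1 hy hy1 hx' hx1' hy' hy1'
  have h2 := abs_pow_mul_pow_sub_le k (sub_nonneg.mpr hx1) (by linarith : 1 - x ≤ 1)
    (sub_nonneg.mpr hy1) (by linarith : 1 - y ≤ 1) (sub_nonneg.mpr hx1')
    (by linarith : 1 - x' ≤ 1) (sub_nonneg.mpr hy1') (by linarith : 1 - y' ≤ 1)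
  rw [sub_sub_sub_cancel_left, sub_sub_sub_cancel_left, abs_sub_comm x' x, abs_sub_comm y' y] at h2
  rw [f, f]
  calc _ = |(x ^ k * y ^ k - x' ^ k * y' ^ k) +
        ((1 - x) ^ k * (1 - y) ^ k - (1 - x') ^ k * (1 - y') ^ k)| := by ring_nf
    _ ≤ _ := (abs_add_le _ _).trans (by linarith)

theorem integrand_mem_Icc {k l : ℕ} {a : Fin 4 → ℝ} (ha : a ∈ closedRegion) :
    0 ≤ integrand k l a ∧ integrand k l a ≤ 4 := by
  obtain ⟨h0, h1, h2⟩ := ha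
  have ha0 := h0 0
  have ha1 := h0 1
  have ha2 := h0 2
  have ha3 := h0 3
  have h3 := f_one_mem_Icc (k := k) (x := a 0 + a 2) (y := a 0 + a 3) (by linarith) (by linarith)
    (by linarith) (by linarith)
  have h4 := f_one_mem_Icc (k := l) (x := a 1 + a 3) (y := a 1 + a 2) (by linarith) (by linarith)
    (by linarith) (by linarith)
  rw [integrand]
  exact ⟨mul_nonneg h3.1 h4.1, by nlinarith⟩

theorem abs_integrand_sub_le {k l : ℕ} {a b : Fin 4 → ℝ} (ha : a ∈ closedRegion)
    (hb : b ∈ closedRegion) {ε : ℝ} (h : ∀ i, |a i - b i| ≤ ε) :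
    |integrand k l a - integrand k l b| ≤ 16 * (k + l) * ε := by
  obtain ⟨ha0, ha1, ha2⟩ := ha
  obtain ⟨hb0, hb1, hb2⟩ := hb
  have hsum : ∀ i j, |a i + a j - (b i + b j)| ≤ 2 * ε := fun i j => by
    rw [add_sub_add_comm, two_mul]
    exact (abs_add_le _ _).trans (add_le_add (h i) (h j))
  have A0 := ha0 0
  have A1 := ha0 1
  have A2 := ha0 2
  have A3 := ha0 3
  have B0 := hb0 0
  have B1 := hb0 1
  have B2 := hb0 2
  have B3 := hb0 3
  have hk := abs_f_one_sub_le (k := k) (x := a 0 + a 2) (y := a 0 + a 3) (x' := b 0 + b 2)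
    (y' := b 0 + b 3) (by linarith) (by linarith) (by linarith) (by linarith) (by linarith)
    (by linarith) (by linarith) (by linarith)
  have hl := abs_f_one_sub_le (k := l) (x := a 1 + a 3) (y := a 1 + a 2) (x' := b 1 + b 3)
    (y' := b 1 + b 2) (by linarith) (by linarith) (by linarith) (by linarith) (by linarith)
    (by linarith) (by linarith) (by linarith)
  have hl2 := f_one_mem_Icc (k := l) (x := a 1 + a 3) (y := a 1 + a 2) (by linarith)
    (by linarith) (by linarith) (by linarith)
  have hk2 := f_one_mem_Icc (k := k) (x := b 0 + b 2) (y := b 0 + b 3) (by linarith)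
    (by linarith) (by linarith) (by linarith)
  replace hk := hk.trans (mul_le_mul_of_nonneg_left (add_le_add (hsum 0 2) (hsum 0 3))
    (by positivity))
  replace hl := hl.trans (mul_le_mul_of_nonneg_left (add_le_add (hsum 1 3) (hsum 1 2))
    (by positivity))
  rw [integrand, integrand]
  generalize f k (a 0 + a 2) (a 0 + a 3) 1 = X at hk ⊢
  generalize f l (a 1 + a 3) (a 1 + a 2) 1 = Y at hl hl2 ⊢
  generalize f k (b 0 + b 2) (b 0 + b 3) 1 = X' at hk hk2 ⊢
  generalize f l (b 1 + b 3) (b 1 + b 2) 1 = Y' at hl ⊢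
  calc |X * Y - X' * Y'| = |(X - X') * Y + X' * (Y - Y')| := by ring_nf
    _ ≤ |X - X'| * Y + X' * |Y - Y'| := by
        refine (abs_add_le _ _).trans (le_of_eq ?_)
        rw [abs_mul, abs_mul, abs_of_nonneg hl2.1, abs_of_nonneg hk2.1]
    _ ≤ (2 * k * (2 * ε + 2 * ε)) * 2 + 2 * (2 * l * (2 * ε + 2 * ε)) :=
        add_le_add (mul_le_mul hk hl2.2 hl2.1 ((abs_nonneg _).trans hk))
          (mul_le_mul hk2.2 hl (abs_nonneg _) (by norm_num))
    _ = _ := by ring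

/-- The point of `ℝ⁴` with coordinates `p / d`. -/
noncomputable def gridPoint (d : ℝ) (p : (ℕ × ℕ) × (ℕ × ℕ)) : Fin 4 → ℝ :=
  ![p.1.1 / d, p.1.2 / d, p.2.1 / d, p.2.2 / d]

/-- The half-open cube of side `1 / d` with lowest vertex `p / d`. -/
noncomputable def gridCube (d : ℝ) (p : (ℕ × ℕ) × (ℕ × ℕ)) : Set (Fin 4 → ℝ) :=
  Set.univ.pi fun i => Set.Ico (gridPoint d p i) (gridPoint d p i + d⁻¹)

theorem coneTerm_eq (k l : ℕ) {d : ℝ} (hd : 0 < d) (p : (ℕ × ℕ) × (ℕ × ℕ)) :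
    coneTerm k l d p = d ^ (2 * k + 2 * l) * integrand k l (gridPoint d p) := by
  have h : ∀ (k : ℕ) (a b : ℕ), limitWeight k d a b =
      d ^ (2 * k) * f k (a / d) (b / d) 1 := by
    intro k a b
    have h1 : (a : ℝ) = d * (a / d) := by field_simp
    have h2 : (b : ℝ) = d * (b / d) := by field_simp
    have h3 : d - a = d * (1 - a / d) := by field_simp
    have h4 : d - b = d * (1 - b / d) := by field_simp
    rw [limitWeight, h3, h4, f]
    nth_rewrite 1 [h1]
    nth_rewrite 1 [h2]
    simp only [mul_pow]
    ring
  rw [coneTerm, h, h, integrand, gridPoint, pow_add]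
  simp only [Matrix.cons_val]
  push_cast
  simp only [add_div]
  ring

theorem mem_gridCube {d : ℝ} {p : (ℕ × ℕ) × (ℕ × ℕ)} {a : Fin 4 → ℝ} :
    a ∈ gridCube d p ↔ ∀ i, gridPoint d p i ≤ a i ∧ a i < gridPoint d p i + d⁻¹ := by
  simp only [gridCube, Set.mem_pi, Set.mem_univ, true_implies, Set.mem_Ico]

theorem measurableSet_gridCube (d : ℝ) (p : (ℕ × ℕ) × (ℕ × ℕ)) : MeasurableSet (gridCube d p) :=
  MeasurableSet.univ_pi fun _ => measurableSet_Ico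

theorem volume_gridCube {d : ℝ} (hd : 0 < d) (p : (ℕ × ℕ) × (ℕ × ℕ)) :
    MeasureTheory.volume (gridCube d p) = ENNReal.ofReal (d⁻¹ ^ 4) := by
  rw [gridCube, Real.volume_pi_Ico]
  simp only [add_sub_cancel_left, Finset.prod_const, Finset.card_univ, Fintype.card_fin]
  rw [ENNReal.ofReal_pow (by positivity)]

theorem gridPoint_nonneg {d : ℝ} (hd : 0 < d) (p : (ℕ × ℕ) × (ℕ × ℕ)) (i : Fin 4) :
    0 ≤ gridPoint d p i := by
  fin_cases i <;> simp only [gridPoint] <;> simp <;> positivity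

theorem gridPoint_mem_closedRegion {D : ℕ} {p : (ℕ × ℕ) × (ℕ × ℕ)} (hp : p ∈ cone D) :
    gridPoint ((D : ℝ) + 1) p ∈ closedRegion := by
  have hd : (0 : ℝ) < (D : ℝ) + 1 := by positivity
  rw [mem_cone] at hp
  have h1 : 2 * (p.1.1 : ℝ) + p.2.1 + p.2.2 ≤ D := by exact_mod_cast hp.1
  have h2 : 2 * (p.1.2 : ℝ) + p.2.1 + p.2.2 ≤ D := by exact_mod_cast hp.2
  refine ⟨gridPoint_nonneg hd p, ?_, ?_⟩ <;> simp only [gridPoint, Matrix.cons_val]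
  · rw [← mul_div_assoc, ← add_div, ← add_div, div_le_one hd]
    linarith
  · rw [← mul_div_assoc, ← add_div, ← add_div, div_le_one hd]
    linarith

theorem pairwiseDisjoint_gridCube {d : ℝ} (hd : 0 < d) (s : Set ((ℕ × ℕ) × (ℕ × ℕ))) :
    s.PairwiseDisjoint (gridCube d) := by
  intro p _ p' _ hne
  rw [Function.onFun, Set.disjoint_left]
  intro a ha ha'
  rw [mem_gridCube] at ha ha'
  apply hne
  have key : ∀ (m n : ℕ) (x : ℝ), (m : ℝ) / d ≤ x ∧ x < m / d + d⁻¹ →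
      (n : ℝ) / d ≤ x ∧ x < n / d + d⁻¹ → m = n := by
    intro m n x hm hn
    rw [← one_div, ← add_div, div_le_iff₀ hd, lt_div_iff₀ hd] at hm hn
    have h1 : (m : ℝ) < n + 1 := by linarith
    have h2 : (n : ℝ) < m + 1 := by linarith
    norm_cast at h1 h2
    omega
  exact Prod.ext (Prod.ext (key _ _ _ (ha 0) (ha' 0)) (key _ _ _ (ha 1) (ha' 1)))
    (Prod.ext (key _ _ _ (ha 2) (ha' 2)) (key _ _ _ (ha 3) (ha' 3)))

theorem region_subset_biUnion_gridCube (D : ℕ) :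
    region ⊆ ⋃ p ∈ cone D, gridCube ((D : ℝ) + 1) p := by
  intro a ha
  obtain ⟨h0, h1, h2⟩ := ha
  have hd : (0 : ℝ) < (D : ℝ) + 1 := by positivity
  have hf : ∀ i, (⌊((D : ℝ) + 1) * a i⌋₊ : ℝ) ≤ ((D : ℝ) + 1) * a i := fun i =>
    Nat.floor_le (mul_nonneg hd.le (h0 i))
  have hf2 : ∀ i, ((D : ℝ) + 1) * a i < ⌊((D : ℝ) + 1) * a i⌋₊ + 1 := fun i =>
    Nat.lt_floor_add_one _
  simp only [Set.mem_iUnion]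
  refine ⟨((⌊((D : ℝ) + 1) * a 0⌋₊, ⌊((D : ℝ) + 1) * a 1⌋₊),
    (⌊((D : ℝ) + 1) * a 2⌋₊, ⌊((D : ℝ) + 1) * a 3⌋₊)), ?_, ?_⟩
  · rw [mem_cone]
    have h3 := hf 0
    have h4 := hf 1
    have h5 := hf 2
    have h6 := hf 3
    have h7 := mul_lt_mul_of_pos_left h1 hd
    have h8 := mul_lt_mul_of_pos_left h2 hd
    constructor
    -- The strict inequality of `region`, scaled by `D + 1`, gives an integer less than `D + 1`,
    -- that is at most `D`, as `cone D` demands.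
    · rw [← Nat.lt_succ_iff, ← Nat.cast_lt (α := ℝ)]
      push_cast
      linarith
    · rw [← Nat.lt_succ_iff, ← Nat.cast_lt (α := ℝ)]
      push_cast
      linarith
  · rw [mem_gridCube]
    have key : ∀ i, (⌊((D : ℝ) + 1) * a i⌋₊ : ℝ) / ((D : ℝ) + 1) ≤ a i ∧
        a i < (⌊((D : ℝ) + 1) * a i⌋₊ : ℝ) / ((D : ℝ) + 1) + ((D : ℝ) + 1)⁻¹ := by
      intro i
      rw [← one_div, ← add_div, div_le_iff₀ hd, lt_div_iff₀ hd, mul_comm (a i)]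
      exact ⟨hf i, hf2 i⟩
    intro i
    fin_cases i
    · exact key 0
    · exact key 1
    · exact key 2
    · exact key 3

theorem measurableSet_region : MeasurableSet region := by
  have h : region = (⋂ i, {a : Fin 4 → ℝ | 0 ≤ a i}) ∩
      ({a | 2 * a 0 + a 2 + a 3 < 1} ∩ {a | 2 * a 1 + a 2 + a 3 < 1}) := by
    ext a
    simp only [region, Set.mem_ofPred_eq, Set.mem_inter_iff, Set.mem_iInter]
  rw [h]
  refine (MeasurableSet.iInter fun i => ?_).inter (MeasurableSet.inter ?_ ?_)
  · exact measurableSet_le measurable_const (by fun_prop)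
  · exact measurableSet_lt (by fun_prop) measurable_const
  · exact measurableSet_lt (by fun_prop) measurable_const

theorem continuous_integrand (k l : ℕ) : Continuous (integrand k l) := by
  unfold integrand f
  fun_prop

theorem integrableOn_integrand (k l : ℕ) :
    MeasureTheory.IntegrableOn (integrand k l) region := by
  refine ((continuous_integrand k l).continuousOn.integrableOn_compact
    (isCompact_Icc (a := (0 : Fin 4 → ℝ)) (b := 1))).mono_set fun a ha => ?_
  obtain ⟨h0, h1, h2⟩ := ha
  have A0 := h0 0
  have A1 := h0 1
  have A2 := h0 2
  have A3 := h0 3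
  refine ⟨h0, fun i => ?_⟩
  fin_cases i <;> simp <;> linarith

theorem setIntegral_region_eq_sum (k l D : ℕ) :
    ∫ a in region, integrand k l a = ∑ p ∈ cone D,
      ∫ a in gridCube ((D : ℝ) + 1) p, region.indicator (integrand k l) a := by
  have hd : (0 : ℝ) < (D : ℝ) + 1 := by positivity
  have hint : MeasureTheory.Integrable (region.indicator (integrand k l)) :=
    (MeasureTheory.integrable_indicator_iff measurableSet_region).mpr (integrableOn_integrand k l)
  rw [← MeasureTheory.integral_biUnion_finset (cone D) (fun p _ => measurableSet_gridCube _ p)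
    (pairwiseDisjoint_gridCube hd _) (fun p _ => hint.integrableOn),
    MeasureTheory.setIntegral_indicator measurableSet_region,
    Set.inter_eq_self_of_subset_right (region_subset_biUnion_gridCube D)]

/-- On points of `region` the integrand is Lipschitz. Within a cube each of the two linear forms
grows by less than `4/d`, so a cube leaves `region` only if its lowest vertex is within `3` lattice
steps of a face; there the integrand is bounded by `4`. -/
theorem abs_integrand_gridPoint_sub_indicator_le (k l : ℕ) {D : ℕ} {p : (ℕ × ℕ) × (ℕ × ℕ)}
    (hp : p ∈ cone D) {a : Fin 4 → ℝ} (ha : a ∈ gridCube ((D : ℝ) + 1) p) :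
    |integrand k l (gridPoint ((D : ℝ) + 1) p) - region.indicator (integrand k l) a| ≤
      16 * (k + l) * ((D : ℝ) + 1)⁻¹ +
        4 * ((if D - (p.1.1 + p.2.1) - (p.1.1 + p.2.2) < 3 then 1 else 0) +
          (if D - (p.1.2 + p.2.2) - (p.1.2 + p.2.1) < 3 then 1 else 0)) := by
  have hd : (0 : ℝ) < (D : ℝ) + 1 := by positivity
  have hg := gridPoint_mem_closedRegion hp
  rw [mem_gridCube] at ha
  have hite : ∀ P : Prop, ∀ [Decidable P], (0 : ℝ) ≤ if P then 1 else 0 := fun P _ => by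
    split_ifs <;> norm_num
  by_cases har : a ∈ region
  · rw [Set.indicator_of_mem har]
    refine (abs_integrand_sub_le hg (region_subset_closedRegion har) (ε := ((D : ℝ) + 1)⁻¹)
      fun i => ?_).trans (le_add_of_nonneg_right
        (mul_nonneg (by norm_num) (add_nonneg (hite _) (hite _))))
    rw [abs_le]
    constructor <;> linarith [(ha i).1, (ha i).2, inv_pos.mpr hd]
  · rw [Set.indicator_of_notMem har, sub_zero]
    have h4 := integrand_mem_Icc (k := k) (l := l) hg
    rw [abs_of_nonneg h4.1]
    have hbad : D - (p.1.1 + p.2.1) - (p.1.1 + p.2.2) < 3 ∨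
        D - (p.1.2 + p.2.2) - (p.1.2 + p.2.1) < 3 := by
      by_contra! hcon
      apply har
      rw [mem_cone] at hp
      have e1 : 2 * p.1.1 + p.2.1 + p.2.2 + 4 ≤ D + 1 := by omega
      have e2 : 2 * p.1.2 + p.2.1 + p.2.2 + 4 ≤ D + 1 := by omega
      have e1' : 2 * (p.1.1 : ℝ) + p.2.1 + p.2.2 + 4 ≤ D + 1 := by exact_mod_cast e1
      have e2' : 2 * (p.1.2 : ℝ) + p.2.1 + p.2.2 + 4 ≤ D + 1 := by exact_mod_cast e2
      have hs : ∀ (m : ℕ) (x : ℝ), x < (m : ℝ) / ((D : ℝ) + 1) + ((D : ℝ) + 1)⁻¹ →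
          ((D : ℝ) + 1) * x < m + 1 := by
        intro m x hx
        rwa [← one_div, ← add_div, lt_div_iff₀ hd, mul_comm] at hx
      have s0 := hs p.1.1 (a 0) (ha 0).2
      have s1 := hs p.1.2 (a 1) (ha 1).2
      have s2 := hs p.2.1 (a 2) (ha 2).2
      have s3 := hs p.2.2 (a 3) (ha 3).2
      refine ⟨fun i => (gridPoint_nonneg hd p i).trans (ha i).1, ?_, ?_⟩
      · refine lt_of_mul_lt_mul_left ?_ hd.le
        linarith
      · refine lt_of_mul_lt_mul_left ?_ hd.le
        linarith
    have h16 : 0 ≤ 16 * ((k : ℝ) + l) * ((D : ℝ) + 1)⁻¹ := by positivity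
    rcases hbad with h | h
    · rw [if_pos h]
      linarith [hite (D - (p.1.2 + p.2.2) - (p.1.2 + p.2.1) < 3)]
    · rw [if_pos h]
      linarith [hite (D - (p.1.1 + p.2.1) - (p.1.1 + p.2.2) < 3)]

/-- The Lipschitz error is `O(1/d)` per unit of volume, and the `O(d ^ 3)` cubes near the faces have
total volume `O(1/d)`. The constant `24` is `4 * (3 + 3)`: integrand at most `4`, three layers at
each of two faces. -/
theorem abs_riemannSum_sub_le (k l D : ℕ) :
    |(∑ p ∈ cone D, integrand k l (gridPoint ((D : ℝ) + 1) p) * ((D : ℝ) + 1)⁻¹ ^ 4) -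
      ∫ a in region, integrand k l a| ≤ (16 * (k + l) + 24) * ((D : ℝ) + 1)⁻¹ := by
  have hd : (0 : ℝ) < (D : ℝ) + 1 := by positivity
  rw [setIntegral_region_eq_sum k l D, ← Finset.sum_sub_distrib]
  have hint : MeasureTheory.Integrable (region.indicator (integrand k l)) :=
    (MeasureTheory.integrable_indicator_iff measurableSet_region).mpr (integrableOn_integrand k l)
  have hcell : ∀ p ∈ cone D, |integrand k l (gridPoint ((D : ℝ) + 1) p) * ((D : ℝ) + 1)⁻¹ ^ 4 -
      ∫ a in gridCube ((D : ℝ) + 1) p, region.indicator (integrand k l) a| ≤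
      (16 * (k + l) * ((D : ℝ) + 1)⁻¹ +
        4 * ((if D - (p.1.1 + p.2.1) - (p.1.1 + p.2.2) < 3 then 1 else 0) +
          (if D - (p.1.2 + p.2.2) - (p.1.2 + p.2.1) < 3 then 1 else 0))) *
        ((D : ℝ) + 1)⁻¹ ^ 4 := by
    intro p hp
    have hv : MeasureTheory.volume.real (gridCube ((D : ℝ) + 1) p) = ((D : ℝ) + 1)⁻¹ ^ 4 := by
      rw [MeasureTheory.Measure.real, volume_gridCube hd, ENNReal.toReal_ofReal (by positivity)]
    have hfin : MeasureTheory.volume (gridCube ((D : ℝ) + 1) p) < ⊤ := by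
      rw [volume_gridCube hd]
      exact ENNReal.ofReal_lt_top
    have h1 : integrand k l (gridPoint ((D : ℝ) + 1) p) * ((D : ℝ) + 1)⁻¹ ^ 4 =
        ∫ _ in gridCube ((D : ℝ) + 1) p, integrand k l (gridPoint ((D : ℝ) + 1) p) := by
      rw [MeasureTheory.setIntegral_const, hv, smul_eq_mul, mul_comm]
    rw [h1, ← MeasureTheory.integral_sub (MeasureTheory.integrableOn_const
      (C := integrand k l (gridPoint ((D : ℝ) + 1) p)) hfin.ne (by simp))
      hint.integrableOn, ← hv, ← Real.norm_eq_abs]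
    exact MeasureTheory.norm_setIntegral_le_of_norm_le_const hfin fun a ha =>
      abs_integrand_gridPoint_sub_indicator_le k l hp ha
  have hφ : ∀ m : ℕ, (0 : ℝ) ≤ if m < 3 then 1 else 0 := fun m => by split_ifs <;> norm_num
  have hS : ∀ t : Finset ℕ, ∑ m ∈ t, (if m < 3 then (1 : ℝ) else 0) ≤ 3 := by
    intro t
    rw [Finset.sum_boole]
    have : (t.filter fun m => m < 3).card ≤ (Finset.range 3).card :=
      Finset.card_le_card fun m hm => Finset.mem_range.mpr (Finset.mem_filter.mp hm).2
    rw [Finset.card_range] at this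
    exact_mod_cast this
  have h1 := sum_cone_fst_le hφ hS D
  have h2 := sum_cone_snd_le hφ hS D
  have h3 := card_cone_le D
  refine (Finset.abs_sum_le_sum_abs _ _).trans ((Finset.sum_le_sum hcell).trans ?_)
  rw [← Finset.sum_mul, Finset.sum_add_distrib, Finset.sum_const, nsmul_eq_mul, ← Finset.mul_sum,
    Finset.sum_add_distrib]
  calc _ ≤ (((D : ℝ) + 1) ^ 4 * (16 * (k + l) * ((D : ℝ) + 1)⁻¹) +
        4 * (((D : ℝ) + 1) ^ 3 * 3 + ((D : ℝ) + 1) ^ 3 * 3)) * ((D : ℝ) + 1)⁻¹ ^ 4 := by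
        gcongr
    _ = _ := by
        field_simp
        ring

theorem abs_sum_coneTerm_sub_le (k l D : ℕ) :
    |(∑ p ∈ cone D, coneTerm k l ((D : ℝ) + 1) p) - ((D : ℝ) + 1) ^ (2 * k + 2 * l + 4) *
      ∫ a in region, integrand k l a| ≤
      (16 * (k + l) + 24) * ((D : ℝ) + 1) ^ (2 * k + 2 * l + 3) := by
  have h := abs_riemannSum_sub_le k l D
  set d : ℝ := (D : ℝ) + 1 with hd
  have hd0 : 0 < d := by positivity
  have h1 : ∑ p ∈ cone D, coneTerm k l d p = d ^ (2 * k + 2 * l + 4) *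
      ∑ p ∈ cone D, integrand k l (gridPoint d p) * d⁻¹ ^ 4 := by
    rw [Finset.mul_sum]
    refine Finset.sum_congr rfl fun p _ => ?_
    rw [coneTerm_eq k l hd0, pow_add d _ 4]
    field_simp
  rw [h1, ← mul_sub, abs_mul, abs_of_pos (by positivity)]
  calc _ ≤ d ^ (2 * k + 2 * l + 4) * ((16 * (k + l) + 24) * d⁻¹) :=
        mul_le_mul_of_nonneg_left h (by positivity)
    _ = _ := by
        rw [pow_succ]
        field_simp

/-! ### The fourth moment -/

theorem finsum_ne_one_eq_sum [Finite F] {Q : F[X]} [Fintype (DirichletChar Q)]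
    [DecidableEq (DirichletChar Q)] (g : DirichletChar Q → ℝ) :
    ∑ᶠ (χ : DirichletChar Q) (_ : χ ≠ 1), g χ = ∑ χ : DirichletChar Q with χ ≠ 1, g χ := by
  rw [← finsum_mem_coe_finset]
  simp only [Finset.coe_filter, Finset.mem_univ, true_and, Set.mem_ofPred_eq]

theorem moment_eq_averagedExpansion [Finite F] [Fintype Fˣ] {Q : F[X]} (hQ : Q.Monic)
    (hi : Irreducible Q) {D : ℕ} (hD : Q.natDegree = D + 1) (k l : ℕ) :
    1 / (totient Q : ℝ) * (1 / Real.log (Nat.card F) ^ (2 * k + 2 * l)) *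
      (∑ᶠ (χ : DirichletChar Q) (_ : χ ≠ 1), ‖iteratedDeriv k (LFunction χ) (1 / 2)‖ ^ 2 *
        ‖iteratedDeriv l (LFunction χ) (1 / 2)‖ ^ 2) =
      averagedExpansion Q D k l -
        (∑ x ∈ triangle D, weight (evenKernel (Nat.card F)) (fun n => (n : ℝ) ^ k) D x.1 x.2 *
          Real.sqrt (Nat.card F) ^ (x.1 + x.2)) *
        (∑ x ∈ triangle D, weight (evenKernel (Nat.card F)) (fun n => (n : ℝ) ^ l) D x.1 x.2 *
          Real.sqrt (Nat.card F) ^ (x.1 + x.2)) / totient Q := by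
  classical
  have := finite_dirichletChar hQ
  have := Fintype.ofFinite (DirichletChar Q)
  have hφ := totient_pos hQ hi
  have hlog : 0 < Real.log (Nat.card F) :=
    Real.log_pos (by exact_mod_cast (two_le_card (F := F)))
  have hsum : ∑ χ : DirichletChar Q with χ ≠ 1, ‖iteratedDeriv k (LFunction χ) (1 / 2)‖ ^ 2 *
      ‖iteratedDeriv l (LFunction χ) (1 / 2)‖ ^ 2 =
      Real.log (Nat.card F) ^ (2 * k + 2 * l) * ∑ χ : DirichletChar Q with χ ≠ 1,
        ‖∑ n ∈ Finset.range Q.natDegree, (((n : ℝ) ^ k : ℝ) : ℂ) * normCoeff χ n‖ ^ 2 *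
          ‖∑ n ∈ Finset.range Q.natDegree, (((n : ℝ) ^ l : ℝ) : ℂ) * normCoeff χ n‖ ^ 2 := by
    rw [Finset.mul_sum]
    refine Finset.sum_congr rfl fun χ hχ => ?_
    have hχ1 : χ ≠ 1 := (Finset.mem_filter.mp hχ).2
    rw [norm_iteratedDeriv_LFunction_sq hQ hχ1 k, norm_iteratedDeriv_LFunction_sq hQ hχ1 l, pow_add]
    ring
  rw [finsum_ne_one_eq_sum, hsum, sum_norm_sq_mul_norm_sq hQ hi hD (fun n => (n : ℝ) ^ k)
    (fun n => (n : ℝ) ^ l), averagedExpansion]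
  field_simp

theorem exists_abs_fourthMoment_sub_le (k l : ℕ) :
    ∃ (C : ℝ) (N : ℕ), ∀ (F : Type*) [Field F] [Finite F] (Q : F[X]),
      Q.Monic → Irreducible Q → N ≤ Q.natDegree →
      |1 / (totient Q : ℝ) * (1 / Real.log (Nat.card F) ^ (2 * k + 2 * l)) *
          (∑ᶠ (χ : DirichletChar Q) (_ : χ ≠ 1),
            ‖iteratedDeriv k (LFunction χ) (1 / 2)‖ ^ 2 *
              ‖iteratedDeriv l (LFunction χ) (1 / 2)‖ ^ 2)
        - (1 - (Nat.card F : ℝ)⁻¹) * (Q.natDegree : ℝ) ^ (2 * k + 2 * l + 4) *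
          ∫ a in region,
            f k (a 0 + a 2) (a 0 + a 3) 1 *
              f l (a 1 + a 3) (a 1 + a 2) 1|
      ≤ C * (Q.natDegree : ℝ) ^ (2 * (k : ℝ) + 2 * l + 7 / 2) := by
  obtain ⟨A, b, hA, h₁⟩ := abs_averagedExpansion_sub_diag_le
  obtain ⟨K₁, hK₁, h₂⟩ := sum_offBound_le hA b
  obtain ⟨K₂, hK₂, h₃⟩ := abs_sum_diag_sub_le k l
  -- The four contributions come from the off-diagonal, the weights and densities on the diagonal,
  -- the Riemann sum, and the trivial character. Only the first needs the exponent `7/2`; the others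
  -- lose at least one full power of `d`. All estimates hold in every positive degree, so `N = 0` is
  -- admissible.
  refine ⟨8450 * K₁ + K₂ + (16 * (k + l) + 24) + 100000, 0, fun F _ _ Q hQ hi _ => ?_⟩
  obtain ⟨D, hD⟩ := Nat.exists_eq_succ_of_ne_zero hi.natDegree_pos.ne'
  have := Fintype.ofFinite Fˣ
  have e₁ := h₁ F Q hQ hi D hD k l
  have e₂ := h₂ D
  have e₃ := h₃ F D
  have e₄ := abs_sum_coneTerm_sub_le k l D
  have e₅ := abs_trivial_contribution_le hQ hi hD
    (isDecayingKernel_evenKernel (two_le_card (F := F))) k l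
  rw [← abs_of_pos (totient_pos hQ hi), ← abs_div] at e₅
  rw [moment_eq_averagedExpansion hQ hi hD, hD, Nat.succ_eq_add_one, Nat.cast_add_one]
  change |_ - _ * ∫ a in region, integrand k l a| ≤ _
  set d : ℝ := (D : ℝ) + 1 with hd
  have hd1 : 1 ≤ d := le_add_of_nonneg_left (Nat.cast_nonneg _)
  set I := ∫ a in region, integrand k l a
  have hq0 : (0 : ℝ) ≤ (Nat.card F : ℝ)⁻¹ := by positivity
  have hq1 : (Nat.card F : ℝ)⁻¹ ≤ 1 :=
    inv_le_one_of_one_le₀ (by exact_mod_cast (two_le_card (F := F)).trans' one_le_two)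
  set E : ℝ := d ^ (2 * (k : ℝ) + 2 * l + 7 / 2) with hE
  have hpow : d ^ (2 * k + 2 * l) * d ^ (7 / 2 : ℝ) = E := by
    rw [hE, Real.rpow_add (by linarith), ← Real.rpow_natCast]
    push_cast
    rfl
  have hpow3 : d ^ (2 * k + 2 * l + 3) ≤ E := by
    rw [← hpow, pow_add]
    refine mul_le_mul_of_nonneg_left ?_ (by positivity)
    rw [← Real.rpow_natCast]
    exact Real.rpow_le_rpow_of_exponent_le hd1 (by norm_num)
  have hpow2 : d ^ (2 * k + 2 * l + 2) ≤ E :=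
    (pow_le_pow_right₀ hd1 (by omega)).trans hpow3
  have e₁' := e₁.trans (mul_le_mul_of_nonneg_left e₂ (by positivity))
  rw [show 8450 * d ^ (2 * k + 2 * l) * (K₁ * d ^ (7 / 2 : ℝ)) =
    8450 * K₁ * (d ^ (2 * k + 2 * l) * d ^ (7 / 2 : ℝ)) by ring, hpow] at e₁'
  have e₃' := e₃.trans (mul_le_mul_of_nonneg_left hpow3 hK₂)
  have e₅' := e₅.trans (mul_le_mul_of_nonneg_left hpow2 (by norm_num))
  have e₄' : |(1 - (Nat.card F : ℝ)⁻¹) * (∑ p ∈ cone D, coneTerm k l d p) -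
      (1 - (Nat.card F : ℝ)⁻¹) * d ^ (2 * k + 2 * l + 4) * I| ≤ (16 * (k + l) + 24) * E := by
    rw [mul_assoc, ← mul_sub, abs_mul, abs_of_nonneg (by linarith)]
    exact (mul_le_of_le_one_left (abs_nonneg _) (by linarith)).trans
      (e₄.trans (mul_le_mul_of_nonneg_left hpow3 (by positivity)))
  rw [abs_le] at e₁' e₃' e₄' e₅' ⊢
  constructor <;> linarith [e₁'.1, e₁'.2, e₃'.1, e₃'.2, e₄'.1, e₄'.2, e₅'.1, e₅'.2]

end FourthMoment

theorem theorem3 (k l : ℕ) :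
    ∃ (C : ℝ) (N : ℕ), ∀ (F : Type*) [Field F] [Finite F] (Q : F[X]),
      Q.Monic → Irreducible Q → N ≤ Q.natDegree →
      |1 / (FourthMoment.totient Q : ℝ) * (1 / Real.log (Nat.card F) ^ (2 * k + 2 * l)) *
          (∑ᶠ (χ : FourthMoment.DirichletChar Q) (_ : χ ≠ 1),
            ‖iteratedDeriv k (FourthMoment.LFunction χ) (1 / 2)‖ ^ 2 *
              ‖iteratedDeriv l (FourthMoment.LFunction χ) (1 / 2)‖ ^ 2)
        - (1 - (Nat.card F : ℝ)⁻¹) * (Q.natDegree : ℝ) ^ (2 * k + 2 * l + 4) *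
          ∫ a in FourthMoment.region,
            FourthMoment.f k (a 0 + a 2) (a 0 + a 3) 1 *
              FourthMoment.f l (a 1 + a 3) (a 1 + a 2) 1|
      ≤ C * (Q.natDegree : ℝ) ^ (2 * (k : ℝ) + 2 * l + 7 / 2) :=
  FourthMoment.exists_abs_fourthMoment_sub_le k l
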